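/- Let $X,T\subset\mathbb{R}^2$ be finite sets (sensor locations and targets), $m=|X|$, $n=|T|$, and let $\alpha\in[0,\pi/3]$, $R\in\mathbb{R}$ and $\delta>1$. A pair of distinct sensors $s\ne s'$ *$\beta$-covers* a target $t\notin\{s,s'\}$ if $\angle sts'\in[\beta,\pi-\beta]$; a set $S$ *$\beta$-covers $T$ within distance $R$* if every $t\in T$ is $\beta$-covered by some pair of sensors of $S$ that are both at Euclidean distance at most $R$ from $t$. Assume that $X$ itself $\alpha$-covers $T$ within distance $R$, and let $k_{\mathsf{OPT}}$ be the smallest size of a subset of $X$ that $\alpha$-covers $T$ within distance $R$. Put $L_\delta=\max\{1,\log_2\delta\}$. Then there is a (deterministic) algorithm and an absolute constant $C$ such that on every such input $(X,T,\alpha,R,\delta)$ the algorithm finds a set $S\subseteq X$ that $((1-1/\delta)\alpha)$-covers $T$ within distance $R$ and satisfies $$|S|\le C\cdot L_\delta\cdot\log k_{\mathsf{OPT}}\cdot k_{\mathsf{OPT}},$$ (where $\log 0=0$, for the case $T=\emptyset$), and its running time is at most $$C\cdot\bigl(L_\delta\cdot k_{\mathsf{OPT}}\cdot m\,n\,\log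 m+1\bigr)$$ (where a product with a factor $k_{\mathsf{OPT}}=0$ is $0$). Running time is counted on a real RAM: unit-cost exact arithmetic $+,-,\times,/$, square root, $\arccos$ and comparison on real numbers; addition, truncated subtraction, comparison and indirect addressing on natural numbers; conversion of natural numbers to reals, but no rounding of reals. The points are given by their coordinates, in arbitrary order. -/

import Mathlib

/-! ### Angular coverage of targets by pairs of sensors -/

/-- The Euclidean plane. -/
abbrev Plane : Type := EuclideanSpace ℝ (Fin 2)

/-- The pair of distinct sensors `s`, `s'` `β`-covers the target `t`: the angle `∠ s t s'`
is defined (so neither sensor sits at `t`) and lies in `[β, π - β]`. -/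
def PairCovers (β : ℝ) (s s' t : Plane) : Prop :=
  s ≠ s' ∧ s ≠ t ∧ s' ≠ t ∧ EuclideanGeometry.angle s t s' ∈ Set.Icc β (Real.pi - β)

/-- The set `S` of sensors `β`-covers the set `T` of targets within distance `R`: every target is
`β`-covered by some pair from `S` both of whose members are at distance at most `R` from it. -/
def CoversWithin (β R : ℝ) (S T : Finset Plane) : Prop :=
  ∀ t ∈ T, ∃ s ∈ S, ∃ s' ∈ S, PairCovers β s s' t ∧ dist s t ≤ R ∧ dist s' t ≤ R

/-- The size of a smallest subset of `X` that `α`-covers `T` within distance `R`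
(the set of sizes is nonempty as soon as `X` itself is feasible). -/
noncomputable def kOpt (α R : ℝ) (X T : Finset Plane) : ℕ :=
  sInf {k : ℕ | ∃ S ⊆ X, CoversWithin α R S T ∧ S.card = k}

/-! ### A real random access machine

Programs of a small imperative language that work on arrays of natural numbers and arrays of real
numbers. Every operation, memory access, comparison and assignment costs one unit of time.
The array names in a program are fixed, the indices are computed (indirect addressing).
On natural numbers there are only addition and truncated subtraction; on real numbers there are
the field operations, square root and arccosine; there is no rounding of reals to integers
and the only constants are natural numbers. -/

namespace RealRAM

/-- Memory: `nat a i` and `real a i` are the cells with index `i` of the arrays named `a`. -/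
structure Store where
  nat : ℕ → ℕ → ℕ
  real : ℕ → ℕ → ℝ

/-- Write `v` to cell `i` of the natural number array `a`. -/
def Store.setNat (σ : Store) (a i v : ℕ) : Store :=
  { σ with nat := Function.update σ.nat a (Function.update (σ.nat a) i v) }

/-- Write `v` to cell `i` of the real array `a`. -/
noncomputable def Store.setReal (σ : Store) (a i : ℕ) (v : ℝ) : Store :=
  { σ with real := Function.update σ.real a (Function.update (σ.real a) i v) }

/-- Expressions with natural number values. -/
inductive NExp : Type
  | const (c : ℕ)
  | get (a : ℕ) (i : NExp)
  | add (e₁ e₂ : NExp)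
  | sub (e₁ e₂ : NExp)

/-- The value of an expression. -/
def NExp.eval (σ : Store) : NExp → ℕ
  | const c => c
  | get a i => σ.nat a (i.eval σ)
  | add e₁ e₂ => e₁.eval σ + e₂.eval σ
  | sub e₁ e₂ => e₁.eval σ - e₂.eval σ

/-- The time to evaluate an expression: one unit for each operation in it. -/
def NExp.cost : NExp → ℕ
  | const _ => 1
  | get _ i => i.cost + 1
  | add e₁ e₂ => e₁.cost + e₂.cost + 1
  | sub e₁ e₂ => e₁.cost + e₂.cost + 1

/-- Expressions with real values. -/
inductive RExp : Type
  | ofNat (e : NExp)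
  | get (a : ℕ) (i : NExp)
  | add (e₁ e₂ : RExp)
  | sub (e₁ e₂ : RExp)
  | mul (e₁ e₂ : RExp)
  | div (e₁ e₂ : RExp)
  | sqrt (e : RExp)
  | arccos (e : RExp)

/-- The value of an expression (division by zero gives `0`, the square root of a negative number
is `0`, and the argument of `arccos` is first clamped to `[-1, 1]`). -/
noncomputable def RExp.eval (σ : Store) : RExp → ℝ
  | ofNat e => (e.eval σ : ℝ)
  | get a i => σ.real a (i.eval σ)
  | add e₁ e₂ => e₁.eval σ + e₂.eval σ
  | sub e₁ e₂ => e₁.eval σ - e₂.eval σ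
  | mul e₁ e₂ => e₁.eval σ * e₂.eval σ
  | div e₁ e₂ => e₁.eval σ / e₂.eval σ
  | sqrt e => Real.sqrt (e.eval σ)
  | arccos e => Real.arccos (e.eval σ)

/-- The time to evaluate an expression. -/
def RExp.cost : RExp → ℕ
  | ofNat e => e.cost + 1
  | get _ i => i.cost + 1
  | add e₁ e₂ => e₁.cost + e₂.cost + 1
  | sub e₁ e₂ => e₁.cost + e₂.cost + 1
  | mul e₁ e₂ => e₁.cost + e₂.cost + 1
  | div e₁ e₂ => e₁.cost + e₂.cost + 1
  | sqrt e => e.cost + 1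
  | arccos e => e.cost + 1

/-- Tests: exact comparisons and their Boolean combinations. -/
inductive Test : Type
  | leNat (e₁ e₂ : NExp)
  | leReal (e₁ e₂ : RExp)
  | neg (b : Test)
  | conj (b₁ b₂ : Test)

/-- Whether a test succeeds. -/
def Test.Holds (σ : Store) : Test → Prop
  | leNat e₁ e₂ => e₁.eval σ ≤ e₂.eval σ
  | leReal e₁ e₂ => e₁.eval σ ≤ e₂.eval σ
  | neg b => ¬ b.Holds σ
  | conj b₁ b₂ => b₁.Holds σ ∧ b₂.Holds σ

/-- The time to evaluate a test. -/
def Test.cost : Test → ℕ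
  | leNat e₁ e₂ => e₁.cost + e₂.cost + 1
  | leReal e₁ e₂ => e₁.cost + e₂.cost + 1
  | neg b => b.cost + 1
  | conj b₁ b₂ => b₁.cost + b₂.cost + 1

/-- Programs. -/
inductive Program : Type
  | skip
  | assignNat (a : ℕ) (i e : NExp)
  | assignReal (a : ℕ) (i : NExp) (e : RExp)
  | seq (p q : Program)
  | branch (b : Test) (p q : Program)
  | loop (b : Test) (p : Program)

/-- `Runs p σ τ σ'`: started with memory `σ`, the program `p` halts after exactly `τ` steps with
memory `σ'`. -/
inductive Runs : Program → Store → ℕ → Store → Prop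
  | skip (σ : Store) : Runs .skip σ 1 σ
  | assignNat (σ : Store) (a : ℕ) (i e : NExp) :
      Runs (.assignNat a i e) σ (i.cost + e.cost + 1) (σ.setNat a (i.eval σ) (e.eval σ))
  | assignReal (σ : Store) (a : ℕ) (i : NExp) (e : RExp) :
      Runs (.assignReal a i e) σ (i.cost + e.cost + 1) (σ.setReal a (i.eval σ) (e.eval σ))
  | seq {p q : Program} {σ σ₁ σ₂ : Store} {τ₁ τ₂ : ℕ} :
      Runs p σ τ₁ σ₁ → Runs q σ₁ τ₂ σ₂ → Runs (.seq p q) σ (τ₁ + τ₂) σ₂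
  | branch_true {b : Test} {p q : Program} {σ σ₁ : Store} {τ : ℕ} :
      b.Holds σ → Runs p σ τ σ₁ → Runs (.branch b p q) σ (b.cost + 1 + τ) σ₁
  | branch_false {b : Test} {p q : Program} {σ σ₁ : Store} {τ : ℕ} :
      ¬ b.Holds σ → Runs q σ τ σ₁ → Runs (.branch b p q) σ (b.cost + 1 + τ) σ₁
  | loop_done {b : Test} {p : Program} {σ : Store} :
      ¬ b.Holds σ → Runs (.loop b p) σ (b.cost + 1) σ
  | loop_step {b : Test} {p : Program} {σ σ₁ σ₂ : Store} {τ₁ τ₂ : ℕ} :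
      b.Holds σ → Runs p σ τ₁ σ₁ → Runs (.loop b p) σ₁ τ₂ σ₂ →
        Runs (.loop b p) σ (b.cost + 1 + τ₁ + τ₂) σ₂

end RealRAM

/-! ### Input and output of a sensor placement program -/

/-- The array that holds coordinate `c` of the points of the list `x`, followed by zeros. -/
noncomputable def coordArray {m : ℕ} (x : Fin m → Plane) (c : Fin 2) : ℕ → ℝ :=
  fun i => if h : i < m then x ⟨i, h⟩ c else 0

/-- The initial memory: natural number array `0` holds the number of sensor locations
and the number of targets; real arrays `0` and `1` hold the coordinates of the sensor locations,
`2` and `3` those of the targets; real array `4` holds `α`, `R`, `δ`. All other cells are zero. -/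
noncomputable def inputStore {m n : ℕ} (x : Fin m → Plane) (t : Fin n → Plane) (α R δ : ℝ) :
    RealRAM.Store where
  nat a i := match a, i with
    | 0, 0 => m
    | 0, 1 => n
    | _, _ => 0
  real a i := match a, i with
    | 0, i => coordArray x 0 i
    | 1, i => coordArray x 1 i
    | 2, i => coordArray t 0 i
    | 3, i => coordArray t 1 i
    | 4, 0 => α
    | 4, 1 => R
    | 4, 2 => δ
    | _, _ => 0

/-- The set of sensors in the final memory: sensor location number `i` is selected iff
cell `i` of natural number array `1` is not zero. -/
noncomputable def outputSet {m : ℕ} (x : Fin m → Plane) (σ : RealRAM.Store) : Finset Plane :=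
  (Finset.univ.filter fun i : Fin m => σ.nat 1 i ≠ 0).image x

/-!
Around a target `t`, only the lines through `t` matter: a pair of sensors `β`-covers `t` iff the
lines from `t` to the two sensors form an angle (in `[0, π / 2]`, `lineAngle`) of at least `β`
(`angle_mem_Icc_iff`). The algorithm keeps for every target a pair of selected sensors within
distance `R`, with line angle `w`, and improves it in rounds. If `w < α ≤ π / 3` and two lines form
an angle of at least `α`, then one of them forms an angle of at least `(α + w) / 2` with a line of
the current pair (`exists_far_line`). Hence an optimal set of sensors contains for each target one
that at least halves the gap between `w` and `α`, and it suffices to find in each round a small set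
of sensors that hits, for every target, the set of these improving sensors (`Scene.farRow`). After
about `log₂ δ` rounds the gap is at most `α / δ`.

Each round is a hitting set problem with optimum at most `k = kOpt`, whose sets are Boolean
combinations of five sets `{f ≥ 0}` with quadratic `f`. So they have at most `(|A| + 1) ^ 30` traces
on a set `A` of sensors (`card_traces_le_of_quadrics`, from the Sauer–Shelah lemma), and a hitting
set of size `O(k log k)` can be found deterministically as follows. The number `k` is guessed, in
powers of two. Given a probability distribution on `A` that gives mass at least `φ` to each set,
greedy picks with multiplicative weights on the sets turn it into a uniform distribution on `p`
picked sensors (with multiplicities) that gives mass at least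
`(1 - η) (φ - 30 log (|A| + 1) / (η p))` to each set (`Picked.fractional`, `Thinned`). The logarithm
is that of the number of different traces on `A`; for this reason only one representative of each
trace gets a weight. The first such step, with `p = O(k log m)`, starts from the uniform
distribution on an optimal solution, which the algorithm need not know. The later ones have
`p = 2 ^ 20 * k * log k * 8 ^ j` for decreasing `j`, and rates `η = 2 ^ (- j - 3)`, so that all
losses together are at most a factor of four (`level`, `Thinned.fractional_step`). After the step
`j = 0` every set still has positive mass, so that the picked sensors are a hitting set. A pick
takes time `O(m n)`, and the numbers of picks form a geometric series dominated by `k log m`.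

The program is verified in a calculus of total correctness with time bounds (`Achieves`); the
numerical constants in the time bounds are generous.
-/

open Finset

/-! ### Total correctness with a time bound for programs of the real RAM -/

namespace RealRAM

/-- The natural number arrays that a program may write to. -/
def Program.natMods : Program → List ℕ
  | .skip => []
  | .assignNat a _ _ => [a]
  | .assignReal _ _ _ => []
  | .seq p q => p.natMods ++ q.natMods
  | .branch _ p q => p.natMods ++ q.natMods
  | .loop _ p => p.natMods

/-- The real arrays that a program may write to. -/
def Program.realMods : Program → List ℕ
  | .skip => []
  | .assignNat _ _ _ => []
  | .assignReal a _ _ => [a]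
  | .seq p q => p.realMods ++ q.realMods
  | .branch _ p q => p.realMods ++ q.realMods
  | .loop _ p => p.realMods

/-- The memories `σ` and `σ'` agree on all arrays that `p` does not write to. -/
structure Frame (p : Program) (σ σ' : Store) : Prop where
  nat : ∀ a, a ∉ p.natMods → σ'.nat a = σ.nat a
  real : ∀ a, a ∉ p.realMods → σ'.real a = σ.real a

/-- Started with memory `σ`, the program `p` halts after at most `τ` steps, and the final memory
satisfies `Q`. -/
def Achieves (p : Program) (τ : ℕ) (Q : Store → Prop) (σ : Store) : Prop :=
  ∃ t σ', Runs p σ t σ' ∧ t ≤ τ ∧ Q σ'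

@[simp] theorem Store.setNat_nat (σ : Store) (a i v b j : ℕ) :
    (σ.setNat a i v).nat b j = if b = a ∧ j = i then v else σ.nat b j := by
  by_cases hb : b = a
  · subst hb
    by_cases hj : j = i <;> simp [Store.setNat, hj]
  · simp [Store.setNat, hb]

@[simp] theorem Store.setNat_real (σ : Store) (a i v : ℕ) : (σ.setNat a i v).real = σ.real := rfl

@[simp] theorem Store.setReal_nat (σ : Store) (a i : ℕ) (v : ℝ) :
    (σ.setReal a i v).nat = σ.nat := rfl

@[simp] theorem Store.setReal_real (σ : Store) (a i : ℕ) (v : ℝ) (b j : ℕ) :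
    (σ.setReal a i v).real b j = if b = a ∧ j = i then v else σ.real b j := by
  by_cases hb : b = a
  · subst hb
    by_cases hj : j = i <;> simp [Store.setReal, hj]
  · simp [Store.setReal, hb]

theorem Store.setNat_nat_of_ne (σ : Store) {a b : ℕ} (i v : ℕ) (h : b ≠ a) :
    (σ.setNat a i v).nat b = σ.nat b := by
  simp [Store.setNat, h]

theorem Frame.refl (p : Program) (σ : Store) : Frame p σ σ := ⟨fun _ _ => rfl, fun _ _ => rfl⟩

theorem Frame.trans {p : Program} {σ σ₁ σ₂ : Store} (h : Frame p σ σ₁) (h' : Frame p σ₁ σ₂) :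
    Frame p σ σ₂ :=
  ⟨fun a ha => (h'.nat a ha).trans (h.nat a ha), fun a ha => (h'.real a ha).trans (h.real a ha)⟩

theorem Frame.mono {p q : Program} {σ σ' : Store} (h : Frame p σ σ')
    (hn : ∀ a ∈ p.natMods, a ∈ q.natMods) (hr : ∀ a ∈ p.realMods, a ∈ q.realMods) :
    Frame q σ σ' :=
  ⟨fun a ha => h.nat a fun h' => ha (hn a h'), fun a ha => h.real a fun h' => ha (hr a h')⟩

theorem Runs.frame {p : Program} {σ σ' : Store} {τ : ℕ} (h : Runs p σ τ σ') : Frame p σ σ' := by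
  induction h with
  | skip σ => exact Frame.refl _ _
  | assignNat σ a i e =>
    refine ⟨fun b hb => ?_, fun _ _ => rfl⟩
    exact Store.setNat_nat_of_ne _ _ _ (by simpa [Program.natMods] using hb)
  | assignReal σ a i e =>
    refine ⟨fun _ _ => rfl, fun b hb => ?_⟩
    have : b ≠ a := by simpa [Program.realMods] using hb
    simp [Store.setReal, this]
  | seq _ _ h₁ h₂ =>
    exact (h₁.mono (by simp +contextual [Program.natMods])
      (by simp +contextual [Program.realMods])).trans
      (h₂.mono (by simp +contextual [Program.natMods]) (by simp +contextual [Program.realMods]))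
  | branch_true _ _ h =>
    exact h.mono (by simp +contextual [Program.natMods]) (by simp +contextual [Program.realMods])
  | branch_false _ _ h =>
    exact h.mono (by simp +contextual [Program.natMods]) (by simp +contextual [Program.realMods])
  | loop_done _ => exact Frame.refl _ _
  | loop_step _ _ _ h₁ h₂ =>
    exact (h₁.mono (by simp [Program.natMods]) (by simp [Program.realMods])).trans h₂

namespace Achieves

variable {p q : Program} {τ τ₁ τ₂ : ℕ} {Q Q' : Store → Prop} {σ : Store}

theorem mono (h : Achieves p τ₁ Q σ) (hτ : τ₁ ≤ τ₂) (hQ : ∀ σ', Q σ' → Q' σ') :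
    Achieves p τ₂ Q' σ := by
  obtain ⟨t, σ', h₁, h₂, h₃⟩ := h
  exact ⟨t, σ', h₁, h₂.trans hτ, hQ _ h₃⟩

/-- A postcondition may be proved with the knowledge that only the arrays that the program
mentions as targets of assignments have changed. -/
theorem imp (h : Achieves p τ₁ Q σ) (hτ : τ₁ ≤ τ₂) (hQ : ∀ σ', Frame p σ σ' → Q σ' → Q' σ') :
    Achieves p τ₂ Q' σ := by
  obtain ⟨t, σ', h₁, h₂, h₃⟩ := h
  exact ⟨t, σ', h₁, h₂.trans hτ, hQ _ h₁.frame h₃⟩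

theorem seq (h : Achieves p τ₁ (fun σ₁ => Achieves q τ₂ Q σ₁) σ) (hτ : τ₁ + τ₂ ≤ τ) :
    Achieves (.seq p q) τ Q σ := by
  obtain ⟨t₁, σ₁, h₁, h₁', t₂, σ₂, h₂, h₂', hQ⟩ := h
  exact ⟨_, _, .seq h₁ h₂, (Nat.add_le_add h₁' h₂').trans hτ, hQ⟩

theorem branch {b : Test} (h₁ : b.Holds σ → Achieves p τ₁ Q σ)
    (h₂ : ¬ b.Holds σ → Achieves q τ₁ Q σ) (hτ : b.cost + 1 + τ₁ ≤ τ) :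
    Achieves (.branch b p q) τ Q σ := by
  by_cases h : b.Holds σ
  · obtain ⟨t, σ', hr, ht, hQ⟩ := h₁ h
    exact ⟨_, _, .branch_true h hr, by omega, hQ⟩
  · obtain ⟨t, σ', hr, ht, hQ⟩ := h₂ h
    exact ⟨_, _, .branch_false h hr, by omega, hQ⟩

/-- Loops: the invariant `I` is indexed by the time that is left, which decreases with every
pass and thus proves termination as well. -/
theorem loop {b : Test} (I : ℕ → Store → Prop)
    (hI : ∀ τ σ, I τ σ → (¬ b.Holds σ → b.cost + 1 ≤ τ ∧ Q σ) ∧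
      (b.Holds σ → ∃ τ₁ τ₂, b.cost + 1 + τ₁ + τ₂ ≤ τ ∧ Achieves p τ₁ (I τ₂) σ))
    (h : I τ σ) : Achieves (.loop b p) τ Q σ := by
  induction τ using Nat.strong_induction_on generalizing σ with
  | _ τ ih =>
    by_cases hb : b.Holds σ
    · obtain ⟨τ₁, τ₂, hτ, t, σ₁, hr, ht, hI₁⟩ := (hI τ σ h).2 hb
      obtain ⟨t', σ₂, hr', ht', hQ⟩ := ih τ₂ (by omega) hI₁
      exact ⟨_, _, .loop_step hb hr hr', by omega, hQ⟩
    · obtain ⟨hτ, hQ⟩ := (hI τ σ h).1 hb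
      exact ⟨_, _, .loop_done hb, hτ, hQ⟩

end Achieves

/-- The weakest precondition of a program without loops. -/
def Program.wp : Program → (Store → Prop) → Store → Prop
  | .skip, Q, σ => Q σ
  | .assignNat a i e, Q, σ => Q (σ.setNat a (i.eval σ) (e.eval σ))
  | .assignReal a i e, Q, σ => Q (σ.setReal a (i.eval σ) (e.eval σ))
  | .seq p q, Q, σ => p.wp (q.wp Q) σ
  | .branch b p q, Q, σ => (b.Holds σ → p.wp Q σ) ∧ (¬ b.Holds σ → q.wp Q σ)
  | .loop _ _, _, _ => False

/-- A bound for the running time of a program without loops. -/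
def Program.time : Program → ℕ
  | .skip => 1
  | .assignNat _ i e => i.cost + e.cost + 1
  | .assignReal _ i e => i.cost + e.cost + 1
  | .seq p q => p.time + q.time
  | .branch b p q => b.cost + 1 + (p.time + q.time)
  | .loop _ _ => 0

theorem Achieves.of_wp {p : Program} {Q : Store → Prop} {σ : Store} {τ : ℕ} (h : p.wp Q σ)
    (hτ : p.time ≤ τ) : Achieves p τ Q σ := by
  suffices H : Achieves p p.time Q σ from H.mono hτ fun _ h => h
  clear hτ
  induction p generalizing σ Q with
  | skip => exact ⟨_, _, .skip σ, le_rfl, h⟩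
  | assignNat a i e => exact ⟨_, _, .assignNat σ a i e, le_rfl, h⟩
  | assignReal a i e => exact ⟨_, _, .assignReal σ a i e, le_rfl, h⟩
  | seq p q ihp ihq => exact (ihp (Q := q.wp Q) h).mono le_rfl (fun σ' h' => ihq h') |>.seq le_rfl
  | branch b p q ihp ihq =>
    refine Achieves.branch (τ₁ := p.time + q.time) (fun hb => ?_) (fun hb => ?_) le_rfl
    · exact (ihp (h.1 hb)).mono (by omega) fun _ h => h
    · exact (ihq (h.2 hb)).mono (by omega) fun _ h => h
  | loop b p _ => exact h.elim

/-- The loop `for v = 0, …, n - 1`, where `n` is the number in cell `j` of array `0`. -/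
def forLoop (v j : ℕ) (body : Program) : Program :=
  .seq (.assignNat v (.const 0) (.const 0))
    (.loop (.neg (.leNat (.get 0 (.const j)) (.get v (.const 0))))
      (.seq body (.assignNat v (.const 0) (.add (.get v (.const 0)) (.const 1)))))

theorem natMods_forLoop (v j : ℕ) (body : Program) :
    (forLoop v j body).natMods = v :: (body.natMods ++ [v]) := rfl

theorem realMods_forLoop (v j : ℕ) (body : Program) :
    (forLoop v j body).realMods = body.realMods ++ [] := rfl

theorem Achieves.forLoop {v j n τ τ' : ℕ} {body : Program} {σ₀ : Store} {Q : Store → Prop}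
    (I : ℕ → Store → Prop) (hn : σ₀.nat 0 j = n) (hv : v ≠ 0) (h0 : 0 ∉ body.natMods)
    (hvb : v ∉ body.natMods) (init : I 0 (σ₀.setNat v 0 0))
    (step : ∀ i < n, ∀ σ, Frame (forLoop v j body) σ₀ σ → σ.nat v 0 = i → I i σ →
      Achieves body τ (fun σ' => I (i + 1) (σ'.setNat v 0 (i + 1))) σ)
    (hQ : ∀ σ, Frame (RealRAM.forLoop v j body) σ₀ σ → I n σ → Q σ)
    (hτ : n * (τ + 13) + 10 ≤ τ') :
    Achieves (RealRAM.forLoop v j body) τ' Q σ₀ := by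
  have hF0 : Frame (RealRAM.forLoop v j body) σ₀ (σ₀.setNat v 0 0) := by
    refine ⟨fun a ha => ?_, fun _ _ => rfl⟩
    rw [natMods_forLoop] at ha
    exact Store.setNat_nat_of_ne _ _ _ fun h => ha (by simp [h])
  refine Achieves.seq (τ₁ := 3) (τ₂ := n * (τ + 13) + 7) ?_ (by omega)
  refine ⟨3, _, .assignNat σ₀ v (.const 0) (.const 0), le_rfl, ?_⟩
  refine Achieves.loop (fun τ'' σ => ∃ i ≤ n, Frame (RealRAM.forLoop v j body) σ₀ σ ∧
    σ.nat v 0 = i ∧ I i σ ∧ (n - i) * (τ + 13) + 7 ≤ τ'') ?_ ?_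
  · rintro τ'' σ ⟨i, hi, hF, hvi, hI, hle⟩
    have h0' : σ.nat 0 j = n := by
      rw [hF.nat 0 (by rw [natMods_forLoop]; simp [h0, hv.symm]), hn]
    constructor
    · intro hb
      simp only [Test.Holds, NExp.eval, h0', hvi, not_not] at hb
      obtain rfl : i = n := le_antisymm hi hb
      exact ⟨le_trans (by simp [Test.cost, NExp.cost]) hle, hQ σ hF hI⟩
    · intro hb
      simp only [Test.Holds, NExp.eval, h0', hvi, not_le] at hb
      refine ⟨τ + 6, (n - (i + 1)) * (τ + 13) + 7, ?_, ?_⟩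
      · have : n - i = (n - (i + 1)) + 1 := by omega
        rw [this, Nat.add_mul] at hle
        simp only [Test.cost, NExp.cost]
        omega
      · refine Achieves.seq (τ₁ := τ) (τ₂ := 6) ?_ le_rfl
        refine (step i hb σ hF hvi hI).imp le_rfl fun σ' hF' hI' => ?_
        have hv' : σ'.nat v 0 = i := by rw [hF'.nat v hvb, hvi]
        refine ⟨6, _, .assignNat σ' _ _ _, le_rfl, i + 1, hb, ?_, ?_, ?_, le_rfl⟩
        · refine hF.trans ⟨fun a ha => ?_, fun a ha => ?_⟩
          · rw [natMods_forLoop] at ha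
            simp only [List.mem_cons, List.mem_append, List.not_mem_nil, or_false, not_or] at ha
            rw [Store.setNat_nat_of_ne _ _ _ ha.1, hF'.nat a ha.2.1]
          · rw [realMods_forLoop] at ha
            simp only [List.append_nil] at ha
            exact hF'.real a ha
        · simp [NExp.eval, hv']
        · simpa [NExp.eval, hv'] using hI'
  · exact ⟨0, Nat.zero_le _, hF0, by simp [NExp.eval], init, by simp⟩

end RealRAM

/-! ### The number of traces of quadrics -/

/-- The quadratic polynomial in two variables with the given coefficients. -/
def quadric (a : Fin 6 → ℝ) (u v : ℝ) : ℝ :=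
  a 0 + a 1 * u + a 2 * v + a 3 * (u * u) + a 4 * (u * v) + a 5 * (v * v)

/-- Sets of the form `{f ≥ 0}` for quadratic `f` shatter no set of more than six points:
the evaluations of the quadratic polynomials at seven points satisfy a nontrivial linear relation,
and no quadratic polynomial can have the sign pattern of its coefficients. -/
theorem card_le_six_of_quadrics_shatter {n : ℕ} (pu pv : ℕ → ℝ) (q : ℕ → Fin 6 → ℝ)
    (A B : Finset ℕ)
    (h : ((range n).image fun t => A.filter fun s => 0 ≤ quadric (q t) (pu s) (pv s)).Shatters B) :
    B.card ≤ 6 := by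
  classical
  by_contra! hB
  -- the evaluation map at the points of `B`, as vectors in the dual of the coefficient space
  let ev : B → (Fin 6 → ℝ) := fun s =>
    ![1, pu s, pv s, pu s * pu s, pu s * pv s, pv s * pv s]
  have hev : ∀ a (s : B), quadric a (pu s) (pv s) = ∑ i, a i * ev s i := by
    intro a s
    simp [quadric, ev, Fin.sum_univ_six]
  have hdep : ¬ LinearIndependent ℝ ev := by
    intro hli
    have := hli.fintype_card_le_finrank
    simp at this
    omega
  obtain ⟨c, hc, s₀, hs₀⟩ := Fintype.not_linearIndependent_iff.1 hdep
  have hrel : ∀ a, ∑ s : B, c s * quadric a (pu s) (pv s) = 0 := by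
    intro a
    simp_rw [hev, mul_sum]
    rw [sum_comm]
    refine sum_eq_zero fun i _ => ?_
    have := congrFun hc i
    simp only [Finset.sum_apply, Pi.smul_apply, smul_eq_mul, Pi.zero_apply] at this
    calc ∑ s : B, c s * (a i * ev s i) = a i * ∑ s : B, c s * ev s i := by
          rw [mul_sum]; exact sum_congr rfl fun _ _ => by ring
      _ = 0 := by rw [this, mul_zero]
  -- a relation in which some coefficient is negative
  obtain ⟨c', hc', s₁, hs₁⟩ : ∃ c' : B → ℝ,
      (∀ a, ∑ s : B, c' s * quadric a (pu s) (pv s) = 0) ∧ ∃ s₁, c' s₁ < 0 := by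
    rcases lt_or_gt_of_ne hs₀ with h0 | h0
    · exact ⟨c, hrel, s₀, h0⟩
    · refine ⟨fun s => - c s, fun a => ?_, s₀, by simpa using h0⟩
      simpa using hrel a
  obtain ⟨u, hu, hu'⟩ := h (t := B.filter fun s => ∃ hs : s ∈ B, 0 ≤ c' ⟨s, hs⟩)
    (filter_subset _ _)
  obtain ⟨t, -, rfl⟩ := mem_image.1 hu
  have hBA : ∀ s ∈ B, s ∈ A := by
    obtain ⟨u, hu, hu'⟩ := h (t := B) Subset.rfl
    obtain ⟨t', -, rfl⟩ := mem_image.1 hu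
    intro s hs
    rw [← hu'] at hs
    exact (mem_filter.1 (mem_inter.1 hs).2).1
  have hiff : ∀ s : B, 0 ≤ c' s ↔ 0 ≤ quadric (q t) (pu s) (pv s) := by
    intro s
    have := Finset.ext_iff.1 hu' s
    simp only [mem_inter, mem_filter, s.2, hBA s s.2, true_and, Subtype.coe_eta,
      exists_prop] at this
    simpa using this.symm
  have hpos : 0 < ∑ s : B, c' s * quadric (q t) (pu s) (pv s) := by
    refine sum_pos' (fun s _ => ?_) ⟨s₁, mem_univ _, ?_⟩
    · by_cases hs : 0 ≤ c' s
      · exact mul_nonneg hs ((hiff s).1 hs)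
      · have := (hiff s).not.1 hs
        exact mul_nonneg_of_nonpos_of_nonpos (not_le.1 hs).le (not_le.1 this).le
    · have := (hiff s₁).not.1 (not_le.2 hs₁)
      exact mul_pos_of_neg_of_neg hs₁ (not_le.1 this)
  exact hpos.ne' (hc' _)

theorem card_powerset_filter_card_le_six (A : Finset ℕ) :
    ((A.powerset).filter fun B => B.card ≤ 6).card ≤ (A.card + 1) ^ 6 := by
  classical
  -- every set of at most six elements is the range of a sextuple over `A` and a blank
  have : ((A.powerset).filter fun B => B.card ≤ 6) ⊆
      (Fintype.piFinset fun _ : Fin 6 => insertNone A).image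
        fun f => univ.biUnion fun i => (f i).toFinset := by
    intro B hB
    rw [mem_filter, mem_powerset] at hB
    refine mem_image.2 ⟨fun i => B.toList[(i : ℕ)]?, ?_, ?_⟩
    · rw [Fintype.mem_piFinset]
      intro i
      rw [mem_insertNone]
      intro a ha
      exact hB.1 (mem_toList.1 (List.mem_of_getElem? ha))
    · ext a
      simp only [mem_biUnion, mem_univ, true_and, Option.mem_toFinset, Option.mem_def]
      constructor
      · rintro ⟨i, hi⟩
        exact mem_toList.1 (List.mem_of_getElem? hi)
      · intro ha
        obtain ⟨i, hi, h⟩ := List.getElem_of_mem (mem_toList.2 ha)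
        have hi' := hi
        rw [length_toList] at hi'
        refine ⟨⟨i, by omega⟩, ?_⟩
        simp [hi', h]
  refine (card_le_card this).trans (card_image_le.trans ?_)
  simp [Fintype.card_piFinset]

/-- The Sauer–Shelah bound for sets `{f ≥ 0}` with quadratic `f`. -/
theorem card_traces_quadrics_le (n : ℕ) (pu pv : ℕ → ℝ) (q : ℕ → Fin 6 → ℝ) (A : Finset ℕ) :
    ((range n).image fun t => A.filter fun s => 0 ≤ quadric (q t) (pu s) (pv s)).card ≤
      (A.card + 1) ^ 6 := by
  classical
  refine (card_le_card_shatterer _).trans ((card_le_card ?_).trans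
    (card_powerset_filter_card_le_six A))
  intro B hB
  rw [mem_shatterer] at hB
  refine mem_filter.2 ⟨mem_powerset.2 ?_, card_le_six_of_quadrics_shatter pu pv q A B hB⟩
  obtain ⟨u, hu, hu'⟩ := hB (t := B) Subset.rfl
  obtain ⟨t, -, rfl⟩ := mem_image.1 hu
  rw [← hu']
  exact inter_subset_right.trans (filter_subset _ _)

/-- A family of sets that are Boolean combinations of five quadrics has polynomially many
traces. -/
theorem card_traces_le_of_quadrics (n : ℕ) (pu pv : ℕ → ℝ) (q : Fin 5 → ℕ → Fin 6 → ℝ)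
    (F : (Fin 5 → Prop) → Prop) (B : ℕ → Finset ℕ) (A : Finset ℕ)
    (hB : ∀ t < n, ∀ s ∈ A, s ∈ B t ↔ F fun i => 0 ≤ quadric (q i t) (pu s) (pv s)) :
    ((range n).image fun t => A ∩ B t).card ≤ (A.card + 1) ^ 30 := by
  classical
  have : ((range n).image fun t => A ∩ B t) ⊆
      (Fintype.piFinset fun i => (range n).image fun t =>
        A.filter fun s => 0 ≤ quadric (q i t) (pu s) (pv s)).image
        fun f => A.filter fun s => F fun i => s ∈ f i := by
    intro C hC
    obtain ⟨t, ht, rfl⟩ := mem_image.1 hC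
    refine mem_image.2 ⟨fun i => A.filter fun s => 0 ≤ quadric (q i t) (pu s) (pv s), ?_, ?_⟩
    · rw [Fintype.mem_piFinset]
      exact fun i => mem_image_of_mem _ ht
    · ext s
      rw [mem_filter, mem_inter]
      refine and_congr_right fun hs => ?_
      rw [hB t (mem_range.1 ht) s hs]
      simp [hs]
  refine (card_le_card this).trans (card_image_le.trans ?_)
  rw [Fintype.card_piFinset]
  refine (prod_le_prod' fun i _ => card_traces_quadrics_le n pu pv (q i) A).trans ?_
  simp [← pow_mul]

/-! ### Fractional hitting sets and multiplicative weights -/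

/-- There is a probability distribution on the set `A` of columns that gives mass at least `φ`
to each of the rows `B 0, …, B (n - 1)`. -/
def Fractional (B : ℕ → Finset ℕ) (n : ℕ) (A : Finset ℕ) (φ : ℝ) : Prop :=
  ∃ μ : ℕ → ℝ, (∀ s, 0 ≤ μ s) ∧ ∑ s ∈ A, μ s = 1 ∧ ∀ t < n, φ ≤ ∑ s ∈ A ∩ B t, μ s

/-- The weight of the rows that contain the column `s`. -/
def load (B : ℕ → Finset ℕ) (n : ℕ) (w : ℕ → ℝ) (s : ℕ) : ℝ :=
  ∑ t ∈ range n, if s ∈ B t then w t else 0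

namespace Fractional

variable {B : ℕ → Finset ℕ} {n : ℕ} {A : Finset ℕ} {φ ψ : ℝ}

theorem mono (h : Fractional B n A φ) (hψ : ψ ≤ φ) : Fractional B n A ψ := by
  obtain ⟨μ, h₁, h₂, h₃⟩ := h
  exact ⟨μ, h₁, h₂, fun t ht => hψ.trans (h₃ t ht)⟩

theorem nonempty_inter (h : Fractional B n A φ) (hφ : 0 < φ) {t : ℕ} (ht : t < n) :
    (A ∩ B t).Nonempty := by
  obtain ⟨μ, h₁, h₂, h₃⟩ := h
  rw [nonempty_iff_ne_empty]
  intro h0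
  have := h₃ t ht
  rw [h0, sum_empty] at this
  linarith

theorem le_one (h : Fractional B n A φ) (hn : 0 < n) : φ ≤ 1 := by
  obtain ⟨μ, h₁, h₂, h₃⟩ := h
  rw [← h₂]
  exact (h₃ 0 hn).trans (sum_le_sum_of_subset_of_nonneg inter_subset_left fun s _ _ => h₁ s)

/-- The uniform distribution on a hitting set. -/
theorem of_hits {O : Finset ℕ} {k : ℕ} (hO : O ⊆ A) (hk : O.card = k) (hk0 : 0 < k)
    (h : ∀ t < n, (O ∩ B t).Nonempty) : Fractional B n A (1 / k) := by
  refine ⟨fun s => if s ∈ O then 1 / k else 0, fun s => by positivity, ?_, fun t ht => ?_⟩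
  · rw [sum_ite_mem, inter_eq_right.2 hO, sum_const, hk, nsmul_eq_mul]
    field_simp
  · obtain ⟨s, hs⟩ := h t ht
    have hs' := mem_inter.1 hs
    refine le_trans ?_ (single_le_sum (f := fun s => if s ∈ O then (1 : ℝ) / k else 0)
      (fun i _ => by positivity) (mem_inter.2 ⟨hO hs'.1, hs'.2⟩))
    simp [hs'.1]

/-- By averaging, some column carries a `φ`-fraction of the weight. -/
theorem exists_load (h : Fractional B n A φ) {w : ℕ → ℝ} (hw : ∀ t < n, 0 ≤ w t) :
    ∃ s ∈ A, φ * ∑ t ∈ range n, w t ≤ load B n w s := by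
  obtain ⟨μ, h₁, h₂, h₃⟩ := h
  by_contra! hlt
  have hsum : φ * ∑ t ∈ range n, w t ≤ ∑ s ∈ A, μ s * load B n w s := by
    calc φ * ∑ t ∈ range n, w t = ∑ t ∈ range n, φ * w t := mul_sum _ _ _
      _ ≤ ∑ t ∈ range n, (∑ s ∈ A ∩ B t, μ s) * w t :=
          sum_le_sum fun t ht => mul_le_mul_of_nonneg_right (h₃ t (mem_range.1 ht))
            (hw t (mem_range.1 ht))
      _ = ∑ t ∈ range n, ∑ s ∈ A, if s ∈ B t then μ s * w t else 0 := by
          refine sum_congr rfl fun t _ => ?_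
          rw [sum_mul, sum_ite_mem]
      _ = ∑ s ∈ A, μ s * load B n w s := by
          rw [sum_comm]
          refine sum_congr rfl fun s _ => ?_
          rw [load, mul_sum]
          exact sum_congr rfl fun t _ => by simp
  have hlt' : ∑ s ∈ A, μ s * load B n w s < ∑ s ∈ A, μ s * (φ * ∑ t ∈ range n, w t) := by
    obtain ⟨s, hs, hs0⟩ : ∃ s ∈ A, μ s ≠ 0 := by
      by_contra! h0
      rw [sum_eq_zero h0] at h₂
      exact zero_ne_one h₂
    exact sum_lt_sum (fun s hs => mul_le_mul_of_nonneg_left (hlt s hs).le (h₁ s))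
      ⟨s, hs, mul_lt_mul_of_pos_left (hlt s hs) (lt_of_le_of_ne (h₁ s) hs0.symm)⟩
  rw [← sum_mul, h₂, one_mul] at hlt'
  exact absurd hlt' (not_lt.2 hsum)

end Fractional

/-- The state of the multiplicative weights method after `p` picks from `A`: column `s` was picked
`cnt s` times, and the weight of a row, initially `1` on `R` and `0` elsewhere, was multiplied
by `1 - η` at each pick of one of its columns. Greedy picks make the total weight decay. -/
structure Picked (B : ℕ → Finset ℕ) (n : ℕ) (A R : Finset ℕ) (η : ℝ) (p : ℕ) (cnt : ℕ → ℕ)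
    (w : ℕ → ℝ) : Prop where
  supp : ∀ s, cnt s ≠ 0 → s ∈ A
  total : ∑ s ∈ A, cnt s = p
  weight : ∀ t < n, w t = if t ∈ R then (1 - η) ^ ∑ s ∈ A ∩ B t, cnt s else 0
  potential : ∀ φ, Fractional B n A φ → ∑ t ∈ range n, w t ≤ R.card * (1 - η * φ) ^ p

namespace Picked

variable {B : ℕ → Finset ℕ} {n : ℕ} {A R : Finset ℕ} {η : ℝ} {p : ℕ} {cnt : ℕ → ℕ} {w : ℕ → ℝ}

theorem zero (hw : ∀ t < n, w t = if t ∈ R then 1 else 0) :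
    Picked B n A R η 0 (fun _ => 0) w where
  supp s h := absurd rfl h
  total := by simp
  weight t ht := by simp [hw t ht]
  potential φ _ := by
    rw [sum_congr rfl fun t ht => hw t (mem_range.1 ht), sum_ite_mem, sum_const]
    simpa using card_le_card (inter_subset_right (s₁ := range n) (s₂ := R))

theorem nonneg (h : Picked B n A R η p cnt w) (hη : η ≤ 1) : ∀ t < n, 0 ≤ w t := by
  intro t ht
  rw [h.weight t ht]
  split_ifs
  · exact pow_nonneg (by linarith) _
  · exact le_rfl

theorem succ (h : Picked B n A R η p cnt w) (hn : 0 < n) (h0 : 0 ≤ η) (hη : η ≤ 1) {s : ℕ}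
    (hs : s ∈ A) (hmax : ∀ s' ∈ A, load B n w s' ≤ load B n w s) {w' : ℕ → ℝ}
    (hw' : ∀ t < n, w' t = if s ∈ B t then w t * (1 - η) else w t) :
    Picked B n A R η (p + 1) (Function.update cnt s (cnt s + 1)) w' := by
  have hupd : ∀ C : Finset ℕ, ∑ s' ∈ C, Function.update cnt s (cnt s + 1) s' =
      (∑ s' ∈ C, cnt s') + if s ∈ C then 1 else 0 := by
    intro C
    rw [← sum_ite_eq' C s (fun _ => 1), ← sum_add_distrib]
    refine sum_congr rfl fun s' _ => ?_
    by_cases hss : s' = s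
    · subst hss; simp
    · simp [hss]
  refine ⟨fun s' hs' => ?_, ?_, fun t ht => ?_, fun φ hφ => ?_⟩
  · by_cases hss : s' = s
    · rwa [hss]
    · exact h.supp s' (by simpa [hss] using hs')
  · rw [hupd, h.total, if_pos hs]
  · rw [hw' t ht, hupd, h.weight t ht]
    by_cases hst : s ∈ B t <;> by_cases htR : t ∈ R <;> simp [hs, hst, htR, pow_succ]
  · obtain ⟨s', hs', hle⟩ := hφ.exists_load (h.nonneg hη)
    have hsum : ∑ t ∈ range n, w' t = ∑ t ∈ range n, w t - η * load B n w s := by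
      rw [load, mul_sum, ← sum_sub_distrib]
      refine sum_congr rfl fun t ht => ?_
      rw [hw' t (mem_range.1 ht)]
      split_ifs <;> ring
    have hle' := mul_le_mul_of_nonneg_left (hle.trans (hmax s' hs')) h0
    have hφ1 := hφ.le_one hn
    have hfac : 0 ≤ 1 - η * φ := by nlinarith
    calc ∑ t ∈ range n, w' t ≤ (1 - η * φ) * ∑ t ∈ range n, w t := by rw [hsum]; linarith
      _ ≤ (1 - η * φ) * (R.card * (1 - η * φ) ^ p) :=
          mul_le_mul_of_nonneg_left (h.potential φ hφ) hfac
      _ = R.card * (1 - η * φ) ^ (p + 1) := by ring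

/-- If the rows in `R` represent all traces on `A`, then the picked columns, with their
frequencies, are again a fractional hitting set, up to a loss that decreases with the number
of picks. -/
theorem fractional (h : Picked B n A R η p cnt w) (hn : 0 < n) (hp : 0 < p) (h0 : 0 < η)
    (hη : η < 1) (hR : ∀ r ∈ R, r < n) (hrep : ∀ t < n, ∃ r ∈ R, A ∩ B r = A ∩ B t) {L φ : ℝ}
    (hL : Real.log R.card ≤ L) (hφ : Fractional B n A φ) :
    Fractional B n (A.filter fun s => cnt s ≠ 0) ((1 - η) * (φ - L / (η * p))) := by
  have hp' : (0 : ℝ) < p := by exact_mod_cast hp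
  have hη' : 0 < 1 - η := by linarith
  have hcast : ∀ C ⊆ A, ∑ s ∈ (A.filter fun s => cnt s ≠ 0) ∩ C, (cnt s : ℝ) / p =
      (∑ s ∈ C, cnt s : ℕ) / p := by
    intro C hC
    rw [Nat.cast_sum, sum_div]
    refine sum_subset inter_subset_right fun s hs hs' => ?_
    have : cnt s = 0 := by
      by_contra hne
      exact hs' (mem_inter.2 ⟨mem_filter.2 ⟨hC hs, hne⟩, hs⟩)
    simp [this]
  refine ⟨fun s => cnt s / p, fun s => by positivity, ?_, fun t ht => ?_⟩
  · have := hcast A Subset.rfl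
    rw [inter_eq_left.2 (filter_subset _ _), h.total] at this
    rw [this]
    field_simp
  · have hset : (A.filter fun s => cnt s ≠ 0) ∩ B t =
        (A.filter fun s => cnt s ≠ 0) ∩ (A ∩ B t) := by
      ext s; simp only [mem_inter, mem_filter]; tauto
    rw [hset, hcast _ inter_subset_left]
    obtain ⟨r, hr, hrt⟩ := hrep t ht
    have hpot := h.potential φ hφ
    have hwr : w r ≤ ∑ t ∈ range n, w t :=
      single_le_sum (fun t ht => h.nonneg hη.le t (mem_range.1 ht)) (mem_range.2 (hR r hr))
    rw [h.weight r (hR r hr), if_pos hr, hrt] at hwr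
    set c := ∑ s ∈ A ∩ B t, cnt s
    have hR0 : (0 : ℝ) < R.card := by exact_mod_cast card_pos.2 ⟨r, hr⟩
    have hfac : 0 < 1 - η * φ := by nlinarith [hφ.le_one hn]
    have hlog := Real.log_le_log (pow_pos hη' c) (hwr.trans hpot)
    rw [Real.log_mul hR0.ne' (pow_pos hfac p).ne', Real.log_pow, Real.log_pow] at hlog
    have h1 := Real.log_le_sub_one_of_pos hfac
    have h2 := Real.one_sub_inv_le_log_of_pos hη'
    have h3 : (c : ℝ) * (1 - (1 - η)⁻¹) ≤ L - p * (η * φ) := by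
      have h4 := mul_le_mul_of_nonneg_left h2 (Nat.cast_nonneg c (α := ℝ))
      have h5 := mul_le_mul_of_nonneg_left h1 hp'.le
      linarith
    have h6 : 1 - (1 - η)⁻¹ = - (η / (1 - η)) := by field_simp; ring
    rw [h6] at h3
    rw [le_div_iff₀ hp']
    have h7 : p * (η * φ) - L ≤ c * (η / (1 - η)) := by linarith
    have h8 : (1 - η) / η * (p * (η * φ) - L) ≤ (1 - η) / η * (c * (η / (1 - η))) :=
      mul_le_mul_of_nonneg_left h7 (by positivity)
    have h9 : (1 - η) / η * (c * (η / (1 - η))) = c := by field_simp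
    have h10 : (1 - η) / η * (p * (η * φ) - L) = (1 - η) * (φ - L / (η * p)) * p := by
      field_simp
    linarith

end Picked

/-- The effect of replacing the columns `A` by `p` of them, picked greedily with rate `η`. -/
structure Thinned (B : ℕ → Finset ℕ) (n : ℕ) (A : Finset ℕ) (η : ℝ) (p : ℕ) (A' : Finset ℕ) :
    Prop where
  subset : A' ⊆ A
  nonempty : A'.Nonempty
  card_le : A'.card ≤ p
  fractional : ∀ φ, Fractional B n A φ →
    Fractional B n A' ((1 - η) * (φ - 30 * Real.log (A.card + 1) / (η * p)))

theorem Picked.thinned {B : ℕ → Finset ℕ} {n : ℕ} {A R : Finset ℕ} {η : ℝ} {p : ℕ} {cnt : ℕ → ℕ}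
    {w : ℕ → ℝ} (h : Picked B n A R η p cnt w) (hn : 0 < n) (hp : 0 < p) (h0 : 0 < η)
    (hη : η < 1) (hR : ∀ r ∈ R, r < n) (hrep : ∀ t < n, ∃ r ∈ R, A ∩ B r = A ∩ B t)
    (hinj : ∀ r ∈ R, ∀ r' ∈ R, A ∩ B r = A ∩ B r' → r = r')
    (htr : ((range n).image fun t => A ∩ B t).card ≤ (A.card + 1) ^ 30) :
    Thinned B n A η p (A.filter fun s => cnt s ≠ 0) where
  subset := filter_subset _ _
  nonempty := by
    obtain ⟨s, hs, hs'⟩ : ∃ s ∈ A, cnt s ≠ 0 := by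
      by_contra! h'
      have := h.total
      rw [sum_eq_zero h'] at this
      omega
    exact ⟨s, mem_filter.2 ⟨hs, hs'⟩⟩
  card_le := by
    rw [← h.total, card_filter]
    exact sum_le_sum fun s _ => by split_ifs <;> omega
  fractional φ hφ := by
    refine h.fractional hn hp h0 hη hR hrep ?_ hφ
    have hcard : R.card ≤ (A.card + 1) ^ 30 := by
      rw [← card_image_of_injOn (s := R) (f := fun t => A ∩ B t) hinj]
      exact (card_le_card (image_subset_image fun r hr => mem_range.2 (hR r hr))).trans htr
    rcases Nat.eq_zero_or_pos R.card with h00 | hpos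
    · rw [h00]
      simpa using Real.log_nonneg (by simp)
    · have : (R.card : ℝ) ≤ ((A.card : ℝ) + 1) ^ 30 := by exact_mod_cast hcard
      have := Real.log_le_log (by exact_mod_cast hpos) this
      rwa [Real.log_pow] at this

/-! ### The schedule of the thinning steps -/

/-- The fraction that survives down to step `j` of the schedule, for the guess `2 ^ i` of the
optimum: the losses of the steps sum to at most a factor of four. -/
noncomputable def level (i j : ℕ) : ℝ := 1 / (2 * 2 ^ i) * (1 - (1 / 2) ^ (j + 1))

theorem level_pos (i j : ℕ) : 0 < level i j := by
  have : ((1 : ℝ) / 2) ^ (j + 1) < 1 := pow_lt_one₀ (by norm_num) (by norm_num) (by omega)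
  unfold level
  have : (0 : ℝ) < 1 - (1 / 2) ^ (j + 1) := by linarith
  positivity

/-- The number of picks in step `j` of the schedule for the guess `2 ^ i`. The constant `2 ^ 20` is
large enough for the exponent `30` in the bound for the number of traces. -/
def picks (i j : ℕ) : ℕ := 2 ^ 20 * 2 ^ i * i * 8 ^ j

theorem picks_pos {i : ℕ} (hi : 1 ≤ i) (j : ℕ) : 0 < picks i j := by
  unfold picks; positivity

theorem picks_succ (i j : ℕ) : picks i (j + 1) = picks i j * 8 := by
  unfold picks; ring

theorem log_le_of_le_two_pow {x : ℝ} {a : ℕ} (hx : 0 < x) (h : x ≤ 2 ^ a) : Real.log x ≤ a := by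
  have h1 := Real.log_le_log hx h
  rw [Real.log_pow] at h1
  have h2 : Real.log 2 ≤ 1 := by linarith [Real.log_two_lt_d9]
  have h3 : (a : ℝ) * Real.log 2 ≤ a * 1 := mul_le_mul_of_nonneg_left h2 (Nat.cast_nonneg a)
  linarith

/-- The first step, which uses the rate `1 / 4` and a number of picks proportional to the logarithm
`l` of the number of columns, loses at most half of the initial fraction. -/
theorem Thinned.fractional_first {B : ℕ → Finset ℕ} {n : ℕ} {A A' : Finset ℕ} {p m l i k J : ℕ}
    (h : Thinned B n A (1 / 4) p A') (hA : A.card ≤ m) (hm : m ≤ 2 ^ l) (hl : 1 ≤ l)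
    (hk0 : 0 < k) (hk : k ≤ 2 ^ i) (hp : 2 ^ 20 * 2 ^ i * l ≤ p) (hφ : Fractional B n A (1 / k)) :
    Fractional B n A' (level i J) := by
  have hg : (0 : ℝ) < 2 ^ i := by positivity
  have hl' : (1 : ℝ) ≤ l := by exact_mod_cast hl
  have hk' : (1 : ℝ) / 2 ^ i ≤ 1 / k := by
    apply one_div_le_one_div_of_le (by exact_mod_cast hk0)
    exact_mod_cast hk
  refine (h.fractional _ (hφ.mono hk')).mono ?_
  have hlog : Real.log (A.card + 1) ≤ 2 * l := by
    have h1 : Real.log (A.card + 1) ≤ (l + 1 : ℕ) := by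
      apply log_le_of_le_two_pow (by positivity)
      have h2 : A.card + 1 ≤ 2 ^ (l + 1) := by
        have := Nat.one_le_two_pow (n := l)
        rw [pow_succ]; omega
      exact_mod_cast h2
    push_cast at h1
    linarith
  have hp' : (2 : ℝ) ^ 20 * 2 ^ i * l ≤ p := by exact_mod_cast hp
  have hp0 : (0 : ℝ) < p := lt_of_lt_of_le (by positivity) hp'
  have hloss : 30 * Real.log (A.card + 1) / (1 / 4 * p) ≤ 1 / 3 * (1 / 2 ^ i) := by
    rw [div_le_iff₀ (by positivity)]
    calc 30 * Real.log (A.card + 1) ≤ 30 * (2 * l) := by linarith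
      _ ≤ 1 / 3 * (1 / 2 ^ i) * (1 / 4 * (2 ^ 20 * 2 ^ i * l)) := by
          rw [show (1 : ℝ) / 3 * (1 / 2 ^ i) * (1 / 4 * (2 ^ 20 * 2 ^ i * l)) = 2 ^ 20 / 12 * l by
            field_simp; norm_num]
          nlinarith
      _ ≤ 1 / 3 * (1 / 2 ^ i) * (1 / 4 * p) := by gcongr
  have hlev : level i J ≤ 1 / 2 * (1 / 2 ^ i) := by
    unfold level
    have : (0 : ℝ) ≤ (1 / 2) ^ (J + 1) := by positivity
    calc (1 : ℝ) / (2 * 2 ^ i) * (1 - (1 / 2) ^ (J + 1)) ≤ 1 / (2 * 2 ^ i) * 1 := by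
          gcongr; linarith
      _ = _ := by field_simp
  linarith

/-- A later step loses at most a fraction `2 * (1 / 2) ^ (j + 3)`: half of it by the factor `1 - η`,
half of it by the number of traces, whose logarithm grows like `i + j` while the number of picks
grows like `i * 8 ^ j`. -/
theorem Thinned.fractional_step {B : ℕ → Finset ℕ} {n : ℕ} {A A' : Finset ℕ} {i j : ℕ}
    (h : Thinned B n A ((1 / 2) ^ (j + 3)) (picks i j) A') (hi : 1 ≤ i)
    (hA : A.card ≤ picks i (j + 1)) (hφ : Fractional B n A (level i (j + 1))) :
    Fractional B n A' (level i j) := by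
  refine (h.fractional _ hφ).mono ?_
  have hi' : (1 : ℝ) ≤ i := by exact_mod_cast hi
  have hlog : Real.log (A.card + 1) ≤ 29 * i * 2 ^ j := by
    have h1 : Real.log (A.card + 1) ≤ (24 + 2 * i + 3 * j : ℕ) := by
      apply log_le_of_le_two_pow (by positivity)
      have h2 : A.card + 1 ≤ 2 ^ (24 + 2 * i + 3 * j) := by
        have h3 := picks_pos hi (j + 1)
        have h4 : i ≤ 2 ^ i := Nat.lt_two_pow_self.le
        calc A.card + 1 ≤ 2 * picks i (j + 1) := by omega
          _ ≤ 2 * (2 ^ 20 * 2 ^ i * 2 ^ i * 8 ^ (j + 1)) := by unfold picks; gcongr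
          _ = 2 ^ (24 + 2 * i + 3 * j) := by
            rw [show (8 : ℕ) = 2 ^ 3 by norm_num, ← pow_mul]; ring
      exact_mod_cast h2
    have h5 : ((j : ℝ) + 1) ≤ 2 ^ j := by exact_mod_cast Nat.lt_two_pow_self (n := j)
    have h6 : (i : ℝ) * (j + 1) ≤ i * 2 ^ j := by gcongr
    have hj : (0 : ℝ) ≤ j := Nat.cast_nonneg j
    push_cast at h1
    nlinarith
  have hlow : 1 / (4 * 2 ^ i) ≤ level i (j + 1) := by
    unfold level
    have : ((1 : ℝ) / 2) ^ (j + 1 + 1) ≤ 1 / 2 := by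
      calc ((1 : ℝ) / 2) ^ (j + 1 + 1) ≤ (1 / 2) ^ 1 :=
            pow_le_pow_of_le_one (by norm_num) (by norm_num) (by omega)
        _ = 1 / 2 := pow_one _
    calc (1 : ℝ) / (4 * 2 ^ i) = 1 / (2 * 2 ^ i) * (1 - 1 / 2) := by field_simp; norm_num
      _ ≤ _ := by gcongr
  have hup : level i (j + 1) ≤ 1 / (2 * 2 ^ i) := by
    unfold level
    have : (0 : ℝ) ≤ (1 / 2) ^ (j + 1 + 1) := by positivity
    calc (1 : ℝ) / (2 * 2 ^ i) * (1 - (1 / 2) ^ (j + 1 + 1)) ≤ 1 / (2 * 2 ^ i) * 1 := by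
          gcongr; linarith
      _ = _ := mul_one _
  set η : ℝ := (1 / 2) ^ (j + 3) with hη
  have hη0 : 0 < η := by positivity
  have hη1 : η ≤ 1 := pow_le_one₀ (by norm_num) (by norm_num)
  have hloss : 30 * Real.log (A.card + 1) / (η * picks i j) ≤ η * level i (j + 1) := by
    have hpk := picks_pos hi j
    have hpk' : (0 : ℝ) < picks i j := by exact_mod_cast hpk
    rw [div_le_iff₀ (by positivity)]
    calc 30 * Real.log (A.card + 1) ≤ 30 * (29 * i * 2 ^ j) := by linarith
      _ ≤ 2 ^ 12 * i * 2 ^ j := by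
          have : (0 : ℝ) ≤ i * 2 ^ j := by positivity
          nlinarith
      _ = η * (1 / (4 * 2 ^ i)) * (η * picks i j) := by
          have h8 : (8 : ℝ) ^ j = 2 ^ j * 2 ^ j * 2 ^ j := by
            rw [← mul_pow, ← mul_pow]; norm_num
          rw [hη]
          simp only [picks]
          push_cast
          rw [one_div_pow, h8]
          field_simp
          ring
      _ ≤ η * level i (j + 1) * (η * picks i j) := by gcongr
  have hlev : level i j = level i (j + 1) - 1 / (2 * 2 ^ i) * (2 * η) := by
    unfold level
    rw [hη]
    ring
  have h1 : (1 - η) * (level i (j + 1) - η * level i (j + 1)) ≤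
      (1 - η) * (level i (j + 1) - 30 * Real.log (A.card + 1) / (η * picks i j)) := by
    apply mul_le_mul_of_nonneg_left _ (by linarith)
    linarith
  have h2 : 0 ≤ η * η * level i (j + 1) := by
    have := level_pos i (j + 1)
    positivity
  have h3 : η * level i (j + 1) ≤ η * (1 / (2 * 2 ^ i)) := by gcongr
  rw [hlev]
  nlinarith

/-! ### Angles between lines -/

/-- The angle in `[0, π / 2]` between the lines spanned by two vectors of the plane. -/
noncomputable def lineAngle (x y : ℝ × ℝ) : ℝ :=
  Real.arccos (Real.sqrt ((x.1 * y.1 + x.2 * y.2) * (x.1 * y.1 + x.2 * y.2) /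
    ((x.1 * x.1 + x.2 * x.2) * (y.1 * y.1 + y.2 * y.2))))

theorem lineAngle_nonneg (x y : ℝ × ℝ) : 0 ≤ lineAngle x y := Real.arccos_nonneg _

theorem lineAngle_le (x y : ℝ × ℝ) : lineAngle x y ≤ Real.pi / 2 :=
  Real.arccos_le_pi_div_two.2 (Real.sqrt_nonneg _)

theorem lineAngle_comm (x y : ℝ × ℝ) : lineAngle x y = lineAngle y x := by
  unfold lineAngle
  congr 3 <;> ring

theorem sq_add_sq_pos {x : ℝ × ℝ} (hx : x ≠ 0) : 0 < x.1 * x.1 + x.2 * x.2 := by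
  by_contra! h
  have h1 := mul_self_nonneg x.1
  have h2 := mul_self_nonneg x.2
  exact hx (Prod.ext (mul_self_eq_zero.1 (by linarith)) (mul_self_eq_zero.1 (by linarith)))

theorem lineAngle_self {x : ℝ × ℝ} (hx : x ≠ 0) : lineAngle x x = 0 := by
  unfold lineAngle
  rw [div_self (mul_pos (sq_add_sq_pos hx) (sq_add_sq_pos hx)).ne']
  simp

/-- For `γ` in `[0, π / 2]`, the vectors at line angle at least `γ` from a given one form a
quadric. -/
theorem le_lineAngle_iff {x y : ℝ × ℝ} (hx : x ≠ 0) (hy : y ≠ 0) {γ : ℝ} (h0 : 0 ≤ γ)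
    (h1 : γ ≤ Real.pi / 2) : γ ≤ lineAngle x y ↔
    (x.1 * y.1 + x.2 * y.2) * (x.1 * y.1 + x.2 * y.2) ≤
      Real.cos γ ^ 2 * ((x.1 * x.1 + x.2 * x.2) * (y.1 * y.1 + y.2 * y.2)) := by
  have hpos := mul_pos (sq_add_sq_pos hx) (sq_add_sq_pos hy)
  have hc : 0 ≤ Real.cos γ := Real.cos_nonneg_of_neg_pi_div_two_le_of_le (by linarith) h1
  rw [← div_le_iff₀ hpos, ← Real.sqrt_le_left hc]
  have hcs : Real.sqrt ((x.1 * y.1 + x.2 * y.2) * (x.1 * y.1 + x.2 * y.2) /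
      ((x.1 * x.1 + x.2 * x.2) * (y.1 * y.1 + y.2 * y.2))) ≤ 1 := by
    rw [Real.sqrt_le_one, div_le_one hpos]
    nlinarith [mul_self_nonneg (x.1 * y.2 - x.2 * y.1)]
  unfold lineAngle
  constructor
  · intro h
    have := Real.cos_le_cos_of_nonneg_of_le_pi h0 (Real.arccos_le_pi _) h
    rwa [Real.cos_arccos (by linarith [Real.sqrt_nonneg ((x.1 * y.1 + x.2 * y.2) *
      (x.1 * y.1 + x.2 * y.2) / ((x.1 * x.1 + x.2 * x.2) * (y.1 * y.1 + y.2 * y.2)))]) hcs] at this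
  · intro h
    calc γ = Real.arccos (Real.cos γ) := (Real.arccos_cos h0 (by linarith)).symm
      _ ≤ _ := Real.arccos_le_arccos h

/-- Every line through the origin has a direction angle within `π / 2` of a given one. -/
theorem exists_direction {x : ℝ × ℝ} (hx : x ≠ 0) (θ₀ : ℝ) :
    ∃ r θ : ℝ, r ≠ 0 ∧ |θ - θ₀| ≤ Real.pi / 2 ∧ x = (r * Real.cos θ, r * Real.sin θ) := by
  set z : ℂ := ⟨x.1, x.2⟩
  have hz : z ≠ 0 := fun h => hx (Prod.ext (congrArg Complex.re h) (congrArg Complex.im h))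
  set k := round ((z.arg - θ₀) / Real.pi)
  refine ⟨(-1) ^ k * ‖z‖, z.arg - k * Real.pi, ?_, ?_, ?_⟩
  · exact mul_ne_zero (zpow_ne_zero _ (by norm_num)) (norm_ne_zero_iff.2 hz)
  · have h := abs_sub_round ((z.arg - θ₀) / Real.pi)
    have h' : z.arg - k * Real.pi - θ₀ = ((z.arg - θ₀) / Real.pi - k) * Real.pi := by
      field_simp [Real.pi_ne_zero]
      ring
    rw [h', abs_mul, abs_of_pos Real.pi_pos]
    calc _ ≤ 1 / 2 * Real.pi := mul_le_mul_of_nonneg_right h Real.pi_pos.le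
      _ = Real.pi / 2 := by ring
  · have hsq : ((-1 : ℝ) ^ k) * (-1) ^ k = 1 := by
      rw [← mul_zpow]; norm_num
    rw [Real.cos_sub_int_mul_pi, Real.sin_sub_int_mul_pi]
    refine Prod.ext ?_ ?_
    · calc x.1 = ‖z‖ * Real.cos z.arg := (Complex.norm_mul_cos_arg z).symm
        _ = ((-1 : ℝ) ^ k * (-1) ^ k) * (‖z‖ * Real.cos z.arg) := by rw [hsq, one_mul]
        _ = _ := by ring
    · calc x.2 = ‖z‖ * Real.sin z.arg := (Complex.norm_mul_sin_arg z).symm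
        _ = ((-1 : ℝ) ^ k * (-1) ^ k) * (‖z‖ * Real.sin z.arg) := by rw [hsq, one_mul]
        _ = _ := by ring

theorem lineAngle_polar {r r' : ℝ} (hr : r ≠ 0) (hr' : r' ≠ 0) (θ θ' : ℝ) :
    lineAngle (r * Real.cos θ, r * Real.sin θ) (r' * Real.cos θ', r' * Real.sin θ') =
      Real.arccos |Real.cos (θ - θ')| := by
  unfold lineAngle
  rw [← Real.sqrt_mul_self_eq_abs]
  congr 2
  have h1 := Real.sin_sq_add_cos_sq θ
  have h2 := Real.sin_sq_add_cos_sq θ'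
  have e1 : r * Real.cos θ * (r * Real.cos θ) + r * Real.sin θ * (r * Real.sin θ) = r ^ 2 := by
    linear_combination r ^ 2 * h1
  have e2 : r' * Real.cos θ' * (r' * Real.cos θ') + r' * Real.sin θ' * (r' * Real.sin θ') =
      r' ^ 2 := by
    linear_combination r' ^ 2 * h2
  simp only [e1, e2]
  rw [Real.cos_sub, div_eq_iff (by positivity)]
  ring

theorem arccos_abs_cos_of_abs_le {x : ℝ} (hx : |x| ≤ Real.pi / 2) :
    Real.arccos |Real.cos x| = |x| := by
  rw [← Real.cos_abs x, abs_of_nonneg (Real.cos_nonneg_of_neg_pi_div_two_le_of_le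
    (by linarith [abs_nonneg x, Real.pi_pos]) hx), Real.arccos_cos (abs_nonneg x)
    (by linarith [Real.pi_pos])]

theorem arccos_abs_cos_of_le_abs {x : ℝ} (hx : Real.pi / 2 ≤ |x|) (hx' : |x| ≤ Real.pi) :
    Real.arccos |Real.cos x| = Real.pi - |x| := by
  rw [← Real.cos_abs x, abs_of_nonpos (Real.cos_nonpos_of_pi_div_two_le_of_le hx
    (by linarith [Real.pi_pos])), ← Real.cos_pi_sub, Real.arccos_cos (by linarith)
    (by linarith [abs_nonneg x])]

/-- The progress made by one round: if two lines `u`, `v` form an angle of at least `α`, then one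
of them forms an angle of at least `(α + w) / 2` with one of the lines `p`, `q`, where `w < α` is
the angle between `p` and `q`. Otherwise `u` and `v` would lie in an arc of length less than `α`;
arcs of that length do not wrap around because `α ≤ π / 3`. -/
theorem exists_far_line {p q u v : ℝ × ℝ} (hp : p ≠ 0) (hq : q ≠ 0) (hu : u ≠ 0) (hv : v ≠ 0)
    {α : ℝ} (hα : α ≤ Real.pi / 3) (hpq : lineAngle p q < α) (huv : α ≤ lineAngle u v) :
    ((α + lineAngle p q) / 2 ≤ lineAngle p u ∨ (α + lineAngle p q) / 2 ≤ lineAngle q u) ∨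
      ((α + lineAngle p q) / 2 ≤ lineAngle p v ∨ (α + lineAngle p q) / 2 ≤ lineAngle q v) := by
  obtain ⟨rp, θp, hrp, -, ep⟩ := exists_direction hp 0
  obtain ⟨rq, θq, hrq, hq', eq⟩ := exists_direction hq θp
  obtain ⟨ru, θu, hru, hu', eu⟩ := exists_direction hu θp
  obtain ⟨rv, θv, hrv, hv', ev⟩ := exists_direction hv θp
  by_contra! H
  obtain ⟨⟨h1, h2⟩, h3, h4⟩ := H
  have hqp : lineAngle p q = |θq - θp| := by
    rw [lineAngle_comm, ep, eq, lineAngle_polar hrq hrp, arccos_abs_cos_of_abs_le hq']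
  have hpi := Real.pi_pos
  set w := lineAngle p q
  -- the position of a line that is close to both `p` and `q`
  have key : ∀ {r θ : ℝ} {x : ℝ × ℝ}, r ≠ 0 → |θ - θp| ≤ Real.pi / 2 →
      x = (r * Real.cos θ, r * Real.sin θ) → lineAngle p x < (α + w) / 2 →
      lineAngle q x < (α + w) / 2 → |θ - θp| < (α + w) / 2 ∧ |θ - θq| < (α + w) / 2 := by
    intro r θ x hr hθ ex hpx hqx
    rw [lineAngle_comm, ep, ex, lineAngle_polar hr hrp, arccos_abs_cos_of_abs_le hθ] at hpx
    refine ⟨hpx, ?_⟩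
    have htri : |θ - θq| ≤ |θ - θp| + |θq - θp| := by
      have := abs_sub_le θ θp θq
      rwa [abs_sub_comm θp θq] at this
    rw [lineAngle_comm, eq, ex, lineAngle_polar hr hrq] at hqx
    rcases le_total |θ - θq| (Real.pi / 2) with h | h
    · rwa [arccos_abs_cos_of_abs_le h] at hqx
    · rw [arccos_abs_cos_of_le_abs h (by linarith)] at hqx
      linarith
  obtain ⟨a1, a2⟩ := key hru hu' eu h1 h2
  obtain ⟨b1, b2⟩ := key hrv hv' ev h3 h4
  have hlt : |θu - θv| < α := by
    rw [abs_lt] at a1 a2 b1 b2 ⊢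
    rcases abs_cases (θq - θp) with ⟨h, -⟩ | ⟨h, -⟩ <;> constructor <;> linarith [a1.1, a1.2,
      a2.1, a2.2, b1.1, b1.2, b2.1, b2.2]
  rw [eu, ev, lineAngle_polar hru hrv, arccos_abs_cos_of_abs_le (by linarith)] at huv
  linarith

/-- The angle `∠ s t s'` lies in `[β, π - β]` iff the lines from `t` to `s` and `s'` form an angle
of at least `β`. -/
theorem angle_mem_Icc_iff (s s' t : Plane) (β : ℝ) :
    EuclideanGeometry.angle s t s' ∈ Set.Icc β (Real.pi - β) ↔
      β ≤ lineAngle (s 0 - t 0, s 1 - t 1) (s' 0 - t 0, s' 1 - t 1) := by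
  have h1 : lineAngle (s 0 - t 0, s 1 - t 1) (s' 0 - t 0, s' 1 - t 1) =
      Real.arccos |Real.cos (EuclideanGeometry.angle s t s')| := by
    unfold lineAngle EuclideanGeometry.angle
    rw [← Real.sqrt_mul_self_eq_abs, InnerProductGeometry.cos_angle]
    congr 2
    have hn : ∀ x : Plane, ‖x‖ ^ 2 = x 0 * x 0 + x 1 * x 1 := by
      intro x
      rw [EuclideanSpace.norm_sq_eq]
      simp [sq]
    have hi : inner ℝ (s -ᵥ t) (s' -ᵥ t) =
        (s 0 - t 0) * (s' 0 - t 0) + (s 1 - t 1) * (s' 1 - t 1) := by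
      simp [PiLp.inner_apply]
      ring
    rw [div_mul_div_comm, hi, mul_mul_mul_comm, ← sq (‖s -ᵥ t‖), ← sq (‖s' -ᵥ t‖), hn, hn]
    simp
  rw [h1]
  set a := EuclideanGeometry.angle s t s'
  have h0 : 0 ≤ a := EuclideanGeometry.angle_nonneg _ _ _
  have hpi : a ≤ Real.pi := EuclideanGeometry.angle_le_pi _ _ _
  have haa : |a| = a := abs_of_nonneg h0
  rw [Set.mem_Icc]
  rcases le_total a (Real.pi / 2) with h | h
  · rw [arccos_abs_cos_of_abs_le (by rwa [haa]), haa]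
    exact ⟨fun h => h.1, fun h' => ⟨h', by linarith⟩⟩
  · rw [arccos_abs_cos_of_le_abs (by rwa [haa]) (by rwa [haa]), haa]
    exact ⟨fun h => by linarith [h.2], fun h' => ⟨by linarith, by linarith⟩⟩

theorem dist_plane (s t : Plane) : dist s t =
    Real.sqrt ((s 0 - t 0) * (s 0 - t 0) + (s 1 - t 1) * (s 1 - t 1)) := by
  rw [EuclideanSpace.dist_eq]
  simp [Real.dist_eq, sq]

/-! ### Names of the memory arrays -/

-- arrays of natural numbers: dimensions, output, incidence matrix, offsets of its rows,
-- current and next set of columns, row representatives, scratch, sensor pair of each target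
notation "nDims" => 0
notation "nSelected" => 1
notation "nMatrix" => 2
notation "nBase" => 3
notation "nSupport" => 4
notation "nNext" => 5
notation "nRep" => 6
notation "nSplit" => 7
notation "nFst" => 8
notation "nSnd" => 9
-- single natural numbers
notation "vRow" => 10
notation "vCol" => 11
notation "vPick" => 12
notation "vArg" => 13
notation "vStep" => 14
notation "vOk" => 15
notation "vHit" => 16
notation "vAcc" => 17
-- arrays of reals: coordinates, parameters, row weights, angle of the pair of each target
notation "rSensorX" => 0
notation "rSensorY" => 1
notation "rTargetX" => 2
notation "rTargetY" => 3
notation "rParam" => 4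
notation "rWeight" => 5
notation "rAngle" => 6
-- single reals
notation "xSum" => 10
notation "xMax" => 11
notation "xPicks" => 12
notation "xRate" => 13
notation "xGuess" => 14
notation "xLog" => 15
notation "xLogCols" => 16
notation "xScale" => 17
notation "xEta" => 18
notation "xCur" => 19
notation "xPow" => 20

namespace RealRAM

/-- The natural number variable stored in cell `0` of array `a`. -/
def NExp.var (a : ℕ) : NExp := .get a (.const 0)

/-- The real variable stored in cell `0` of array `a`. -/
def RExp.var (a : ℕ) : RExp := .get a (.const 0)

/-- The constant `c`. -/
def RExp.const (c : ℕ) : RExp := .ofNat (.const c)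

/-- Assignment to a natural number variable. -/
def setN (a : ℕ) (e : NExp) : Program := .assignNat a (.const 0) e

/-- Assignment to a real variable. -/
def setR (a : ℕ) (e : RExp) : Program := .assignReal a (.const 0) e

/-- The test `e ≠ 0`. -/
def Test.nonzero (e : NExp) : Test := .neg (.leNat e (.const 0))

/-- The test `e₁ = e₂`. -/
def Test.eqNat (e₁ e₂ : NExp) : Test := .conj (.leNat e₁ e₂) (.leNat e₂ e₁)

/-- The test `e₁ < e₂`. -/
def Test.ltReal (e₁ e₂ : RExp) : Test := .neg (.leReal e₂ e₁)

/-- The test `b₁ ∨ b₂`. -/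
def Test.disj (b₁ b₂ : Test) : Test := .neg (.conj (.neg b₁) (.neg b₂))

infixr:60 " ;; " => Program.seq

section simp_lemmas

variable (σ : Store)

@[simp] theorem NExp.eval_const (c : ℕ) : (NExp.const c).eval σ = c := rfl
@[simp] theorem NExp.eval_get (a : ℕ) (i : NExp) : (NExp.get a i).eval σ = σ.nat a (i.eval σ) := rfl
@[simp] theorem NExp.eval_add (e₁ e₂ : NExp) : (NExp.add e₁ e₂).eval σ = e₁.eval σ + e₂.eval σ :=
  rfl
@[simp] theorem NExp.eval_sub (e₁ e₂ : NExp) : (NExp.sub e₁ e₂).eval σ = e₁.eval σ - e₂.eval σ :=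
  rfl
@[simp] theorem NExp.eval_var (a : ℕ) : (NExp.var a).eval σ = σ.nat a 0 := rfl
@[simp] theorem RExp.eval_ofNat (e : NExp) : (RExp.ofNat e).eval σ = (e.eval σ : ℝ) := rfl
@[simp] theorem RExp.eval_const (c : ℕ) : (RExp.const c).eval σ = (c : ℝ) := rfl
@[simp] theorem RExp.eval_var (a : ℕ) : (RExp.var a).eval σ = σ.real a 0 := rfl
@[simp] theorem RExp.eval_get (a : ℕ) (i : NExp) : (RExp.get a i).eval σ = σ.real a (i.eval σ) :=
  rfl
@[simp] theorem RExp.eval_add (e₁ e₂ : RExp) : (RExp.add e₁ e₂).eval σ = e₁.eval σ + e₂.eval σ :=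
  rfl
@[simp] theorem RExp.eval_sub (e₁ e₂ : RExp) : (RExp.sub e₁ e₂).eval σ = e₁.eval σ - e₂.eval σ :=
  rfl
@[simp] theorem RExp.eval_mul (e₁ e₂ : RExp) : (RExp.mul e₁ e₂).eval σ = e₁.eval σ * e₂.eval σ :=
  rfl
@[simp] theorem RExp.eval_div (e₁ e₂ : RExp) : (RExp.div e₁ e₂).eval σ = e₁.eval σ / e₂.eval σ :=
  rfl
@[simp] theorem RExp.eval_sqrt (e : RExp) : (RExp.sqrt e).eval σ = Real.sqrt (e.eval σ) := rfl
@[simp] theorem RExp.eval_arccos (e : RExp) : (RExp.arccos e).eval σ = Real.arccos (e.eval σ) := rfl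
@[simp] theorem Test.holds_leNat (e₁ e₂ : NExp) :
    (Test.leNat e₁ e₂).Holds σ ↔ e₁.eval σ ≤ e₂.eval σ := Iff.rfl
@[simp] theorem Test.holds_leReal (e₁ e₂ : RExp) :
    (Test.leReal e₁ e₂).Holds σ ↔ e₁.eval σ ≤ e₂.eval σ := Iff.rfl
@[simp] theorem Test.holds_neg (b : Test) : b.neg.Holds σ ↔ ¬ b.Holds σ := Iff.rfl
@[simp] theorem Test.holds_conj (b₁ b₂ : Test) :
    (b₁.conj b₂).Holds σ ↔ b₁.Holds σ ∧ b₂.Holds σ := Iff.rfl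
@[simp] theorem Test.holds_disj (b₁ b₂ : Test) :
    (b₁.disj b₂).Holds σ ↔ b₁.Holds σ ∨ b₂.Holds σ := by
  simp only [Test.disj, Test.holds_neg, Test.holds_conj]; tauto
@[simp] theorem Test.holds_nonzero (e : NExp) : (Test.nonzero e).Holds σ ↔ e.eval σ ≠ 0 := by
  simp [Test.nonzero]
@[simp] theorem Test.holds_eqNat (e₁ e₂ : NExp) :
    (Test.eqNat e₁ e₂).Holds σ ↔ e₁.eval σ = e₂.eval σ := by
  simp [Test.eqNat, le_antisymm_iff]
@[simp] theorem Test.holds_ltReal (e₁ e₂ : RExp) :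
    (Test.ltReal e₁ e₂).Holds σ ↔ e₁.eval σ < e₂.eval σ := by
  simp [Test.ltReal]

end simp_lemmas

/-- The memory holds the incidence matrix of the rows `B 0, …, B (n - 1)` with `m` columns. -/
structure HasRows (m n : ℕ) (B : ℕ → Finset ℕ) (σ : Store) : Prop where
  cols : σ.nat nDims 0 = m
  rows : σ.nat nDims 1 = n
  base : ∀ t < n, σ.nat nBase t = t * m
  cell : ∀ t < n, ∀ s < m, σ.nat nMatrix (t * m + s) = if s ∈ B t then 1 else 0

theorem HasRows.congr {m n : ℕ} {B : ℕ → Finset ℕ} {σ σ' : Store} (h : HasRows m n B σ)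
    (h0 : σ'.nat nDims = σ.nat nDims) (h2 : σ'.nat nMatrix = σ.nat nMatrix)
    (h3 : σ'.nat nBase = σ.nat nBase) : HasRows m n B σ' :=
  ⟨by rw [h0, h.cols], by rw [h0, h.rows], by rw [h3]; exact h.base, by rw [h2]; exact h.cell⟩

/-- The array `a` holds the indicator function of the set `A` of columns. -/
structure Encodes (a m : ℕ) (A : Finset ℕ) (σ : Store) : Prop where
  lt : ∀ s ∈ A, s < m
  mem : ∀ s < m, σ.nat a s ≠ 0 ↔ s ∈ A

theorem Encodes.congr {a m : ℕ} {A : Finset ℕ} {σ σ' : Store} (h : Encodes a m A σ)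
    (h' : σ'.nat a = σ.nat a) : Encodes a m A σ' :=
  ⟨h.lt, by rw [h']; exact h.mem⟩

/-- The matrix cell in row `t` and column `s`. -/
def NExp.cell (t s : NExp) : NExp := .get nMatrix (.add (.get nBase t) s)

@[simp] theorem NExp.eval_cell (t s : NExp) (σ : Store) :
    (NExp.cell t s).eval σ = σ.nat nMatrix (σ.nat nBase (t.eval σ) + s.eval σ) := rfl

theorem HasRows.get {m n : ℕ} {B : ℕ → Finset ℕ} {σ : Store} (h : HasRows m n B σ) {t s : ℕ}
    (ht : t < n) (hs : s < m) :
    σ.nat nMatrix (σ.nat nBase t + s) = if s ∈ B t then 1 else 0 := by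
  rw [h.base t ht, h.cell t ht s hs]

/-! ### Representatives of the rows with the same trace -/

/-- Refine the classes of rows by the column `vCol`: in every class, the rows that disagree with
the representative get the first of them as their new representative. -/
def refineClasses : Program :=
  forLoop vRow 1 (.assignNat nSplit (.var vRow) (.get nDims (.const 1))) ;;
  forLoop vRow 1
    (.branch (.eqNat (.cell (.var vRow) (.var vCol)) (.cell (.get nRep (.var vRow)) (.var vCol)))
      .skip
      (.branch (.leNat (.get nDims (.const 1)) (.get nSplit (.get nRep (.var vRow))))
          (.assignNat nSplit (.get nRep (.var vRow)) (.var vRow)) .skip ;;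
        .assignNat nRep (.var vRow) (.get nSplit (.get nRep (.var vRow)))))

/-- Compute for every row the first row with the same trace on the current set of columns. -/
def findRepresentatives : Program :=
  forLoop vRow 1 (.assignNat nRep (.var vRow) (.const 0)) ;;
  forLoop vCol 0 (.branch (.nonzero (.get nSupport (.var vCol))) refineClasses .skip)

/-- Row `r` is the first of the rows with the same trace on `D` as row `t`. -/
def IsRep (B : ℕ → Finset ℕ) (D : Finset ℕ) (t r : ℕ) : Prop :=
  IsLeast {t' | D ∩ B t' = D ∩ B t} r

theorem insert_inter_eq_iff {B : ℕ → Finset ℕ} {D : Finset ℕ} {s : ℕ} {t t' : ℕ} :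
    insert s D ∩ B t' = insert s D ∩ B t ↔ D ∩ B t' = D ∩ B t ∧ (s ∈ B t' ↔ s ∈ B t) := by
  simp only [Finset.ext_iff, mem_inter, mem_insert]
  constructor
  · intro h
    refine ⟨fun a => ?_, ?_⟩
    · have := h a
      tauto
    · simpa using h s
  · rintro ⟨h, h'⟩ a
    have := h a
    by_cases ha : a = s
    · subst ha; tauto
    · tauto

/-- During the second loop, the cell `nSplit c` of a representative `c` holds the first row of its
class so far that disagrees with it in column `s`, or `n` if there is none. -/
theorem refineClasses_achieves {m n : ℕ} {B : ℕ → Finset ℕ} {D : Finset ℕ} {s : ℕ} {σ : Store}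
    (h : HasRows m n B σ) (hs : s < m) (hcol : σ.nat vCol 0 = s)
    (hrep : ∀ t < n, IsRep B D t (σ.nat nRep t)) :
    Achieves refineClasses (100 * n + 20)
      (fun σ' => ∀ t < n, IsRep B (insert s D) t (σ'.nat nRep t)) σ := by
  refine Achieves.seq (τ₁ := 20 * n + 10) (τ₂ := 80 * n + 10) ?_ (by omega)
  refine Achieves.forLoop (τ := 7) (fun i σ' => ∀ t < i, σ'.nat nSplit t = n) h.rows (by decide)
    (by decide) (by decide) (by simp) ?_ ?_ (by omega)
  · intro i hi σ' hF hv hI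
    refine Achieves.of_wp ?_ (by decide)
    have h0 := hF.nat 0 (by decide)
    intro t ht
    rcases Nat.lt_succ_iff_lt_or_eq.1 ht with h' | rfl
    · simp [hv, h'.ne, hI t h']
    · simp [hv, h0, h.rows]
  intro σ₁ hF₁ hsplit
  have h₁ : HasRows m n B σ₁ :=
    h.congr (hF₁.nat _ (by decide)) (hF₁.nat _ (by decide)) (hF₁.nat _ (by decide))
  have hcol₁ : σ₁.nat vCol 0 = s := by rw [hF₁.nat _ (by decide), hcol]
  have hrep₁ : ∀ t < n, IsRep B D t (σ₁.nat nRep t) := by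
    rw [hF₁.nat _ (by decide)]; exact hrep
  clear hF₁ hrep hcol h
  refine Achieves.forLoop (τ := 67) (fun i σ' =>
    (∀ t < i, IsRep B (insert s D) t (σ'.nat nRep t)) ∧
    (∀ t, i ≤ t → t < n → IsRep B D t (σ'.nat nRep t)) ∧
    ∀ c < n, IsRep B D c c →
      (σ'.nat nSplit c = n ∧ ∀ t < i, D ∩ B t = D ∩ B c → (s ∈ B t ↔ s ∈ B c)) ∨
      (σ'.nat nSplit c < i ∧
        IsLeast {t | D ∩ B t = D ∩ B c ∧ ¬ (s ∈ B t ↔ s ∈ B c)} (σ'.nat nSplit c)))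
    h₁.rows (by decide) (by decide) (by decide) ?_ ?_ ?_ (by omega)
  · refine ⟨by simp, ?_, ?_⟩
    · simpa using fun t => hrep₁ t
    · intro c hc _
      left
      simpa using hsplit c hc
  · rintro i hi σ' hF hv ⟨I1, I2, I3⟩
    have h' : HasRows m n B σ' :=
      h₁.congr (hF.nat _ (by decide)) (hF.nat _ (by decide)) (hF.nat _ (by decide))
    have hcol' : σ'.nat vCol 0 = s := by rw [hF.nat _ (by decide), hcol₁]
    have hi_rep := I2 i le_rfl hi
    set c := σ'.nat nRep i with hc
    have hci : c ≤ i := hi_rep.2 rfl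
    have hcn : c < n := hci.trans_lt hi
    have hcc : D ∩ B c = D ∩ B i := hi_rep.1
    have hcrep : IsRep B D c c := ⟨rfl, fun t' ht' => hi_rep.2 (ht'.trans hcc)⟩
    have huniq : ∀ c', IsRep B D c' c' → D ∩ B i = D ∩ B c' → c' = c := by
      intro c' hc' hic'
      exact le_antisymm (hc'.2 (hcc.trans hic')) (hi_rep.2 hic'.symm)
    refine Achieves.of_wp ?_ (by decide)
    simp only [Program.wp, Test.holds_eqNat, NExp.eval_cell, NExp.eval_var, NExp.eval_get, hv,
      hcol', ← hc, h'.get hi hs, h'.get hcn hs, Test.holds_leNat, NExp.eval_const, h'.rows]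
    have hbit : ((if s ∈ B i then 1 else 0) = if s ∈ B c then 1 else 0) ↔
        (s ∈ B i ↔ s ∈ B c) := by
      by_cases h1 : s ∈ B i <;> by_cases h2 : s ∈ B c <;> simp [h1, h2]
    rw [hbit]
    refine ⟨fun hb => ?_, fun hb => ⟨fun hle => ?_, fun hle => ?_⟩⟩
    · -- row `i` agrees with its representative
      simp only [Store.setNat_nat, Nat.reduceEqDiff, false_and, if_false]
      refine ⟨fun t ht => ?_, fun t ht ht' => I2 t (by omega) ht', fun c' hc' hcr' => ?_⟩
      · rcases Nat.lt_succ_iff_lt_or_eq.1 ht with h1 | rfl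
        · exact I1 t h1
        · rw [← hc]
          refine ⟨insert_inter_eq_iff.2 ⟨hcc, hb.symm⟩, fun t' ht' => ?_⟩
          exact hi_rep.2 (insert_inter_eq_iff.1 ht').1
      · rcases I3 c' hc' hcr' with ⟨h1, h2⟩ | ⟨h1, h2⟩
        · refine Or.inl ⟨h1, fun t ht htc => ?_⟩
          rcases Nat.lt_succ_iff_lt_or_eq.1 ht with h3 | rfl
          · exact h2 t h3 htc
          · rw [huniq c' hcr' htc]; exact hb
        · exact Or.inr ⟨by omega, h2⟩
    · -- row `i` is the first of its class that disagrees with the representative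
      have hnone : ∀ t < i, D ∩ B t = D ∩ B c → (s ∈ B t ↔ s ∈ B c) := by
        rcases I3 c hcn hcrep with ⟨-, h2⟩ | ⟨h1, -⟩
        · exact h2
        · omega
      have hleast : IsLeast {t | D ∩ B t = D ∩ B c ∧ ¬ (s ∈ B t ↔ s ∈ B c)} i := by
        refine ⟨⟨hcc.symm, hb⟩, fun t' ht' => ?_⟩
        by_contra! hlt
        exact ht'.2 (hnone t' hlt ht'.1)
      simp only [Store.setNat_nat, Nat.reduceEqDiff, false_and, if_false,
        true_and, hv, ← hc, if_true]
      refine ⟨fun t ht => ?_, fun t ht ht' => ?_, fun c' hc' hcr' => ?_⟩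
      · rcases Nat.lt_succ_iff_lt_or_eq.1 ht with h1 | rfl
        · rw [if_neg h1.ne]; exact I1 t h1
        · rw [if_pos rfl]
          refine ⟨rfl, fun t' ht' => ?_⟩
          obtain ⟨h1, h2⟩ := insert_inter_eq_iff.1 ht'
          exact hleast.2 ⟨h1.trans hcc.symm, by rw [h2]; exact hb⟩
      · rw [if_neg (by omega)]; exact I2 t (by omega) ht'
      · by_cases hcc' : c' = c
        · rw [if_pos hcc']
          subst hcc'
          exact Or.inr ⟨by omega, hleast⟩
        · rw [if_neg hcc']
          rcases I3 c' hc' hcr' with ⟨h1, h2⟩ | ⟨h1, h2⟩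
          · refine Or.inl ⟨h1, fun t ht htc => ?_⟩
            rcases Nat.lt_succ_iff_lt_or_eq.1 ht with h3 | rfl
            · exact h2 t h3 htc
            · exact absurd (huniq c' hcr' htc) hcc'
          · exact Or.inr ⟨by omega, h2⟩
    · -- an earlier row of the class disagrees with the representative
      obtain ⟨hlt, hleast⟩ := (I3 c hcn hcrep).resolve_left fun h1 => hle h1.1.ge
      simp only [Store.setNat_nat, Nat.reduceEqDiff, false_and, if_false,
        true_and]
      refine ⟨fun t ht => ?_, fun t ht ht' => ?_, fun c' hc' hcr' => ?_⟩
      · rcases Nat.lt_succ_iff_lt_or_eq.1 ht with h1 | rfl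
        · rw [if_neg h1.ne]; exact I1 t h1
        · rw [if_pos rfl]
          refine ⟨insert_inter_eq_iff.2 ⟨hleast.1.1.trans hcc, ?_⟩, fun t' ht' => ?_⟩
          · have := hleast.1.2
            tauto
          · obtain ⟨h1, h2⟩ := insert_inter_eq_iff.1 ht'
            exact hleast.2 ⟨h1.trans hcc.symm, by rw [h2]; exact hb⟩
      · rw [if_neg (by omega)]; exact I2 t (by omega) ht'
      · rcases I3 c' hc' hcr' with ⟨h1, h2⟩ | ⟨h1, h2⟩
        · refine Or.inl ⟨h1, fun t ht htc => ?_⟩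
          rcases Nat.lt_succ_iff_lt_or_eq.1 ht with h3 | rfl
          · exact h2 t h3 htc
          · rw [huniq c' hcr' htc] at h1
            exact absurd h1 (hlt.trans hi).ne
        · exact Or.inr ⟨by omega, h2⟩
  · rintro σ' - ⟨I1, -, -⟩
    exact I1

theorem findRepresentatives_achieves {m n : ℕ} {B : ℕ → Finset ℕ} {A : Finset ℕ} {σ : Store}
    (h : HasRows m n B σ) (hA : Encodes nSupport m A σ) (hm : 0 < m) (hn : 0 < n) :
    Achieves findRepresentatives (200 * (m * n))
      (fun σ' => ∀ t < n, IsRep B A t (σ'.nat nRep t)) σ := by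
  have hmn : n ≤ m * n := Nat.le_mul_of_pos_left n hm
  have hmn' : m ≤ m * n := Nat.le_mul_of_pos_right m hn
  refine Achieves.seq (τ₁ := 18 * n + 10) (τ₂ := 100 * (m * n) + 44 * m + 10) ?_ (by omega)
  refine Achieves.forLoop (τ := 5) (fun i σ' => ∀ t < i, σ'.nat nRep t = 0) h.rows (by decide)
    (by decide) (by decide) (by simp) ?_ ?_ (by omega)
  · intro i hi σ' hF hv hI
    refine Achieves.of_wp ?_ (by decide)
    intro t ht
    rcases Nat.lt_succ_iff_lt_or_eq.1 ht with h' | rfl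
    · simp [hv, h'.ne, hI t h']
    · simp [hv]
  intro σ₁ hF₁ hrep
  have h₁ : HasRows m n B σ₁ :=
    h.congr (hF₁.nat _ (by decide)) (hF₁.nat _ (by decide)) (hF₁.nat _ (by decide))
  have hA₁ : Encodes nSupport m A σ₁ := hA.congr (hF₁.nat _ (by decide))
  clear hF₁ hA h
  refine Achieves.forLoop (τ := 100 * n + 28)
    (fun i σ' => ∀ t < n, IsRep B (A.filter (· < i)) t (σ'.nat nRep t)) h₁.cols (by decide)
    (by decide) (by decide) ?_ ?_ ?_ (by ring_nf; omega)
  · intro t ht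
    simp [hrep t ht, IsRep, IsLeast, lowerBounds]
  · intro i hi σ' hF hv hI
    have h' : HasRows m n B σ' :=
      h₁.congr (hF.nat _ (by decide)) (hF.nat _ (by decide)) (hF.nat _ (by decide))
    have hA' : Encodes nSupport m A σ' := hA₁.congr (hF.nat _ (by decide))
    refine Achieves.branch (τ₁ := 100 * n + 20) (fun hb => ?_) (fun hb => ?_)
      (by simp only [Test.cost, Test.nonzero, NExp.cost, NExp.var]; omega)
    · simp only [Test.holds_nonzero, NExp.eval_get, NExp.eval_var, hv] at hb
      have hiA := (hA'.mem i hi).1 hb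
      refine (refineClasses_achieves h' hi hv hI).mono le_rfl fun σ'' h'' => ?_
      have : A.filter (· < i + 1) = insert i (A.filter (· < i)) := by
        ext a; simp only [mem_filter, mem_insert, Nat.lt_succ_iff_lt_or_eq]
        constructor
        · tauto
        · rintro (rfl | h)
          · exact ⟨hiA, Or.inr rfl⟩
          · tauto
      rw [this]
      exact h''
    · simp only [Test.holds_nonzero, NExp.eval_get, NExp.eval_var, hv] at hb
      have hiA := (hA'.mem i hi).not.1 hb
      refine Achieves.of_wp (p := .skip) ?_ (by simp [Program.time])
      have : A.filter (· < i + 1) = A.filter (· < i) := by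
        refine filter_congr fun a ha => ?_
        have : a ≠ i := fun h => hiA (h ▸ ha)
        omega
      rw [this]
      exact hI
  · intro σ' hF hI
    rwa [filter_true_of_mem hA₁.lt] at hI

/-! ### Greedy picks -/

/-- Find the column of the current set with the largest load. Loads are nonnegative, so the initial
maximum `-1` is exceeded by the first column of the set. -/
def findHeaviest : Program :=
  setR xMax (.sub (.const 0) (.const 1)) ;;
  setN vArg (.const 0) ;;
  forLoop vCol 0 (.branch (.nonzero (.get nSupport (.var vCol)))
    (setR xSum (.const 0) ;;
      forLoop vRow 1 (.branch (.nonzero (.cell (.var vRow) (.var vCol)))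
        (setR xSum (.add (.var xSum) (.get rWeight (.var vRow)))) .skip) ;;
      .branch (.ltReal (.var xMax) (.var xSum))
        (setR xMax (.var xSum) ;; setN vArg (.var vCol)) .skip)
    .skip)

/-- Pick a column of largest load and decrease the weights of its rows. -/
def pickColumn : Program :=
  findHeaviest ;;
  .assignNat nNext (.var vArg) (.const 1) ;;
  forLoop vRow 1 (.branch (.nonzero (.cell (.var vRow) (.var vArg)))
    (.assignReal rWeight (.var vRow)
      (.mul (.get rWeight (.var vRow)) (.sub (.const 1) (.var xRate)))) .skip)

theorem findHeaviest_achieves {m n : ℕ} {B : ℕ → Finset ℕ} {A : Finset ℕ} {σ : Store}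
    (h : HasRows m n B σ) (hA : Encodes nSupport m A σ) (hne : A.Nonempty)
    (hw : ∀ t < n, 0 ≤ σ.real rWeight t) (hm : 0 < m) (hn : 0 < n) :
    Achieves findHeaviest (200 * (m * n)) (fun σ' => σ'.nat vArg 0 ∈ A ∧
      ∀ s ∈ A, load B n (σ.real rWeight) s ≤ load B n (σ.real rWeight) (σ'.nat vArg 0)) σ := by
  have hmn : n ≤ m * n := Nat.le_mul_of_pos_left n hm
  have hmn' : m ≤ m * n := Nat.le_mul_of_pos_right m hn
  set w := σ.real rWeight with hwdef
  have hload : ∀ s, 0 ≤ load B n w s := fun s => sum_nonneg fun t ht => by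
    split_ifs
    exacts [hw t (mem_range.1 ht), le_rfl]
  refine Achieves.seq (τ₁ := 7) (τ₂ := 60 * (m * n) + 100 * m + 20) ?_ (by omega)
  refine Achieves.of_wp ?_ (by decide)
  refine Achieves.seq (τ₁ := 3) (τ₂ := 60 * (m * n) + 100 * m + 10) ?_ (by omega)
  refine Achieves.of_wp ?_ (by decide)
  set σ₁ := ((σ.setReal xMax ((NExp.const 0).eval σ)
    ((RExp.sub (.const 0) (.const 1)).eval σ)).setNat vArg 0 0) with hσ₁
  change Achieves _ _ _ σ₁
  have h₁ : HasRows m n B σ₁ := ⟨by simp [hσ₁, h.cols], by simp [hσ₁, h.rows],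
    by simpa [hσ₁] using h.base, by simpa [hσ₁] using h.cell⟩
  have hA₁ : Encodes nSupport m A σ₁ := ⟨hA.lt, by simpa [hσ₁] using hA.mem⟩
  have hw₁ : σ₁.real rWeight = w := by funext t; simp [hσ₁, hwdef]
  have hm₁ : σ₁.real xMax 0 = -1 := by simp [hσ₁]
  clear_value σ₁
  refine Achieves.forLoop (τ := 60 * n + 80) (fun i σ' =>
    (∀ s ∈ A, s < i → load B n w s ≤ σ'.real xMax 0) ∧
    ((σ'.real xMax 0 = -1 ∧ ∀ s ∈ A, ¬ s < i) ∨
      (σ'.nat vArg 0 ∈ A ∧ σ'.real xMax 0 = load B n w (σ'.nat vArg 0))))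
    h₁.cols (by decide) (by decide) (by decide) ?_ ?_ ?_ (by ring_nf; omega)
  · simp [hm₁]
  · rintro i hi σ' hF hv ⟨I1, I2⟩
    have h' : HasRows m n B σ' :=
      h₁.congr (hF.nat _ (by decide)) (hF.nat _ (by decide)) (hF.nat _ (by decide))
    have hA' : Encodes nSupport m A σ' := hA₁.congr (hF.nat _ (by decide))
    have hw' : σ'.real rWeight = w := by rw [hF.real _ (by decide), hw₁]
    refine Achieves.branch (τ₁ := 60 * n + 70) (fun hb => ?_) (fun hb => ?_)
      (by simp only [Test.cost, Test.nonzero, NExp.cost, NExp.var]; omega)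
    · simp only [Test.holds_nonzero, NExp.eval_get, NExp.eval_var, hv] at hb
      have hiA := (hA'.mem i hi).1 hb
      refine Achieves.seq (τ₁ := 4) (τ₂ := 60 * n + 66) ?_ (by omega)
      refine Achieves.of_wp ?_ (by decide)
      refine Achieves.seq (τ₁ := 60 * n + 10) (τ₂ := 50) ?_ (by omega)
      refine Achieves.forLoop (τ := 30) (fun k σ'' => σ''.real xSum 0 =
        ∑ t ∈ range k, if i ∈ B t then w t else 0) (n := n) (by simp [h'.rows]) (by decide)
        (by decide) (by decide) (by simp) ?_ ?_ (by omega)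
      · intro k hk σ'' hF' hv' hI
        have h'' : HasRows m n B σ'' := by
          refine ⟨?_, ?_, ?_, ?_⟩
          · rw [hF'.nat _ (by decide)]; simp [h'.cols]
          · rw [hF'.nat _ (by decide)]; simp [h'.rows]
          · rw [hF'.nat _ (by decide)]; simpa using h'.base
          · rw [hF'.nat _ (by decide)]; simpa using h'.cell
        have hv2 : σ''.nat vCol 0 = i := by rw [hF'.nat _ (by decide)]; simp [hv]
        have hw'' : σ''.real rWeight = w := by
          rw [hF'.real _ (by decide)]; funext t; simp [hw']
        refine Achieves.of_wp ?_ (by decide)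
        simp only [Program.wp, Test.holds_nonzero, NExp.eval_cell, NExp.eval_var, hv', hv2,
          h''.get hk hi, setR]
        rw [sum_range_succ, ← hI]
        by_cases hik : i ∈ B k <;> simp [hik, hv', hw'']
      · intro σ'' hF' hI
        have hv2 : σ''.nat vCol 0 = i := by rw [hF'.nat _ (by decide)]; simp [hv]
        have hmax : σ''.real xMax 0 = σ'.real xMax 0 := by
          rw [hF'.real _ (by decide)]; simp
        have harg : σ''.nat vArg 0 = σ'.nat vArg 0 := by
          rw [hF'.nat _ (by decide)]; simp
        have hsum : σ''.real xSum 0 = load B n w i := hI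
        refine Achieves.of_wp ?_ (by decide)
        simp only [Program.wp, Test.holds_ltReal, RExp.eval_var, setR, setN, NExp.eval_const,
          NExp.eval_var, Store.setNat_nat, Store.setNat_real, Store.setReal_nat,
          Store.setReal_real, hv2, hmax, harg, hsum, Nat.reduceEqDiff, false_and, if_false,
          and_self, if_true]
        refine ⟨fun hlt => ⟨fun s hs hsi => ?_, Or.inr ⟨hiA, trivial⟩⟩,
          fun hlt => ⟨fun s hs hsi => ?_, ?_⟩⟩
        · rcases Nat.lt_succ_iff_lt_or_eq.1 hsi with h1 | rfl
          · exact (I1 s hs h1).trans hlt.le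
          · exact le_rfl
        · rcases Nat.lt_succ_iff_lt_or_eq.1 hsi with h1 | rfl
          · exact I1 s hs h1
          · exact not_lt.1 hlt
        · rcases I2 with ⟨h1, -⟩ | h1
          · rw [h1] at hlt
            linarith [hload i]
          · exact Or.inr h1
    · simp only [Test.holds_nonzero, NExp.eval_get, NExp.eval_var, hv] at hb
      have hiA := (hA'.mem i hi).not.1 hb
      have hlt : ∀ s ∈ A, s < i + 1 ↔ s < i := by
        intro s hs
        have : s ≠ i := fun h => hiA (h ▸ hs)
        omega
      refine Achieves.of_wp (p := .skip) ?_ (by simp [Program.time])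
      simp only [Program.wp, Store.setNat_nat, Store.setNat_real, Nat.reduceEqDiff, false_and,
        if_false]
      refine ⟨fun s hs hsi => I1 s hs ((hlt s hs).1 hsi), I2.imp_left fun h => ⟨h.1, ?_⟩⟩
      exact fun s hs hsi => h.2 s hs ((hlt s hs).1 hsi)
  · rintro σ' hF ⟨I1, I2⟩
    rcases I2 with ⟨-, h2⟩ | ⟨h1, h2⟩
    · obtain ⟨s, hs⟩ := hne
      exact absurd (hA.lt s hs) (h2 s hs)
    · exact ⟨h1, fun s hs => h2 ▸ I1 s hs (hA.lt s hs)⟩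

theorem pickColumn_achieves {m n : ℕ} {B : ℕ → Finset ℕ} {A : Finset ℕ} {σ : Store}
    (h : HasRows m n B σ) (hA : Encodes nSupport m A σ) (hne : A.Nonempty)
    (hw : ∀ t < n, 0 ≤ σ.real rWeight t) (hm : 0 < m) (hn : 0 < n) :
    Achieves pickColumn (300 * (m * n)) (fun σ' => ∃ s ∈ A,
      (∀ s' ∈ A, load B n (σ.real rWeight) s' ≤ load B n (σ.real rWeight) s) ∧
      (∀ a, σ'.nat nNext a = if a = s then 1 else σ.nat nNext a) ∧
      ∀ t < n, σ'.real rWeight t = if s ∈ B t then σ.real rWeight t * (1 - σ.real xRate 0)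
        else σ.real rWeight t) σ := by
  have hmn : n ≤ m * n := Nat.le_mul_of_pos_left n hm
  refine Achieves.seq (τ₁ := 200 * (m * n)) (τ₂ := 70 * n + 20) ?_ (by omega)
  refine (findHeaviest_achieves h hA hne hw hm hn).imp le_rfl ?_
  rintro σ₁ hF₁ ⟨hs, hmax⟩
  have h₁ : HasRows m n B σ₁ :=
    h.congr (hF₁.nat _ (by decide)) (hF₁.nat _ (by decide)) (hF₁.nat _ (by decide))
  have hw₁ : σ₁.real rWeight = σ.real rWeight := hF₁.real _ (by decide)
  have hr₁ : σ₁.real xRate = σ.real xRate := hF₁.real _ (by decide)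
  have hn₁ : σ₁.nat nNext = σ.nat nNext := hF₁.nat _ (by decide)
  set s := σ₁.nat vArg 0 with hsdef
  have hsm := hA.lt s hs
  refine Achieves.seq (τ₁ := 4) (τ₂ := 70 * n + 10) ?_ (by omega)
  refine Achieves.of_wp ?_ (by decide)
  set w := σ.real rWeight
  refine Achieves.forLoop (τ := 50) (fun i σ' =>
    (∀ t < i, σ'.real rWeight t = if s ∈ B t then w t * (1 - σ.real xRate 0) else w t) ∧
    ∀ t, i ≤ t → σ'.real rWeight t = w t) (n := n) (by simp [h₁.rows])
    (by decide) (by decide) (by decide) (by simp [hw₁]) ?_ ?_ (by omega)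
  · rintro i hi σ' hF hv ⟨I1, I2⟩
    have h' : HasRows m n B σ' := by
      refine ⟨?_, ?_, ?_, ?_⟩
      · rw [hF.nat _ (by decide)]; simp [h₁.cols]
      · rw [hF.nat _ (by decide)]; simp [h₁.rows]
      · rw [hF.nat _ (by decide)]; simpa using h₁.base
      · rw [hF.nat _ (by decide)]; simpa using h₁.cell
    have hv2 : σ'.nat vArg 0 = s := by rw [hF.nat _ (by decide)]; simp [hsdef]
    have hr' : σ'.real xRate 0 = σ.real xRate 0 := by rw [hF.real _ (by decide)]; simp [hr₁]
    refine Achieves.of_wp ?_ (by decide)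
    simp only [Program.wp, Test.holds_nonzero, NExp.eval_cell, NExp.eval_var, hv, hv2,
      h'.get hi hsm, Store.setNat_real, Store.setReal_real, true_and]
    refine ⟨fun hb => ⟨fun t ht => ?_, fun t ht => ?_⟩, fun hb => ⟨fun t ht => ?_, fun t ht => ?_⟩⟩
    · rcases Nat.lt_succ_iff_lt_or_eq.1 ht with h1 | rfl
      · rw [if_neg h1.ne]; exact I1 t h1
      · have hst : s ∈ B t := by by_contra hst; simp [hst] at hb
        simp [hst, hv, I2 t le_rfl, hr']
    · rw [if_neg (by omega)]; exact I2 t (by omega)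
    · rcases Nat.lt_succ_iff_lt_or_eq.1 ht with h1 | rfl
      · exact I1 t h1
      · have hst : s ∉ B t := fun hst => by simp [hst] at hb
        simp [hst, I2 t le_rfl]
    · exact I2 t (by omega)
  · rintro σ' hF ⟨I1, -⟩
    refine ⟨s, hs, hmax, fun a => ?_, I1⟩
    rw [hF.nat _ (by decide)]
    simp [hn₁, hsdef]

/-! ### One thinning step -/

/-- Set the weights of the representatives to `1`, of the other rows to `0`, and clear the next
set of columns. -/
def initWeights : Program :=
  forLoop vRow 1 (.branch (.eqNat (.get nRep (.var vRow)) (.var vRow))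
    (.assignReal rWeight (.var vRow) (.const 1)) (.assignReal rWeight (.var vRow) (.const 0))) ;;
  forLoop vCol 0 (.assignNat nNext (.var vCol) (.const 0))

/-- Pick as many columns as the real variable `xPicks` says. -/
def pickColumns : Program :=
  setN vPick (.const 0) ;;
  .loop (.ltReal (.ofNat (.var vPick)) (.var xPicks))
    (pickColumn ;; setN vPick (.add (.var vPick) (.const 1)))

/-- Replace the current set of columns by greedily picked ones. -/
def thin : Program :=
  findRepresentatives ;; initWeights ;; pickColumns ;;
  forLoop vCol 0 (.assignNat nSupport (.var vCol) (.get nNext (.var vCol)))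

theorem initWeights_achieves {m n : ℕ} {B : ℕ → Finset ℕ} {σ : Store}
    (h : HasRows m n B σ) (hm : 0 < m) (hn : 0 < n) :
    Achieves initWeights (100 * (m * n)) (fun σ' => (∀ s < m, σ'.nat nNext s = 0) ∧
      ∀ t < n, σ'.real rWeight t = if σ.nat nRep t = t then 1 else 0) σ := by
  have hmn : n ≤ m * n := Nat.le_mul_of_pos_left n hm
  have hmn' : m ≤ m * n := Nat.le_mul_of_pos_right m hn
  refine Achieves.seq (τ₁ := 40 * n + 10) (τ₂ := 20 * m + 10) ?_ (by omega)
  refine Achieves.forLoop (τ := 25) (fun i σ' =>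
    ∀ t < i, σ'.real rWeight t = if σ.nat nRep t = t then 1 else 0) h.rows
    (by decide) (by decide) (by decide) (by simp) ?_ ?_ (by omega)
  · intro i hi σ' hF hv I1
    have hrep : σ'.nat nRep = σ.nat nRep := hF.nat _ (by decide)
    refine Achieves.of_wp ?_ (by decide)
    simp only [Program.wp, Test.holds_eqNat, NExp.eval_get, NExp.eval_var, hv, hrep,
      Store.setNat_real, Store.setReal_real, true_and, RExp.eval_const]
    refine ⟨fun hb t ht => ?_, fun hb t ht => ?_⟩ <;>
    · rcases Nat.lt_succ_iff_lt_or_eq.1 ht with h1 | rfl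
      · rw [if_neg h1.ne]; exact I1 t h1
      · simp [hb]
  intro σ₁ hF₁ hw
  have hc : σ₁.nat nDims 0 = m := by rw [hF₁.nat _ (by decide), h.cols]
  refine Achieves.forLoop (τ := 7) (fun i σ' => ∀ s < i, σ'.nat nNext s = 0) hc (by decide)
    (by decide) (by decide) (by simp) ?_ ?_ (by omega)
  · intro i hi σ' hF hv I1
    refine Achieves.of_wp ?_ (by decide)
    intro s hs
    rcases Nat.lt_succ_iff_lt_or_eq.1 hs with h' | rfl
    · simp [hv, h'.ne, I1 s h']
    · simp [hv]
  · intro σ' hF I1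
    refine ⟨I1, ?_⟩
    rw [hF.real _ (by decide)]
    exact hw

theorem pickColumns_achieves {m n p : ℕ} {B : ℕ → Finset ℕ} {A R : Finset ℕ} {η : ℝ} {σ : Store}
    (h : HasRows m n B σ) (hA : Encodes nSupport m A σ) (hne : A.Nonempty) (hm : 0 < m)
    (hn : 0 < n) (h0 : 0 ≤ η) (hη : η ≤ 1) (hrate : σ.real xRate 0 = η)
    (hp : σ.real xPicks 0 = p) (hw : ∀ t < n, σ.real rWeight t = if t ∈ R then 1 else 0)
    (hnext : ∀ s < m, σ.nat nNext s = 0) :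
    Achieves pickColumns (400 * (m * n) * p + 40) (fun σ' => ∃ cnt w, Picked B n A R η p cnt w ∧
      ∀ s < m, σ'.nat nNext s ≠ 0 ↔ cnt s ≠ 0) σ := by
  have hmn : 1 ≤ m * n := Nat.mul_pos hm hn
  refine Achieves.seq (τ₁ := 3) (τ₂ := 400 * (m * n) * p + 30) ?_ (by omega)
  refine Achieves.of_wp ?_ (by decide)
  set σ₁ := σ.setNat vPick 0 0 with hσ₁
  change Achieves _ _ _ σ₁
  refine Achieves.loop (fun τ σ' => ∃ i ≤ p, Frame (pickColumn ;; setN vPick (.const 0)) σ₁ σ' ∧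
    σ'.nat vPick 0 = i ∧ 400 * (m * n) * (p - i) + 30 ≤ τ ∧
    ∃ cnt, Picked B n A R η i cnt (σ'.real rWeight) ∧ ∀ s < m, σ'.nat nNext s ≠ 0 ↔ cnt s ≠ 0)
    ?_ ?_
  · rintro τ σ' ⟨i, hi, hF, hv, hτ, cnt, hP, hcnt⟩
    have hp' : σ'.real xPicks 0 = p := by rw [hF.real _ (by decide)]; simp [hσ₁, hp]
    have h' : HasRows m n B σ' := by
      refine ⟨?_, ?_, ?_, ?_⟩
      · rw [hF.nat _ (by decide)]; simp [hσ₁, h.cols]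
      · rw [hF.nat _ (by decide)]; simp [hσ₁, h.rows]
      · rw [hF.nat _ (by decide)]; simpa [hσ₁] using h.base
      · rw [hF.nat _ (by decide)]; simpa [hσ₁] using h.cell
    have hA' : Encodes nSupport m A σ' :=
      ⟨hA.lt, by rw [hF.nat _ (by decide)]; simpa [hσ₁] using hA.mem⟩
    have hr' : σ'.real xRate 0 = η := by rw [hF.real _ (by decide)]; simp [hσ₁, hrate]
    simp only [Test.holds_ltReal, RExp.eval_ofNat, NExp.eval_var, RExp.eval_var, hv, hp',
      Nat.cast_lt, not_lt]
    refine ⟨fun hle => ⟨?_, ?_⟩, fun hlt => ?_⟩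
    · refine le_trans ?_ (le_trans (Nat.le_add_left 30 _) hτ)
      decide
    · obtain rfl : i = p := le_antisymm hi hle
      exact ⟨cnt, _, hP, hcnt⟩
    · refine ⟨300 * (m * n) + 6, 400 * (m * n) * (p - (i + 1)) + 30, ?_, ?_⟩
      · have e : p - i = p - (i + 1) + 1 := by omega
        rw [e, mul_add] at hτ
        have : (Test.ltReal (.ofNat (.var vPick)) (.var xPicks)).cost = 7 := rfl
        omega
      · refine Achieves.seq (τ₁ := 300 * (m * n)) (τ₂ := 6) ?_ le_rfl
        refine (pickColumn_achieves h' hA' hne (hP.nonneg hη) hm hn).imp le_rfl ?_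
        rintro σ₂ hF₂ ⟨s, hs, hmax, hnx, hw₂⟩
        refine Achieves.of_wp ?_ (by decide)
        have hv₂ : σ₂.nat vPick 0 = i := by rw [hF₂.nat _ (by decide), hv]
        refine ⟨i + 1, hlt, ?_, by simp [hv₂], le_rfl, Function.update cnt s (cnt s + 1), ?_, ?_⟩
        · refine (hF.trans (hF₂.mono ?_ ?_)).trans (Frame.mono (p := setN vPick (.const 0))
            ⟨fun a ha => ?_, fun _ _ => rfl⟩ (by decide) (by decide))
          · exact fun a ha => List.mem_append_left _ ha
          · exact fun a ha => List.mem_append_left _ ha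
          · exact Store.setNat_nat_of_ne _ _ _ (by simpa [Program.natMods, setN] using ha)
        · rw [hr'] at hw₂
          exact hP.succ hn h0 hη hs hmax hw₂
        · intro a ha
          have hnx' := hnx a
          have hcnt' := hcnt a ha
          by_cases has : a = s
          · subst has; simp [hnx']
          · rw [if_neg has] at hnx'
            simp [has, hnx', hcnt']
  · refine ⟨0, Nat.zero_le _, Frame.refl _ _, by simp [hσ₁], by simp, fun _ => 0,
      Picked.zero (by simpa [hσ₁] using hw), ?_⟩
    simpa [hσ₁] using hnext

/-- The weights are carried by the rows that represent themselves, one for each trace. -/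
theorem thin_achieves {m n p : ℕ} {B : ℕ → Finset ℕ} {A : Finset ℕ} {η : ℝ} {σ : Store}
    (h : HasRows m n B σ) (hA : Encodes nSupport m A σ) (hne : A.Nonempty) (hm : 0 < m)
    (hn : 0 < n) (h0 : 0 < η) (hη : η < 1) (hrate : σ.real xRate 0 = η)
    (hp0 : 0 < p) (hp : σ.real xPicks 0 = p)
    (htr : ((range n).image fun t => A ∩ B t).card ≤ (A.card + 1) ^ 30) :
    Achieves thin (800 * (m * n) * p) (fun σ' => ∃ A', Thinned B n A η p A' ∧
      Encodes nSupport m A' σ') σ := by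
  have hmn : m ≤ m * n := Nat.le_mul_of_pos_right m hn
  have hmnp : m * n ≤ m * n * p := Nat.le_mul_of_pos_right _ hp0
  have e : 800 * (m * n) * p = 800 * (m * n * p) := by ring
  refine Achieves.seq (τ₁ := 200 * (m * n)) (τ₂ := 600 * (m * n * p)) ?_ (by omega)
  refine (findRepresentatives_achieves h hA hm hn).imp le_rfl ?_
  intro σ₁ hF₁ hrep
  have h₁ : HasRows m n B σ₁ :=
    h.congr (hF₁.nat _ (by decide)) (hF₁.nat _ (by decide)) (hF₁.nat _ (by decide))
  refine Achieves.seq (τ₁ := 100 * (m * n)) (τ₂ := 500 * (m * n * p)) ?_ (by omega)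
  refine (initWeights_achieves h₁ hm hn).imp le_rfl ?_
  rintro σ₂ hF₂ ⟨hnext, hw⟩
  have h₂ : HasRows m n B σ₂ :=
    h₁.congr (hF₂.nat _ (by decide)) (hF₂.nat _ (by decide)) (hF₂.nat _ (by decide))
  have hA₂ : Encodes nSupport m A σ₂ :=
    hA.congr ((hF₂.nat _ (by decide)).trans (hF₁.nat _ (by decide)))
  set R := (range n).filter fun t => σ₁.nat nRep t = t with hR
  have e' : 400 * (m * n) * p = 400 * (m * n * p) := by ring
  refine Achieves.seq (τ₁ := 400 * (m * n) * p + 40) (τ₂ := 20 * m + 10) ?_ (by omega)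
  refine (pickColumns_achieves (p := p) (R := R) (η := η) h₂ hA₂ hne hm hn h0.le hη.le ?_ ?_ ?_
    hnext).imp le_rfl ?_
  · rw [hF₂.real _ (by decide), hF₁.real _ (by decide), hrate]
  · rw [hF₂.real _ (by decide), hF₁.real _ (by decide), hp]
  · intro t ht
    rw [hw t ht]
    simp [hR, ht]
  rintro σ₃ hF₃ ⟨cnt, w, hP, hcnt⟩
  have h₃ : HasRows m n B σ₃ :=
    h₂.congr (hF₃.nat _ (by decide)) (hF₃.nat _ (by decide)) (hF₃.nat _ (by decide))
  refine Achieves.forLoop (τ := 7) (fun i σ' => ∀ s < i, σ'.nat nSupport s = σ₃.nat nNext s)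
    h₃.cols (by decide) (by decide) (by decide) (by simp) ?_ ?_ (by omega)
  · intro i hi σ' hF hv I1
    have hnx : σ'.nat nNext = σ₃.nat nNext := hF.nat _ (by decide)
    refine Achieves.of_wp ?_ (by decide)
    intro s hs
    rcases Nat.lt_succ_iff_lt_or_eq.1 hs with h' | rfl
    · simp [hv, h'.ne, I1 s h']
    · simp [hv, hnx]
  · intro σ' hF I1
    refine ⟨_, hP.thinned hn hp0 h0 hη (by simp +contextual [hR]) ?_ ?_ htr, ?_, ?_⟩
    · intro t ht
      have hle : σ₁.nat nRep t ≤ t := (hrep t ht).2 rfl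
      have hlt := hle.trans_lt ht
      refine ⟨σ₁.nat nRep t, ?_, (hrep t ht).1⟩
      rw [hR, mem_filter, mem_range]
      refine ⟨hlt, le_antisymm ((hrep _ hlt).2 rfl) ?_⟩
      exact (hrep t ht).2 ((hrep _ hlt).1.trans (hrep t ht).1)
    · intro r hr r' hr' hrr
      rw [hR, mem_filter, mem_range] at hr hr'
      have h1 := hrep r hr.1
      have h2 := hrep r' hr'.1
      rw [hr.2] at h1
      rw [hr'.2] at h2
      exact le_antisymm (h1.2 hrr.symm) (h2.2 hrr)
    · exact fun s hs => hA.lt s (mem_filter.1 hs).1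
    · intro s hs
      rw [I1 s hs, hcnt s hs, mem_filter]
      exact ⟨fun h => ⟨hP.supp s h, h⟩, fun h => h.2⟩

/-! ### Scanning a row for a selected column -/

/-- Set `vHit` to `s + 1` for the last column `s` of the current set that lies in row `vRow`, and
to `0` if there is none. -/
def scanRow : Program :=
  setN vHit (.const 0) ;;
  forLoop vCol 0 (.branch
    (.conj (.nonzero (.get nSupport (.var vCol))) (.nonzero (.cell (.var vRow) (.var vCol))))
    (setN vHit (.add (.var vCol) (.const 1))) .skip)

/-- Set `vOk` to `1` if the current set of columns hits all rows, and to `0` otherwise. -/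
def checkHits : Program :=
  setN vOk (.const 1) ;;
  forLoop vRow 1 (scanRow ;; .branch (.nonzero (.var vHit)) .skip (setN vOk (.const 0)))

theorem scanRow_achieves {m n t : ℕ} {B : ℕ → Finset ℕ} {A : Finset ℕ} {σ : Store}
    (h : HasRows m n B σ) (hA : Encodes nSupport m A σ) (ht : t < n) (hrow : σ.nat vRow 0 = t) :
    Achieves scanRow (60 * m + 20) (fun σ' =>
      (σ'.nat vHit 0 = 0 ∧ A ∩ B t = ∅) ∨ ∃ s ∈ A ∩ B t, σ'.nat vHit 0 = s + 1) σ := by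
  refine Achieves.seq (τ₁ := 3) (τ₂ := 60 * m + 10) ?_ (by omega)
  refine Achieves.of_wp ?_ (by decide)
  refine Achieves.forLoop (τ := 47) (fun i σ' =>
    (σ'.nat vHit 0 = 0 ∧ ∀ s ∈ A ∩ B t, ¬ s < i) ∨ ∃ s ∈ A ∩ B t, σ'.nat vHit 0 = s + 1)
    (n := m) (by simp [h.cols]) (by decide) (by decide) (by decide) (by simp) ?_ ?_ (by omega)
  · intro i hi σ' hF hv hI
    have h' : HasRows m n B σ' := by
      refine ⟨?_, ?_, ?_, ?_⟩
      · rw [hF.nat _ (by decide)]; simp [h.cols]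
      · rw [hF.nat _ (by decide)]; simp [h.rows]
      · rw [hF.nat _ (by decide)]; simpa using h.base
      · rw [hF.nat _ (by decide)]; simpa using h.cell
    have hA' : Encodes nSupport m A σ' :=
      ⟨hA.lt, by rw [hF.nat _ (by decide)]; simpa using hA.mem⟩
    have hr' : σ'.nat vRow 0 = t := by rw [hF.nat _ (by decide)]; simp [hrow]
    refine Achieves.of_wp ?_ (by decide)
    have hiff : (σ'.nat nSupport i ≠ 0 ∧ ((if i ∈ B t then 1 else 0) ≠ 0)) ↔ i ∈ A ∩ B t := by
      rw [hA'.mem i hi, mem_inter]; simp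
    simp only [Program.wp, setN, Test.holds_conj, Test.holds_nonzero, NExp.eval_get,
      NExp.eval_var, NExp.eval_cell, hv, hr', h'.get ht hi, NExp.eval_const, NExp.eval_add,
      Store.setNat_nat, Nat.reduceEqDiff, false_and, if_false, and_self, if_true, hiff]
    refine ⟨fun hb => Or.inr ⟨i, hb, rfl⟩, fun hb => ?_⟩
    rcases hI with ⟨h1, h2⟩ | h1
    · refine Or.inl ⟨h1, fun s hs hlt => ?_⟩
      rcases Nat.lt_succ_iff_lt_or_eq.1 hlt with h3 | rfl
      · exact h2 s hs h3
      · exact hb hs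
    · exact Or.inr h1
  · rintro σ' hF (⟨h1, h2⟩ | h1)
    · refine Or.inl ⟨h1, eq_empty_of_forall_notMem fun s hs => h2 s hs ?_⟩
      exact hA.lt s (mem_inter.1 hs).1
    · exact Or.inr h1

theorem checkHits_achieves {m n : ℕ} {B : ℕ → Finset ℕ} {A : Finset ℕ} {σ : Store}
    (h : HasRows m n B σ) (hA : Encodes nSupport m A σ) (hm : 0 < m) (hn : 0 < n) :
    Achieves checkHits (200 * (m * n)) (fun σ' =>
      σ'.nat vOk 0 ≠ 0 ↔ ∀ t < n, (A ∩ B t).Nonempty) σ := by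
  have hmn : n ≤ m * n := Nat.le_mul_of_pos_left n hm
  have hmn' : m ≤ m * n := Nat.le_mul_of_pos_right m hn
  refine Achieves.seq (τ₁ := 3) (τ₂ := 60 * (m * n) + 60 * n + 10) ?_ (by omega)
  refine Achieves.of_wp ?_ (by decide)
  refine Achieves.forLoop (τ := 60 * m + 33) (fun i σ' =>
    σ'.nat vOk 0 ≠ 0 ↔ ∀ t < i, (A ∩ B t).Nonempty)
    (n := n) (by simp [h.rows]) (by decide) (by decide) (by decide) (by simp) ?_ ?_
    (by ring_nf; omega)
  · intro i hi σ' hF hv hI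
    have h' : HasRows m n B σ' := by
      refine ⟨?_, ?_, ?_, ?_⟩
      · rw [hF.nat _ (by decide)]; simp [h.cols]
      · rw [hF.nat _ (by decide)]; simp [h.rows]
      · rw [hF.nat _ (by decide)]; simpa using h.base
      · rw [hF.nat _ (by decide)]; simpa using h.cell
    have hA' : Encodes nSupport m A σ' :=
      ⟨hA.lt, by rw [hF.nat _ (by decide)]; simpa using hA.mem⟩
    refine Achieves.seq (τ₁ := 60 * m + 20) (τ₂ := 13) ?_ (by omega)
    refine (scanRow_achieves h' hA' hi hv).imp le_rfl fun σ'' hF' h'' => ?_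
    have hok : σ''.nat vOk 0 = σ'.nat vOk 0 := by rw [hF'.nat _ (by decide)]
    refine Achieves.of_wp ?_ (by decide)
    have hsplit : (∀ t < i + 1, (A ∩ B t).Nonempty) ↔
        (∀ t < i, (A ∩ B t).Nonempty) ∧ (A ∩ B i).Nonempty :=
      Nat.forall_lt_succ_right
    rw [hsplit, ← hI, ← hok]
    rcases h'' with ⟨h1, h2⟩ | ⟨s, h1, h2⟩
    · simp [Program.wp, setN, h1, h2]
    · have : (A ∩ B i).Nonempty := ⟨s, h1⟩
      simp [Program.wp, setN, h2, this]
  · exact fun σ' _ hI => hI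

/-! ### Hitting sets for a guess of the optimum -/

/-- Start with all columns and compute the number of picks of the first thinning step: the number
`2 ^ 20 * 2 ^ i * i` of the last step (where `2 ^ i` is the guess), times the smallest power of
eight for which it is at least `2 ^ 20 * 2 ^ i` times the logarithm of the number of columns. -/
def startSchedule : Program :=
  forLoop vCol 0 (.assignNat nSupport (.var vCol) (.const 1)) ;;
  setR xPicks (.mul (.mul (.const 1048576) (.var xGuess)) (.var xLog)) ;;
  setR xScale (.var xLog) ;;
  setR xEta (.div (.const 1) (.const 8)) ;;
  setN vStep (.const 0) ;;
  .loop (.ltReal (.var xScale) (.var xLogCols))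
    (setR xScale (.mul (.var xScale) (.const 8)) ;;
      setR xPicks (.mul (.var xPicks) (.const 8)) ;;
      setR xEta (.div (.var xEta) (.const 2)) ;;
      setN vStep (.add (.var vStep) (.const 1)))

/-- Thin out the current set of columns until the schedule is finished. The variable `xEta` holds
the rate `(1 / 2) ^ (j + 3)` of step `j = vStep`; only the first step uses the rate `1 / 4`. -/
def runSchedule : Program :=
  setR xRate (.div (.const 1) (.const 4)) ;;
  thin ;;
  .loop (.leNat (.const 1) (.var vStep))
    (setN vStep (.sub (.var vStep) (.const 1)) ;;
      setR xPicks (.div (.var xPicks) (.const 8)) ;;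
      setR xEta (.mul (.var xEta) (.const 2)) ;;
      setR xRate (.var xEta) ;;
      thin)

/-- Try to find a hitting set for the current guess of the optimum. -/
def tryGuess : Program := startSchedule ;; runSchedule ;; checkHits

/-- Find a hitting set: double the guess until an attempt succeeds. -/
def findHittingSet : Program :=
  setR xGuess (.const 2) ;;
  setR xLog (.const 1) ;;
  setN vOk (.const 0) ;;
  .loop (.leNat (.var vOk) (.const 0))
    (tryGuess ;;
      .branch (.nonzero (.var vOk)) .skip
        (setR xGuess (.mul (.var xGuess) (.const 2)) ;;
          setR xLog (.add (.var xLog) (.const 1))))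

/-- The number of picks overshoots its lower bound at most eightfold, because the guess is at most
of the order of the number of columns (`i ≤ l`). -/
theorem startSchedule_achieves {m i l : ℕ} {σ : Store} (hm0 : σ.nat nDims 0 = m)
    (hi : 1 ≤ i) (hil : i ≤ l) (hg : σ.real xGuess 0 = 2 ^ i) (hlog : σ.real xLog 0 = i)
    (hl : σ.real xLogCols 0 = l) :
    Achieves startSchedule (20 * m + 100 * l + 100) (fun σ' => ∃ J,
      Encodes nSupport m (range m) σ' ∧ σ'.real xPicks 0 = picks i J ∧
      σ'.real xEta 0 = (1 / 2) ^ (J + 3) ∧ σ'.nat vStep 0 = J ∧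
      2 ^ 20 * 2 ^ i * l ≤ picks i J ∧ picks i J ≤ 2 ^ 23 * (2 ^ i * l)) σ := by
  refine Achieves.seq (τ₁ := 20 * m + 10) (τ₂ := 100 * l + 90) ?_ (by omega)
  refine Achieves.forLoop (τ := 7) (fun k σ' => ∀ s < k, σ'.nat nSupport s = 1)
    hm0 (by decide) (by decide) (by decide) (by simp) ?_ ?_ (by omega)
  · intro k hk σ' hF hv I1
    refine Achieves.of_wp ?_ (by decide)
    intro s hs
    rcases Nat.lt_succ_iff_lt_or_eq.1 hs with h' | rfl
    · simp [hv, h'.ne, I1 s h']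
    · simp [hv]
  intro σ₁ hF₁ hsup
  have hg₁ : σ₁.real xGuess 0 = 2 ^ i := by rw [hF₁.real _ (by decide), hg]
  have hlog₁ : σ₁.real xLog 0 = i := by rw [hF₁.real _ (by decide), hlog]
  have hl₁ : σ₁.real xLogCols 0 = l := by rw [hF₁.real _ (by decide), hl]
  clear hF₁
  refine Achieves.seq (τ₁ := 12) (τ₂ := 100 * l + 78) ?_ (by omega)
  refine Achieves.of_wp ?_ (by decide)
  refine Achieves.seq (τ₁ := 4) (τ₂ := 100 * l + 74) ?_ (by omega)
  refine Achieves.of_wp ?_ (by decide)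
  refine Achieves.seq (τ₁ := 10) (τ₂ := 100 * l + 64) ?_ (by omega)
  refine Achieves.of_wp ?_ (by decide)
  refine Achieves.seq (τ₁ := 4) (τ₂ := 100 * l + 60) ?_ (by omega)
  refine Achieves.of_wp ?_ (by decide)
  refine Achieves.loop (fun τ σ' => ∃ j, (∀ s < m, σ'.nat nSupport s = 1) ∧
    σ'.real xLogCols 0 = l ∧ σ'.real xScale 0 = (i * 8 ^ j : ℕ) ∧
    σ'.real xPicks 0 = picks i j ∧ σ'.real xEta 0 = (1 / 2) ^ (j + 3) ∧ σ'.nat vStep 0 = j ∧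
    picks i j ≤ 2 ^ 23 * (2 ^ i * l) ∧ 100 * (l - i * 8 ^ j) + 20 ≤ τ) ?_ ?_
  · rintro τ σ' ⟨j, h1, h2, h3, h4, h5, h6, h7, hτ⟩
    simp only [Test.holds_ltReal, RExp.eval_var, h2, h3, Nat.cast_lt, not_lt]
    refine ⟨fun hle => ⟨?_, j, ⟨by simp, fun s hs => by simp [h1 s hs, hs]⟩, h4, h5, h6, ?_, h7⟩,
      fun hlt => ⟨50, 100 * (l - i * 8 ^ (j + 1)) + 20, ?_, ?_⟩⟩
    · refine le_trans ?_ (le_trans (Nat.le_add_left 20 _) hτ)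
      decide
    · calc 2 ^ 20 * 2 ^ i * l ≤ 2 ^ 20 * 2 ^ i * (i * 8 ^ j) := Nat.mul_le_mul_left _ hle
        _ = picks i j := by unfold picks; ring
    · have : (Test.ltReal (.var xScale) (.var xLogCols)).cost = 6 := rfl
      have h8 : 1 ≤ i * 8 ^ j := Nat.mul_pos hi (by positivity)
      have h9 : i * 8 ^ (j + 1) = 8 * (i * 8 ^ j) := by ring
      omega
    · refine Achieves.of_wp ?_ (by decide)
      refine ⟨j + 1, ?_, ?_, ?_, ?_, ?_, ?_, ?_, le_rfl⟩
      · simpa [setR] using h1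
      · simpa [setR] using h2
      · simp [h3]; ring
      · simp [h4, picks_succ]
      · simp [h5]; ring
      · simp [h6]
      · rw [picks_succ]
        calc picks i j * 8 = 2 ^ 23 * (2 ^ i * (i * 8 ^ j)) := by unfold picks; ring
          _ ≤ 2 ^ 23 * (2 ^ i * l) := by gcongr
  · refine ⟨0, by simpa [setR] using hsup, by simpa [setR] using hl₁, by simp [hlog₁], ?_,
      by simp; norm_num, by simp, ?_, by simp; omega⟩
    · simp [hg₁, hlog₁, picks]
    · calc picks i 0 = 2 ^ 20 * (2 ^ i * i) := by unfold picks; ring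
        _ ≤ 2 ^ 23 * (2 ^ i * l) := by gcongr <;> norm_num

/-- An instance of the hitting set problem: a set of `k` of the `m` columns hits all of the
`n` rows, and the rows have polynomially many traces on every set of columns. -/
structure HittingInstance (m n k : ℕ) (B : ℕ → Finset ℕ) : Prop where
  pos : 0 < n
  two_le : 2 ≤ k
  hits : ∃ O ⊆ range m, O.card = k ∧ ∀ t < n, (O ∩ B t).Nonempty
  traces : ∀ A ⊆ range m, ((range n).image fun t => A ∩ B t).card ≤ (A.card + 1) ^ 30

theorem HittingInstance.le {m n k : ℕ} {B : ℕ → Finset ℕ} (h : HittingInstance m n k B) :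
    k ≤ m := by
  obtain ⟨O, hO, hk, -⟩ := h.hits
  simpa [hk] using card_le_card hO

/-- The numbers of picks decrease geometrically, so the first step dominates the running time,
which is bounded whether or not the guess `2 ^ i` is large enough. -/
theorem runSchedule_achieves {m n k i l J : ℕ} {B : ℕ → Finset ℕ} {σ : Store}
    (h : HasRows m n B σ) (hB : HittingInstance m n k B) (hml : m ≤ 2 ^ l) (hi : 1 ≤ i)
    (hil : i ≤ l) (hA : Encodes nSupport m (range m) σ) (hp : σ.real xPicks 0 = picks i J)
    (heta : σ.real xEta 0 = (1 / 2) ^ (J + 3)) (hstep : σ.nat vStep 0 = J)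
    (hJ : 2 ^ 20 * 2 ^ i * l ≤ picks i J) :
    Achieves runSchedule (1900 * (m * n) * picks i J) (fun σ' => ∃ A, Encodes nSupport m A σ' ∧
      A.card ≤ picks i 0 ∧ (k ≤ 2 ^ i → ∀ t < n, (A ∩ B t).Nonempty)) σ := by
  have hn := hB.pos
  have hm : 0 < m := lt_of_lt_of_le (by have := hB.two_le; omega) hB.le
  have hmn : 1 ≤ m * n := Nat.mul_pos hm hn
  have hmnp : 1 ≤ m * n * picks i J := Nat.mul_pos hmn (picks_pos hi J)
  refine Achieves.seq (τ₁ := 10) (τ₂ := 1800 * (m * n) * picks i J + 50) ?_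
    (by rw [mul_assoc, mul_assoc _ (m * n)]; omega)
  refine Achieves.of_wp ?_ (by decide)
  have h₀ : HasRows m n B (σ.setReal xRate 0 (1 / 4)) :=
    ⟨h.cols, h.rows, h.base, h.cell⟩
  refine Achieves.seq (τ₁ := 800 * (m * n) * picks i J)
    (τ₂ := 1000 * (m * n) * picks i J + 50) ?_
    (by rw [mul_assoc, mul_assoc 1000, mul_assoc 1800]; omega)
  have hfirst := thin_achieves (p := picks i J) (η := 1 / 4) (A := range m)
    (σ := σ.setReal xRate 0 (1 / 4)) h₀ ⟨hA.lt, hA.mem⟩ ⟨0, by simpa using hm⟩ hm hn (by norm_num)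
    (by norm_num) (by simp) (picks_pos hi J) (by simpa using hp) (hB.traces _ Subset.rfl)
  simp only [setR, RExp.eval_div, RExp.eval_const, NExp.eval_const, Nat.cast_one,
    Nat.cast_ofNat]
  refine hfirst.imp le_rfl ?_
  rintro σ₁ hF₁ ⟨A₁, hthin, hA₁⟩
  have h₁ : HasRows m n B σ₁ :=
    h₀.congr (hF₁.nat _ (by decide)) (hF₁.nat _ (by decide)) (hF₁.nat _ (by decide))
  refine Achieves.loop (fun τ σ' => ∃ j A, HasRows m n B σ' ∧ Encodes nSupport m A σ' ∧
    A.Nonempty ∧ A.card ≤ picks i j ∧ σ'.real xPicks 0 = picks i j ∧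
    σ'.real xEta 0 = (1 / 2) ^ (j + 3) ∧ σ'.nat vStep 0 = j ∧
    (k ≤ 2 ^ i → Fractional B n A (level i j)) ∧ 1000 * (m * n) * picks i j + 50 ≤ τ) ?_ ?_
  · rintro τ σ' ⟨j, A, h', hA', hne, hcard, hp', heta', hstep', hfrac, hτ⟩
    simp only [Test.holds_leNat, NExp.eval_const, NExp.eval_var, hstep']
    refine ⟨fun hj => ?_, fun hj => ?_⟩
    · obtain rfl : j = 0 := by omega
      refine ⟨?_, A, hA', hcard, fun hk t ht =>
        (hfrac hk).nonempty_inter (level_pos i 0) ht⟩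
      refine le_trans ?_ (le_trans (Nat.le_add_left 50 _) hτ)
      decide
    · obtain ⟨j, rfl⟩ : ∃ j', j = j' + 1 := ⟨j - 1, by omega⟩
      refine ⟨800 * (m * n) * picks i j + 40, 1000 * (m * n) * picks i j + 50, ?_, ?_⟩
      · have : (Test.leNat (.const 1) (.var vStep)).cost = 4 := rfl
        have hpj : 1 ≤ m * n * picks i j := Nat.mul_pos hmn (picks_pos hi j)
        rw [picks_succ] at hτ
        have e : 1000 * (m * n) * (picks i j * 8) = 8000 * (m * n * picks i j) := by ring
        have e1 : 1000 * (m * n) * picks i j = 1000 * (m * n * picks i j) := by ring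
        have e2 : 800 * (m * n) * picks i j = 800 * (m * n * picks i j) := by ring
        omega
      · refine Achieves.seq (τ₁ := 6) (τ₂ := 800 * (m * n) * picks i j + 34) ?_ (by omega)
        refine Achieves.of_wp ?_ (by decide)
        refine Achieves.seq (τ₁ := 10) (τ₂ := 800 * (m * n) * picks i j + 24) ?_ (by omega)
        refine Achieves.of_wp ?_ (by decide)
        refine Achieves.seq (τ₁ := 10) (τ₂ := 800 * (m * n) * picks i j + 14) ?_ (by omega)
        refine Achieves.of_wp ?_ (by decide)
        refine Achieves.seq (τ₁ := 4) (τ₂ := 800 * (m * n) * picks i j + 10) ?_ (by omega)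
        refine Achieves.of_wp ?_ (by decide)
        simp only [Program.wp]
        set σ₂ := (((σ'.setNat vStep ((NExp.const 0).eval σ')
          ((NExp.sub (.var vStep) (.const 1)).eval σ')).setReal xPicks _ _).setReal xEta _
            _).setReal xRate _ _ with hσ₂
        have e1 : σ₂.real xRate 0 = (1 / 2) ^ (j + 3) := by
          simp [hσ₂, heta']
          ring
        have e2 : σ₂.real xPicks 0 = picks i j := by
          simp [hσ₂, hp', picks_succ]
        have e3 : σ₂.real xEta 0 = (1 / 2) ^ (j + 3) := by
          simp [hσ₂, heta']
          ring
        have e4 : σ₂.nat vStep 0 = j := by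
          simp [hσ₂, hstep']
        have h₂ : HasRows m n B σ₂ := ⟨by simp [hσ₂, h'.cols], by simp [hσ₂, h'.rows],
          by simpa [hσ₂] using h'.base, by simpa [hσ₂] using h'.cell⟩
        have hA₂ : Encodes nSupport m A σ₂ := ⟨hA'.lt, by simpa [hσ₂] using hA'.mem⟩
        clear_value σ₂
        refine (thin_achieves h₂ hA₂ hne hm hn (η := (1 / 2) ^ (j + 3)) (by positivity)
          (pow_lt_one₀ (by norm_num) (by norm_num) (by omega)) e1 (picks_pos hi j) e2
          (hB.traces A fun s hs => mem_range.2 (hA'.lt s hs))).imp (by omega) ?_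
        rintro σ₃ hF₃ ⟨A₃, hthin₃, hA₃⟩
        refine ⟨j, A₃, h₂.congr (hF₃.nat _ (by decide)) (hF₃.nat _ (by decide))
          (hF₃.nat _ (by decide)), hA₃, hthin₃.nonempty, hthin₃.card_le, ?_, ?_, ?_,
          fun hk => hthin₃.fractional_step hi hcard (hfrac hk), le_rfl⟩
        · rw [hF₃.real _ (by decide), e2]
        · rw [hF₃.real _ (by decide), e3]
        · rw [hF₃.nat _ (by decide), e4]
  · refine ⟨J, A₁, h₁, hA₁, hthin.nonempty, hthin.card_le, ?_, ?_, ?_, fun hk => ?_, le_rfl⟩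
    · rw [hF₁.real _ (by decide)]; simpa using hp
    · rw [hF₁.real _ (by decide)]; simpa using heta
    · rw [hF₁.nat _ (by decide)]; simpa using hstep
    · obtain ⟨O, hO, hOk, hhit⟩ := hB.hits
      have hk0 : 0 < k := by have := hB.two_le; omega
      exact hthin.fractional_first (card_range m).le hml (hi.trans hil) hk0 hk hJ
        (Fractional.of_hits hO hOk hk0 hhit)

theorem tryGuess_achieves {m n k i l : ℕ} {B : ℕ → Finset ℕ} {σ : Store}
    (h : HasRows m n B σ) (hB : HittingInstance m n k B) (hml : m ≤ 2 ^ l) (hi : 1 ≤ i)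
    (hil : i ≤ l) (hg : σ.real xGuess 0 = 2 ^ i) (hlog : σ.real xLog 0 = i)
    (hl : σ.real xLogCols 0 = l) :
    Achieves tryGuess (2 ^ 35 * (m * n) * l * 2 ^ i) (fun σ' => ∃ A, Encodes nSupport m A σ' ∧
      A.card ≤ picks i 0 ∧ (σ'.nat vOk 0 ≠ 0 ↔ ∀ t < n, (A ∩ B t).Nonempty) ∧
      (k ≤ 2 ^ i → σ'.nat vOk 0 ≠ 0)) σ := by
  have hn := hB.pos
  have hm : 0 < m := lt_of_lt_of_le (by have := hB.two_le; omega) hB.le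
  have hmn : 1 ≤ m * n := Nat.mul_pos hm hn
  have hmn' : m ≤ m * n := Nat.le_mul_of_pos_right m hn
  set V := 2 ^ i * l with hV
  have hV1 : l ≤ V := Nat.le_mul_of_pos_left l (by positivity)
  have hV2 : m * n ≤ m * n * V := Nat.le_mul_of_pos_right _ (by omega)
  have hV3 : V ≤ m * n * V := Nat.le_mul_of_pos_left _ hmn
  refine Achieves.seq (τ₁ := 20 * m + 100 * l + 100)
    (τ₂ := 1900 * (2 ^ 23 * (m * n * V)) + 200 * (m * n)) ?_ ?_
  swap
  · have : 2 ^ 35 * (m * n) * l * 2 ^ i = 2 ^ 35 * (m * n * V) := by rw [hV]; ring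
    rw [this]
    omega
  refine (startSchedule_achieves h.cols hi hil hg hlog hl).imp le_rfl ?_
  rintro σ₁ hF₁ ⟨J, hA₁, hp, heta, hstep, hlow, hup⟩
  have h₁ : HasRows m n B σ₁ :=
    h.congr (hF₁.nat _ (by decide)) (hF₁.nat _ (by decide)) (hF₁.nat _ (by decide))
  refine Achieves.seq (τ₁ := 1900 * (m * n) * picks i J) (τ₂ := 200 * (m * n)) ?_ ?_
  swap
  · rw [← hV] at hup
    have := Nat.mul_le_mul_left (1900 * (m * n)) hup
    have e : 1900 * (m * n) * (2 ^ 23 * V) = 1900 * (2 ^ 23 * (m * n * V)) := by ring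
    omega
  refine (runSchedule_achieves h₁ hB hml hi hil hA₁ hp heta hstep hlow).imp le_rfl ?_
  rintro σ₂ hF₂ ⟨A, hA, hcard, hhit⟩
  have h₂ : HasRows m n B σ₂ :=
    h₁.congr (hF₂.nat _ (by decide)) (hF₂.nat _ (by decide)) (hF₂.nat _ (by decide))
  refine (checkHits_achieves h₂ hA hm hn).imp le_rfl fun σ₃ hF₃ hok => ?_
  exact ⟨A, hA.congr (hF₃.nat _ (by decide)), hcard, hok, fun hk => hok.2 (hhit hk)⟩

/-- The guess never reaches `2 * k`, since an attempt succeeds once the guess is at least `k`; the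
times of the attempts form a geometric series. -/
theorem findHittingSet_achieves {m n k l : ℕ} {B : ℕ → Finset ℕ} {σ : Store}
    (h : HasRows m n B σ) (hB : HittingInstance m n k B) (hml : m ≤ 2 ^ l)
    (hl : σ.real xLogCols 0 = l) :
    Achieves findHittingSet (2 ^ 39 * (m * n) * l * k) (fun σ' => ∃ A, Encodes nSupport m A σ' ∧
      (∀ t < n, (A ∩ B t).Nonempty) ∧ ∃ i, 2 ^ i < 2 * k ∧ A.card ≤ picks i 0) σ := by
  have hn := hB.pos
  have hk := hB.two_le
  have hkm := hB.le
  have hm : 0 < m := by omega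
  have hmn : 1 ≤ m * n := Nat.mul_pos hm hn
  have hl1 : 1 ≤ l := by
    by_contra! h0
    obtain rfl : l = 0 := by omega
    simp at hml; omega
  set U := 2 ^ 36 * (m * n) * l with hU
  have hU1 : 2 ^ 36 ≤ U := by
    calc 2 ^ 36 = 2 ^ 36 * 1 * 1 := by norm_num
      _ ≤ U := by rw [hU]; gcongr
  have hUk : 2 ^ 39 * (m * n) * l * k = 8 * (U * k) := by rw [hU]; ring
  have hUk' : U ≤ U * k := Nat.le_mul_of_pos_right _ (by omega)
  rw [hUk]
  refine Achieves.seq (τ₁ := 4) (τ₂ := U * (4 * k) + 100) ?_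
    (by have : U * (4 * k) = 4 * (U * k) := by ring
        omega)
  refine Achieves.of_wp ?_ (by decide)
  refine Achieves.seq (τ₁ := 4) (τ₂ := U * (4 * k) + 90) ?_ (by omega)
  refine Achieves.of_wp ?_ (by decide)
  refine Achieves.seq (τ₁ := 3) (τ₂ := U * (4 * k) + 80) ?_ (by omega)
  refine Achieves.of_wp ?_ (by decide)
  -- the attempts from the guess `2 ^ i` on take time `U * (2 ^ i + 2 ^ (i + 1) + ⋯)`, with last
  -- guess less than `2 * k`
  refine Achieves.loop (fun τ σ' => 50 ≤ τ ∧
    ((σ'.nat vOk 0 ≠ 0 ∧ ∃ A, Encodes nSupport m A σ' ∧ (∀ t < n, (A ∩ B t).Nonempty) ∧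
      ∃ i, 2 ^ i < 2 * k ∧ A.card ≤ picks i 0) ∨
    ∃ i : ℕ, σ'.nat vOk 0 = 0 ∧ HasRows m n B σ' ∧ σ'.real xLogCols 0 = l ∧ 1 ≤ i ∧ 2 ^ i < 2 * k ∧
      σ'.real xGuess 0 = (2 : ℝ) ^ i ∧ σ'.real xLog 0 = (i : ℝ) ∧ U * (4 * k - 2 ^ i) + 50 ≤ τ)) ?_ ?_
  · rintro τ σ' ⟨hτ, hcase⟩
    simp only [Test.holds_leNat, NExp.eval_const, NExp.eval_var]
    rcases hcase with ⟨hok, hA⟩ | ⟨i, hok, h', hl', hi, hik, hg, hlog, hτ'⟩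
    · refine ⟨fun _ => ⟨le_trans (by decide) hτ, hA⟩, fun h0 => absurd h0 (by omega)⟩
    · refine ⟨fun h0 => absurd hok.le h0, fun _ => ?_⟩
      refine ⟨2 ^ 35 * (m * n) * l * 2 ^ i + 50, U * (4 * k - 2 ^ (i + 1)) + 50, ?_, ?_⟩
      · have hcost : (Test.leNat (.var vOk) (.const 0)).cost = 4 := rfl
        have e1 : 4 * k - 2 ^ i = (4 * k - 2 ^ (i + 1)) + 2 ^ i := by
          rw [pow_succ]; omega
        rw [e1, mul_add] at hτ'
        have e2 : U * 2 ^ i = 2 * (2 ^ 35 * (m * n) * l * 2 ^ i) := by rw [hU]; ring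
        have e3 : U ≤ U * 2 ^ i := Nat.le_mul_of_pos_right _ (by positivity)
        omega
      · have hil : i ≤ l := by
          have : 2 ^ i < 2 ^ (l + 1) := by rw [pow_succ]; omega
          have := (Nat.pow_lt_pow_iff_right (by norm_num)).1 this
          omega
        refine Achieves.seq (τ₂ := 50) ?_ le_rfl
        refine (tryGuess_achieves h' hB hml hi hil hg hlog hl').imp le_rfl ?_
        rintro σ₁ hF₁ ⟨A, hA, hcard, hok₁, hk₁⟩
        refine Achieves.of_wp ?_ (by decide)
        simp only [Program.wp, Test.holds_nonzero, NExp.eval_var]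
        refine ⟨fun hb => ⟨by omega, Or.inl ⟨hb, A, hA, hok₁.1 hb, i, hik, hcard⟩⟩, fun hb => ?_⟩
        refine ⟨by omega, Or.inr ⟨i + 1, ?_, ?_, ?_, by omega, ?_, ?_, ?_, le_rfl⟩⟩
        · simpa using not_not.1 hb
        · have h₁ : HasRows m n B σ₁ :=
            h'.congr (hF₁.nat _ (by decide)) (hF₁.nat _ (by decide)) (hF₁.nat _ (by decide))
          exact ⟨h₁.cols, h₁.rows, h₁.base, h₁.cell⟩
        · have := hF₁.real xLogCols (by decide)
          simp [this, hl']
        · have : ¬ k ≤ 2 ^ i := fun h => hb (hk₁ h)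
          rw [pow_succ]; omega
        · have := hF₁.real xGuess (by decide)
          simp [this, hg, pow_succ]
        · have := hF₁.real xLog (by decide)
          simp [this, hlog]
  · refine ⟨by omega, Or.inr ⟨1, by simp, ?_, by simpa using hl, le_rfl, by omega,
      by simp, by simp, ?_⟩⟩
    · exact ⟨by simp [h.cols], by simp [h.rows], by simpa using h.base,
        by simpa using h.cell⟩
    · have : U * (4 * k - 2 ^ 1) ≤ U * (4 * k) := Nat.mul_le_mul_left _ (by omega)
      omega

end RealRAM

/-! ### The rows of a round -/

/-- An input: `m` sensors at `(px s, py s)`, `n` targets at `(tx t, ty t)`, and the parameters. -/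
structure Scene where
  m : ℕ
  n : ℕ
  px : ℕ → ℝ
  py : ℕ → ℝ
  tx : ℕ → ℝ
  ty : ℕ → ℝ
  α : ℝ
  R : ℝ
  δ : ℝ

namespace Scene

variable (c : Scene)

/-- The vector from target `t` to sensor `s`. -/
def vec (s t : ℕ) : ℝ × ℝ := (c.px s - c.tx t, c.py s - c.ty t)

/-- The squared distance of sensor `s` from target `t`. -/
def distSq (s t : ℕ) : ℝ := (c.vec s t).1 * (c.vec s t).1 + (c.vec s t).2 * (c.vec s t).2

/-- The angle between the lines from target `t` to the sensors `s` and `s'`. -/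
noncomputable def ang (s s' t : ℕ) : ℝ := lineAngle (c.vec s t) (c.vec s' t)

/-- Sensor `s` is within distance `R` of target `t` but not at `t`. -/
def Visible (s t : ℕ) : Prop := 0 < c.distSq s t ∧ Real.sqrt (c.distSq s t) ≤ c.R

theorem Visible.vec_ne_zero {c : Scene} {s t : ℕ} (h : c.Visible s t) : c.vec s t ≠ 0 := by
  intro h0
  have := h.1
  simp [distSq, h0] at this

/-- The set `O` of sensors `α`-covers the target `t`. -/
def Feasible (O : Finset ℕ) (t : ℕ) : Prop :=
  ∃ u ∈ O, ∃ v ∈ O, u ≠ v ∧ c.Visible u t ∧ c.Visible v t ∧ c.α ≤ c.ang u v t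

open Classical in
/-- The sensors that see target `t`. -/
noncomputable def nearRow (t : ℕ) : Finset ℕ := (range c.m).filter fun s => c.Visible s t

/-- The target with the sensor pair `p`, `q` at line angle `w` needs no better pair. -/
def Done (p q : ℕ) (w : ℝ) : Prop := c.α ≤ w ∧ p ≠ q

/-- Sensor `s` forms with `p` or `q` a pair of distinct sensors whose line angle is at least
halfway between `w` and `α`. -/
def Improves (p q : ℕ) (w : ℝ) (s t : ℕ) : Prop :=
  s ≠ p ∧ ((c.α + w) / 2 ≤ c.ang p s t ∨ (c.α + w) / 2 ≤ c.ang s q t)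

open Classical in
/-- The sensors that a round of the algorithm may use to improve the pair `P t`, `Q t` of the
target `t`. -/
noncomputable def farRow (P Q : ℕ → ℕ) (W : ℕ → ℝ) (t : ℕ) : Finset ℕ :=
  (range c.m).filter fun s =>
    c.Visible s t ∧ (c.Done (P t) (Q t) (W t) ∨ c.Improves (P t) (Q t) (W t) s t)

@[simp] theorem mem_nearRow {s t : ℕ} : s ∈ c.nearRow t ↔ s < c.m ∧ c.Visible s t := by
  simp [nearRow]

@[simp] theorem mem_farRow {P Q : ℕ → ℕ} {W : ℕ → ℝ} {s t : ℕ} : s ∈ c.farRow P Q W t ↔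
    s < c.m ∧ c.Visible s t ∧
      (c.Done (P t) (Q t) (W t) ∨ c.Improves (P t) (Q t) (W t) s t) := by
  simp [farRow]

/-- The sensors `p`, `q` from `S` see `t`, their line angle is `w`, and it has the size guaranteed
after `r` rounds. -/
structure Pair (S : Finset ℕ) (r t p q : ℕ) (w : ℝ) : Prop where
  fst_mem : p ∈ S
  snd_mem : q ∈ S
  fst_visible : c.Visible p t
  snd_visible : c.Visible q t
  angle : w = c.ang p q t
  ne : r ≠ 0 → p ≠ q
  le : c.α * (1 - (1 / 2) ^ r) ≤ w

variable {c}

theorem Pair.mono {S S' : Finset ℕ} {r t p q : ℕ} {w : ℝ} (h : c.Pair S r t p q w)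
    (hS : S ⊆ S') : c.Pair S' r t p q w :=
  { h with fst_mem := hS h.fst_mem, snd_mem := hS h.snd_mem }

theorem Pair.init {S : Finset ℕ} {t s : ℕ} (hs : s ∈ S) (hv : c.Visible s t) :
    c.Pair S 0 t s s 0 :=
  ⟨hs, hs, hv, hv, (lineAngle_self hv.vec_ne_zero).symm, fun h => absurd rfl h, by simp⟩

theorem Pair.done {S : Finset ℕ} {r t p q : ℕ} {w : ℝ} (h : c.Pair S r t p q w)
    (h0 : 0 ≤ c.α) (hd : c.Done p q w) : c.Pair S (r + 1) t p q w :=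
  { h with
    ne := fun _ => hd.2
    le := by
      have : (0 : ℝ) ≤ (1 / 2) ^ (r + 1) := by positivity
      nlinarith [hd.1] }

theorem Pair.half_le {S : Finset ℕ} {r t p q : ℕ} {w x : ℝ} (h : c.Pair S r t p q w)
    (hx : (c.α + w) / 2 ≤ x) : c.α * (1 - (1 / 2) ^ (r + 1)) ≤ x := by
  have := h.le
  rw [pow_succ]
  linarith

theorem Pair.improve_snd {S : Finset ℕ} {r t p q s : ℕ} {w : ℝ} (h : c.Pair S r t p q w)
    (hs : s ∈ S) (hv : c.Visible s t) (hi : c.Improves p q w s t)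
    (hle : (c.α + w) / 2 ≤ c.ang p s t) : c.Pair S (r + 1) t p s (c.ang p s t) :=
  ⟨h.fst_mem, hs, h.fst_visible, hv, rfl, fun _ => hi.1.symm, h.half_le hle⟩

theorem Pair.improve_fst {S : Finset ℕ} {r t p q s : ℕ} {w : ℝ} (h : c.Pair S r t p q w)
    (hs : s ∈ S) (hv : c.Visible s t) (hi : c.Improves p q w s t)
    (hle : ¬ (c.α + w) / 2 ≤ c.ang p s t) : c.Pair S (r + 1) t s q (c.ang s q t) := by
  have h1 := hi.2.resolve_left hle
  refine ⟨hs, h.snd_mem, hv, h.snd_visible, rfl, fun _ hsq => ?_, h.half_le h1⟩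
  have h2 : c.ang s q t = 0 := by rw [hsq]; exact lineAngle_self h.snd_visible.vec_ne_zero
  have h3 : 0 ≤ c.ang p s t := lineAngle_nonneg _ _
  linarith

/-- A set of sensors that `α`-covers `t` contains one that can improve the pair of `t`. -/
theorem Pair.exists_mem_farRow {S O : Finset ℕ} {r t : ℕ} {P Q : ℕ → ℕ} {W : ℕ → ℝ}
    (h : c.Pair S r t (P t) (Q t) (W t)) (h0 : 0 ≤ c.α) (hα : c.α ≤ Real.pi / 3)
    (hO : O ⊆ range c.m) (hf : c.Feasible O t) : (O ∩ c.farRow P Q W t).Nonempty := by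
  obtain ⟨u, hu, v, hv, huv, hvu, hvv, hang⟩ := hf
  have hW0 : 0 ≤ W t := by rw [h.angle]; exact lineAngle_nonneg _ _
  suffices H : ∃ s ∈ O, c.Visible s t ∧ (c.Done (P t) (Q t) (W t) ∨
      c.Improves (P t) (Q t) (W t) s t) by
    obtain ⟨s, hs, hs'⟩ := H
    exact ⟨s, mem_inter.2 ⟨hs, c.mem_farRow.2 ⟨mem_range.1 (hO hs), hs'⟩⟩⟩
  by_cases hd : c.Done (P t) (Q t) (W t)
  · exact ⟨u, hu, hvu, Or.inl hd⟩
  by_cases hlt : W t < c.α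
  · have hpp : c.ang (P t) (P t) t = 0 := lineAngle_self h.fst_visible.vec_ne_zero
    -- such a sensor differs from the first one of the pair
    have key : ∀ s, ((c.α + W t) / 2 ≤ c.ang (P t) s t ∨ (c.α + W t) / 2 ≤ c.ang (Q t) s t) →
        c.Improves (P t) (Q t) (W t) s t := by
      intro s hs
      have hcomm : c.ang (Q t) s t = c.ang s (Q t) t := lineAngle_comm _ _
      rw [hcomm] at hs
      refine ⟨?_, hs⟩
      rintro rfl
      rw [hpp, ← h.angle] at hs
      rcases hs with hs | hs <;> linarith
    have hlt' := hlt
    rw [h.angle] at hlt'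
    have := exists_far_line h.fst_visible.vec_ne_zero h.snd_visible.vec_ne_zero
      hvu.vec_ne_zero hvv.vec_ne_zero hα hlt' hang
    have hW : lineAngle (c.vec (P t) t) (c.vec (Q t) t) = W t := h.angle.symm
    rw [hW] at this
    rcases this with h1 | h1
    · exact ⟨u, hu, hvu, Or.inr (key u h1)⟩
    · exact ⟨v, hv, hvv, Or.inr (key v h1)⟩
  · -- here `α = 0`, and a second sensor is all that is missing
    have hPQ : P t = Q t := by
      by_contra hne
      exact hd ⟨not_lt.1 hlt, hne⟩
    have hW : W t = 0 := by
      rw [h.angle, hPQ]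
      exact lineAngle_self h.snd_visible.vec_ne_zero
    have hα0 : c.α = 0 := by linarith
    have hthr : (c.α + W t) / 2 = 0 := by rw [hα0, hW]; norm_num
    by_cases hup : u = P t
    · refine ⟨v, hv, hvv, Or.inr ⟨fun h' => huv (hup.trans h'.symm), Or.inl ?_⟩⟩
      rw [hthr]; exact lineAngle_nonneg _ _
    · refine ⟨u, hu, hvu, Or.inr ⟨hup, Or.inl ?_⟩⟩
      rw [hthr]; exact lineAngle_nonneg _ _

/-! ### The rows of a round are Boolean combinations of quadrics -/

theorem exists_quadric_const (x : ℝ) : ∃ a, ∀ u v, quadric a u v = x :=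
  ⟨![x, 0, 0, 0, 0, 0], fun u v => by simp [quadric]⟩

/-- The function `k - e ((u - x)² + (v - y)²) - (a (u - x) + b (v - y))²` is quadratic. -/
theorem exists_quadric (k e a b x y : ℝ) : ∃ q, ∀ u v, quadric q u v =
    k - e * ((u - x) * (u - x) + (v - y) * (v - y)) -
      (a * (u - x) + b * (v - y)) * (a * (u - x) + b * (v - y)) := by
  refine ⟨![k - e * (x * x + y * y) - (a * x + b * y) * (a * x + b * y),
    2 * e * x + 2 * a * (a * x + b * y), 2 * e * y + 2 * b * (a * x + b * y),
    - e - a * a, - 2 * a * b, - e - b * b], fun u v => ?_⟩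
  simp only [quadric, Matrix.cons_val]
  ring

/-- The way in which rows are composed of five quadrics. -/
def rowShape (f : Fin 5 → Prop) : Prop := f 0 ∧ ¬ f 1 ∧ ¬ f 2 ∧ (f 3 ∨ f 4)

/-- If `R < 0`, the disk is empty, although its equation depends on `R ^ 2` only. -/
theorem exists_quadric_disk (c : Scene) (t : ℕ) : ∃ q₀ q₁, ∀ s,
    c.Visible s t ↔ 0 ≤ quadric q₀ (c.px s) (c.py s) ∧ ¬ 0 ≤ quadric q₁ (c.px s) (c.py s) := by
  obtain ⟨q₁, h₁⟩ := exists_quadric 0 1 0 0 (c.tx t) (c.ty t)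
  have h₁' : ∀ s, 0 < c.distSq s t ↔ ¬ 0 ≤ quadric q₁ (c.px s) (c.py s) := by
    intro s
    rw [h₁, not_le, distSq, vec]
    constructor <;> intro h <;> linarith
  by_cases hR : 0 ≤ c.R
  · obtain ⟨q₀, h₀⟩ := exists_quadric (c.R ^ 2) 1 0 0 (c.tx t) (c.ty t)
    refine ⟨q₀, q₁, fun s => ?_⟩
    rw [Visible, h₁' s, and_comm, Real.sqrt_le_left hR, h₀, distSq, vec]
    refine and_congr_left fun _ => ?_
    constructor <;> intro h <;> linarith
  · obtain ⟨q₀, h₀⟩ := exists_quadric_const (-1)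
    refine ⟨q₀, q₁, fun s => ?_⟩
    rw [h₀]
    constructor
    · intro h
      exact absurd ((Real.sqrt_nonneg _).trans h.2) hR
    · intro h
      linarith [h.1]

theorem exists_quadrics_nearRow (c : Scene) (t : ℕ) : ∃ q : Fin 5 → Fin 6 → ℝ, ∀ s < c.m,
    s ∈ c.nearRow t ↔ rowShape fun i => 0 ≤ quadric (q i) (c.px s) (c.py s) := by
  obtain ⟨q₀, q₁, h⟩ := exists_quadric_disk c t
  obtain ⟨q₂, h₂⟩ := exists_quadric_const (-1)
  obtain ⟨q₃, h₃⟩ := exists_quadric_const 0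
  refine ⟨![q₀, q₁, q₂, q₃, q₃], fun s hs => ?_⟩
  simp [rowShape, hs, h s, h₂, h₃]

/-- The five quadrics are the disk, its center, the sensor `P t`, and the two double wedges of lines
that are far from those of the pair. -/
theorem exists_quadrics_farRow {P Q : ℕ → ℕ} {W : ℕ → ℝ} {S : Finset ℕ} {r t : ℕ}
    (h : c.Pair S r t (P t) (Q t) (W t)) (h0 : 0 ≤ c.α) (hα : c.α ≤ Real.pi / 3)
    (hS : S ⊆ range c.m)
    (hinj : ∀ s < c.m, ∀ s' < c.m, c.px s = c.px s' → c.py s = c.py s' → s = s') :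
    ∃ q : Fin 5 → Fin 6 → ℝ, ∀ s < c.m,
      s ∈ c.farRow P Q W t ↔ rowShape fun i => 0 ≤ quadric (q i) (c.px s) (c.py s) := by
  by_cases hd : c.Done (P t) (Q t) (W t)
  · obtain ⟨q, hq⟩ := exists_quadrics_nearRow c t
    refine ⟨q, fun s hs => ?_⟩
    rw [← hq s hs]
    simp [hd]
  obtain ⟨q₀, q₁, hdisk⟩ := exists_quadric_disk c t
  obtain ⟨q₂, h₂⟩ := exists_quadric 0 1 0 0 (c.px (P t)) (c.py (P t))
  set γ := (c.α + W t) / 2 with hγ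
  have hW0 : 0 ≤ W t := by rw [h.angle]; exact lineAngle_nonneg _ _
  have hW1 : W t ≤ Real.pi / 2 := by rw [h.angle]; exact lineAngle_le _ _
  have hγ0 : 0 ≤ γ := by rw [hγ]; linarith
  have hγ1 : γ ≤ Real.pi / 2 := by rw [hγ]; linarith [Real.pi_pos]
  have hcone : ∀ p, c.Visible p t → ∃ q, ∀ s, c.Visible s t →
      (γ ≤ c.ang p s t ↔ 0 ≤ quadric q (c.px s) (c.py s)) := by
    intro p hp
    obtain ⟨q, hq⟩ := exists_quadric 0 (- (Real.cos γ ^ 2 * c.distSq p t)) (c.vec p t).1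
      (c.vec p t).2 (c.tx t) (c.ty t)
    refine ⟨q, fun s hs => ?_⟩
    rw [ang, le_lineAngle_iff hp.vec_ne_zero hs.vec_ne_zero hγ0 hγ1, hq, distSq]
    simp only [vec]
    constructor <;> intro h <;> linarith
  obtain ⟨q₃, h₃⟩ := hcone _ h.fst_visible
  obtain ⟨q₄, h₄⟩ := hcone _ h.snd_visible
  refine ⟨![q₀, q₁, q₂, q₃, q₄], fun s hs => ?_⟩
  have hne : s ≠ P t ↔ ¬ 0 ≤ quadric q₂ (c.px s) (c.py s) := by
    rw [h₂, not_iff_not]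
    constructor
    · rintro rfl; simp
    · intro hle
      have h1 := mul_self_nonneg (c.px s - c.px (P t))
      have h2 := mul_self_nonneg (c.py s - c.py (P t))
      refine hinj s hs _ (mem_range.1 (hS h.fst_mem)) ?_ ?_
      · exact sub_eq_zero.1 (mul_self_eq_zero.1 (by linarith))
      · exact sub_eq_zero.1 (mul_self_eq_zero.1 (by linarith))
  simp only [mem_farRow, hd, false_or, Improves, ← hγ, hs, true_and, rowShape, Matrix.cons_val]
  constructor
  · rintro ⟨hv, h1, h2⟩
    have hcomm : c.ang s (Q t) t = c.ang (Q t) s t := lineAngle_comm _ _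
    rw [hcomm, h₃ s hv, h₄ s hv] at h2
    exact ⟨((hdisk s).1 hv).1, ((hdisk s).1 hv).2, hne.1 h1, h2⟩
  · rintro ⟨h1, h2, h3, h4⟩
    have hv := (hdisk s).2 ⟨h1, h2⟩
    have hcomm : c.ang s (Q t) t = c.ang (Q t) s t := lineAngle_comm _ _
    rw [← h₃ s hv, ← h₄ s hv, ← hcomm] at h4
    exact ⟨hv, hne.2 h3, h4⟩

open RealRAM

/-- Rows that are composed of quadrics and hit by a small set form an instance of the hitting set
problem that `findHittingSet` can solve. -/
theorem hittingInstance_of_quadrics {k : ℕ} {B : ℕ → Finset ℕ} {O : Finset ℕ} (hn : 0 < c.n)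
    (hk : 2 ≤ k) (hO : O ⊆ range c.m) (hOk : O.card = k)
    (hB : ∀ t < c.n, (O ∩ B t).Nonempty)
    (hq : ∀ t < c.n, ∃ q : Fin 5 → Fin 6 → ℝ, ∀ s < c.m,
      s ∈ B t ↔ rowShape fun i => 0 ≤ quadric (q i) (c.px s) (c.py s)) :
    HittingInstance c.m c.n k B where
  pos := hn
  two_le := hk
  hits := ⟨O, hO, hOk, hB⟩
  traces A hA := by
    have : ∀ t, ∃ q : Fin 5 → Fin 6 → ℝ, t < c.n → ∀ s < c.m,
        s ∈ B t ↔ rowShape fun i => 0 ≤ quadric (q i) (c.px s) (c.py s) := by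
      intro t
      by_cases ht : t < c.n
      · obtain ⟨q, hq⟩ := hq t ht
        exact ⟨q, fun _ => hq⟩
      · exact ⟨0, fun h => absurd h ht⟩
    choose q hq using this
    exact card_traces_le_of_quadrics c.n c.px c.py (fun i t => q t i) rowShape B A
      fun t ht s hs => hq t ht s (mem_range.1 (hA hs))

end Scene

namespace RealRAM

/-! ### Geometric expressions and tests -/

/-- The first coordinate of the vector from target `t` to sensor `s`. -/
def RExp.dx (s t : NExp) : RExp := .sub (.get rSensorX s) (.get rTargetX t)

/-- The second coordinate of the vector from target `t` to sensor `s`. -/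
def RExp.dy (s t : NExp) : RExp := .sub (.get rSensorY s) (.get rTargetY t)

/-- The inner product of the vectors from target `t` to the sensors `s` and `s'`. -/
def RExp.dot (s s' t : NExp) : RExp :=
  .add (.mul (.dx s t) (.dx s' t)) (.mul (.dy s t) (.dy s' t))

/-- The angle between the lines from target `t` to the sensors `s` and `s'`. -/
def RExp.ang (s s' t : NExp) : RExp :=
  .arccos (.sqrt (.div (.mul (.dot s s' t) (.dot s s' t)) (.mul (.dot s s t) (.dot s' s' t))))

/-- Halfway between the angle of the pair of target `t` and `α`. -/
def RExp.halfway (t : NExp) : RExp :=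
  .div (.add (.get rParam (.const 0)) (.get rAngle t)) (.const 2)

/-- The test whether target `t` sees sensor `s`. -/
def Test.visible (s t : NExp) : Test :=
  .conj (.ltReal (.const 0) (.dot s s t)) (.leReal (.sqrt (.dot s s t)) (.get rParam (.const 1)))

/-- The test whether target `t` needs no better pair. -/
def Test.done (t : NExp) : Test :=
  .conj (.leReal (.get rParam (.const 0)) (.get rAngle t)) (.neg (.eqNat (.get nFst t) (.get nSnd t)))

/-- The test whether sensor `s` improves the pair of target `t`. -/
def Test.improves (s t : NExp) : Test :=
  .conj (.neg (.eqNat s (.get nFst t)))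
    (.disj (.leReal (.halfway t) (.ang (.get nFst t) s t))
      (.leReal (.halfway t) (.ang s (.get nSnd t) t)))

/-- The memory holds the input `c`, the offsets of the matrix rows, and the number `l` in the
variable for the logarithm of the number of sensors. -/
structure HasScene (c : Scene) (l : ℕ) (σ : Store) : Prop where
  cols : σ.nat nDims 0 = c.m
  rows : σ.nat nDims 1 = c.n
  base : ∀ t < c.n, σ.nat nBase t = t * c.m
  px : σ.real rSensorX = c.px
  py : σ.real rSensorY = c.py
  tx : σ.real rTargetX = c.tx
  ty : σ.real rTargetY = c.ty
  α : σ.real rParam 0 = c.α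
  R : σ.real rParam 1 = c.R
  δ : σ.real rParam 2 = c.δ
  log : σ.real xLogCols 0 = l

theorem HasScene.congr {c : Scene} {l : ℕ} {σ σ' : Store} (h : HasScene c l σ)
    (h0 : σ'.nat nDims = σ.nat nDims) (h3 : σ'.nat nBase = σ.nat nBase)
    (hr : ∀ a < 5, σ'.real a = σ.real a) (hl : σ'.real xLogCols = σ.real xLogCols) :
    HasScene c l σ' where
  cols := by rw [h0, h.cols]
  rows := by rw [h0, h.rows]
  base := by rw [h3]; exact h.base
  px := by rw [hr _ (by decide), h.px]
  py := by rw [hr _ (by decide), h.py]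
  tx := by rw [hr _ (by decide), h.tx]
  ty := by rw [hr _ (by decide), h.ty]
  α := by rw [hr _ (by decide), h.α]
  R := by rw [hr _ (by decide), h.R]
  δ := by rw [hr _ (by decide), h.δ]
  log := by rw [hl, h.log]

/-- Programs that do not write to the arrays of the input keep the input. -/
theorem HasScene.frame {c : Scene} {l : ℕ} {σ σ' : Store} {p : Program} (h : HasScene c l σ)
    (hF : Frame p σ σ') (hn : nDims ∉ p.natMods ∧ nBase ∉ p.natMods)
    (hr : ∀ a < 5, a ∉ p.realMods) (hl : xLogCols ∉ p.realMods) : HasScene c l σ' :=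
  h.congr (hF.nat _ hn.1) (hF.nat _ hn.2) (fun a ha => hF.real a (hr a ha)) (hF.real _ hl)

section eval

variable {c : Scene} {l : ℕ} {σ : Store}

theorem HasScene.eval_dot (h : HasScene c l σ) (s s' t : NExp) : (RExp.dot s s' t).eval σ =
    (c.vec (s.eval σ) (t.eval σ)).1 * (c.vec (s'.eval σ) (t.eval σ)).1 +
      (c.vec (s.eval σ) (t.eval σ)).2 * (c.vec (s'.eval σ) (t.eval σ)).2 := by
  simp [RExp.dot, RExp.dx, RExp.dy, Scene.vec, h.px, h.py, h.tx, h.ty]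

theorem HasScene.eval_ang (h : HasScene c l σ) (s s' t : NExp) :
    (RExp.ang s s' t).eval σ = c.ang (s.eval σ) (s'.eval σ) (t.eval σ) := by
  simp only [RExp.ang, RExp.eval_arccos, RExp.eval_sqrt, RExp.eval_div, RExp.eval_mul, h.eval_dot]
  rfl

theorem HasScene.eval_halfway (h : HasScene c l σ) (t : NExp) :
    (RExp.halfway t).eval σ = (c.α + σ.real rAngle (t.eval σ)) / 2 := by
  simp [RExp.halfway, h.α]

theorem HasScene.holds_visible (h : HasScene c l σ) (s t : NExp) :
    (Test.visible s t).Holds σ ↔ c.Visible (s.eval σ) (t.eval σ) := by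
  simp only [Test.visible, Test.holds_conj, Test.holds_ltReal, Test.holds_leReal, RExp.eval_sqrt,
    h.eval_dot, RExp.eval_const, RExp.eval_get, NExp.eval_const, h.R, Nat.cast_zero]
  rfl

theorem HasScene.holds_done (h : HasScene c l σ) (t : NExp) : (Test.done t).Holds σ ↔
    c.Done (σ.nat nFst (t.eval σ)) (σ.nat nSnd (t.eval σ)) (σ.real rAngle (t.eval σ)) := by
  simp [Test.done, Scene.Done, h.α]

theorem HasScene.holds_improves (h : HasScene c l σ) (s t : NExp) : (Test.improves s t).Holds σ ↔
    c.Improves (σ.nat nFst (t.eval σ)) (σ.nat nSnd (t.eval σ)) (σ.real rAngle (t.eval σ))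
      (s.eval σ) (t.eval σ) := by
  simp [Test.improves, Scene.Improves, h.eval_ang, h.eval_halfway]

end eval

/-! ### The incidence matrix -/

/-- Compute the offsets of the rows of the incidence matrix. -/
def setOffsets : Program :=
  setN vAcc (.const 0) ;;
  forLoop vRow 1 (.assignNat nBase (.var vRow) (.var vAcc) ;;
    setN vAcc (.add (.var vAcc) (.get nDims (.const 0))))

/-- Compute the incidence matrix: the test decides whether column `vCol` lies in row `vRow`. -/
def fillMatrix (b : Test) : Program :=
  forLoop vRow 1 (forLoop vCol 0 (.branch b
    (.assignNat nMatrix (.add (.get nBase (.var vRow)) (.var vCol)) (.const 1))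
    (.assignNat nMatrix (.add (.get nBase (.var vRow)) (.var vCol)) (.const 0))))

theorem setOffsets_achieves {m n : ℕ} {σ : Store} (hm : σ.nat nDims 0 = m)
    (hn : σ.nat nDims 1 = n) :
    Achieves setOffsets (40 * n + 20) (fun σ' => ∀ t < n, σ'.nat nBase t = t * m) σ := by
  refine Achieves.seq (τ₁ := 3) (τ₂ := 40 * n + 10) ?_ (by omega)
  refine Achieves.of_wp ?_ (by decide)
  refine Achieves.forLoop (τ := 20) (fun i σ' => σ'.nat vAcc 0 = i * m ∧
    ∀ t < i, σ'.nat nBase t = t * m) (n := n) (by simp [hn]) (by decide) (by decide) (by decide)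
    (by simp) ?_ (fun σ' _ hI => hI.2) (by omega)
  rintro i hi σ' hF hv ⟨I1, I2⟩
  have hm' : σ'.nat nDims 0 = m := by rw [hF.nat _ (by decide)]; simp [hm]
  refine Achieves.of_wp ?_ (by decide)
  refine ⟨?_, fun t ht => ?_⟩
  · simp [I1, hm']; ring
  · rcases Nat.lt_succ_iff_lt_or_eq.1 ht with h' | rfl
    · simp [hv, h'.ne, I2 t h']
    · simp [hv, I1]

theorem mul_add_inj {m t t' s s' : ℕ} (hs : s < m) (hs' : s' < m) :
    t * m + s = t' * m + s' ↔ t = t' ∧ s = s' := by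
  refine ⟨fun h => ?_, fun ⟨h, h'⟩ => by rw [h, h']⟩
  have h1 : (t * m + s) / m = t := by
    rw [mul_comm, Nat.mul_add_div (by omega), Nat.div_eq_of_lt hs, add_zero]
  have h2 : (t' * m + s') / m = t' := by
    rw [mul_comm, Nat.mul_add_div (by omega), Nat.div_eq_of_lt hs', add_zero]
  have h3 : t = t' := by rw [← h1, h, h2]
  subst h3
  exact ⟨rfl, by omega⟩

theorem fillMatrix_achieves {m n a : ℕ} {b : Test} {B : ℕ → Finset ℕ} {σ : Store}
    (hm : σ.nat nDims 0 = m) (hn : σ.nat nDims 1 = n) (hbase : ∀ t < n, σ.nat nBase t = t * m)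
    (ha : b.cost ≤ a) (hm0 : 0 < m) (hn0 : 0 < n)
    (hb : ∀ t < n, ∀ s < m, ∀ σ', Frame (fillMatrix b) σ σ' → σ'.nat vRow 0 = t →
      σ'.nat vCol 0 = s → (b.Holds σ' ↔ s ∈ B t)) :
    Achieves (fillMatrix b) ((a + 80) * (m * n)) (HasRows m n B) σ := by
  have hmn : n ≤ m * n := Nat.le_mul_of_pos_left n hm0
  have hmn' : 1 ≤ m * n := Nat.mul_pos hm0 hn0
  refine Achieves.forLoop (τ := (a + 35) * m + 10) (fun i σ' =>
    ∀ t < i, ∀ s < m, σ'.nat nMatrix (t * m + s) = if s ∈ B t then 1 else 0)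
    hn (by decide) (by simp [natMods_forLoop, Program.natMods])
    (by simp [natMods_forLoop, Program.natMods]) (by simp) ?_ ?_ ?_
  · intro i hi σ₁ hF₁ hv hI
    have hF₁' : Frame (fillMatrix b) σ σ₁ := hF₁
    have hm₁ : σ₁.nat nDims 0 = m := by
      rw [hF₁.nat _ (by simp [natMods_forLoop, Program.natMods]), hm]
    have hbase₁ : σ₁.nat nBase i = i * m := by
      rw [hF₁.nat _ (by simp [natMods_forLoop, Program.natMods]), hbase i hi]
    refine Achieves.forLoop (τ := a + 22) (fun j σ' =>
      (∀ t < i, ∀ s < m, σ'.nat nMatrix (t * m + s) = if s ∈ B t then 1 else 0) ∧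
      ∀ s < j, σ'.nat nMatrix (i * m + s) = if s ∈ B i then 1 else 0) hm₁
      (by decide) (by simp [Program.natMods]) (by simp [Program.natMods])
      (by simpa using hI) ?_ ?_ (by ring_nf; omega)
    · rintro j hj σ₂ hF₂ hv₂ ⟨I1, I2⟩
      have hrow : σ₂.nat vRow 0 = i := by
        rw [hF₂.nat _ (by simp [natMods_forLoop, Program.natMods]), hv]
      have hbase₂ : σ₂.nat nBase i = i * m := by
        rw [hF₂.nat _ (by simp [natMods_forLoop, Program.natMods]), hbase₁]
      have hF : Frame (fillMatrix b) σ σ₂ := by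
        refine hF₁'.trans (hF₂.mono ?_ ?_)
        · simp [fillMatrix, natMods_forLoop, Program.natMods]
        · simp [fillMatrix, realMods_forLoop, Program.realMods]
      have hiff := hb i hi j hj σ₂ hF hrow hv₂
      -- the effect of writing the right value
      have hwrite : ∀ x, x = (if j ∈ B i then 1 else 0) →
          (∀ t < i, ∀ s < m, (σ₂.setNat nMatrix (i * m + j) x).nat nMatrix (t * m + s) =
            if s ∈ B t then 1 else 0) ∧
          ∀ s < j + 1, (σ₂.setNat nMatrix (i * m + j) x).nat nMatrix (i * m + s) =
            if s ∈ B i then 1 else 0 := by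
        rintro x rfl
        refine ⟨fun t ht s hs => ?_, fun s hs => ?_⟩
        · rw [Store.setNat_nat, if_neg, I1 t ht s hs]
          rw [mul_add_inj hs hj]
          omega
        · rcases Nat.lt_succ_iff_lt_or_eq.1 hs with h' | rfl
          · rw [Store.setNat_nat, if_neg, I2 s h']
            omega
          · simp
      refine Achieves.branch (τ₁ := 10) (fun h => ?_) (fun h => ?_) (by omega)
      · refine Achieves.of_wp (p := .assignNat _ _ _) ?_ (by decide)
        have := hwrite 1 (by rw [if_pos (hiff.1 h)])
        simpa [Program.wp, hrow, hv₂, hbase₂] using this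
      · refine Achieves.of_wp (p := .assignNat _ _ _) ?_ (by decide)
        have := hwrite 0 (by rw [if_neg (hiff.not.1 h)])
        simpa [Program.wp, hrow, hv₂, hbase₂] using this
    · rintro σ₂ hF₂ ⟨I1, I2⟩ t ht s hs
      rw [Store.setNat_nat_of_ne _ _ _ (by decide)]
      rcases Nat.lt_succ_iff_lt_or_eq.1 ht with h' | rfl
      · exact I1 t h' s hs
      · exact I2 s hs
  · intro σ' hF hI
    refine ⟨?_, ?_, ?_, hI⟩
    · rw [hF.nat _ (by simp [natMods_forLoop, Program.natMods]), hm]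
    · rw [hF.nat _ (by simp [natMods_forLoop, Program.natMods]), hn]
    · rw [hF.nat _ (by simp [natMods_forLoop, Program.natMods])]
      exact hbase
  · have e : n * ((a + 35) * m + 10 + 13) + 10 = (a + 35) * (m * n) + 23 * n + 10 := by ring
    have e' : (a + 80) * (m * n) = (a + 35) * (m * n) + 45 * (m * n) := by ring
    rw [e, e']
    omega

/-! ### Rounds of the algorithm -/

/-- Give every target the pair that consists twice of a selected sensor that it sees. -/
def initPairs : Program :=
  forLoop vRow 1 (scanRow ;;
    .assignNat nFst (.var vRow) (.sub (.var vHit) (.const 1)) ;;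
    .assignNat nSnd (.var vRow) (.sub (.var vHit) (.const 1)) ;;
    .assignReal rAngle (.var vRow) (.const 0))

/-- Replace one sensor in the pair of every target that is not done. -/
def improvePairs : Program :=
  forLoop vRow 1 (scanRow ;;
    .branch (.done (.var vRow)) .skip
      (.branch (.leReal (.halfway (.var vRow))
          (.ang (.get nFst (.var vRow)) (.sub (.var vHit) (.const 1)) (.var vRow)))
        (.assignReal rAngle (.var vRow)
            (.ang (.get nFst (.var vRow)) (.sub (.var vHit) (.const 1)) (.var vRow)) ;;
          .assignNat nSnd (.var vRow) (.sub (.var vHit) (.const 1)))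
        (.assignReal rAngle (.var vRow)
            (.ang (.sub (.var vHit) (.const 1)) (.get nSnd (.var vRow)) (.var vRow)) ;;
          .assignNat nFst (.var vRow) (.sub (.var vHit) (.const 1)))))

/-- Add the current set of columns to the output. -/
def selectSupport : Program :=
  forLoop vCol 0 (.branch (.nonzero (.get nSupport (.var vCol)))
    (.assignNat nSelected (.var vCol) (.const 1)) .skip)

/-- The first round: hit the disks of all targets. -/
def firstRound : Program :=
  fillMatrix (.visible (.var vCol) (.var vRow)) ;; findHittingSet ;; initPairs ;; selectSupport

/-- The test for membership in the row of a later round. -/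
def Test.far : Test :=
  .conj (.visible (.var vCol) (.var vRow))
    (.disj (.done (.var vRow)) (.improves (.var vCol) (.var vRow)))

/-- A later round: at least halve the gap between `α` and the angle of each pair. -/
def nextRound : Program :=
  fillMatrix .far ;; findHittingSet ;; improvePairs ;; selectSupport

/-- The pairs of all targets are as good as `r` rounds guarantee, with sensors from `S`. -/
def HasPairs (c : Scene) (S : Finset ℕ) (r : ℕ) (σ : Store) : Prop :=
  ∀ t < c.n, c.Pair S r t (σ.nat nFst t) (σ.nat nSnd t) (σ.real rAngle t)

theorem selectSupport_achieves {m : ℕ} {A S : Finset ℕ} {σ : Store} (hm : σ.nat nDims 0 = m)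
    (hA : Encodes nSupport m A σ) (hS : Encodes nSelected m S σ) :
    Achieves selectSupport (40 * m + 10) (Encodes nSelected m (S ∪ A)) σ := by
  refine Achieves.forLoop (τ := 20) (fun i σ' => ∀ s < m, σ'.nat nSelected s ≠ 0 ↔
    s ∈ S ∨ (s ∈ A ∧ s < i)) hm (by decide) (by decide) (by decide) (by simpa using hS.mem)
    ?_ ?_ (by omega)
  · intro i hi σ' hF hv hI
    have hA' : Encodes nSupport m A σ' := hA.congr (hF.nat _ (by decide))
    have hiff := hA'.mem i hi
    refine Achieves.of_wp ?_ (by decide)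
    simp only [Program.wp, Test.holds_nonzero, NExp.eval_get, NExp.eval_var, hv, hiff,
      NExp.eval_const, Store.setNat_nat, Nat.reduceEqDiff, false_and, if_false, true_and]
    refine ⟨fun hiA s hs => ?_, fun hiA s hs => ?_⟩
    · by_cases hsi : s = i
      · subst hsi; simp [hiA]
      · rw [if_neg hsi, hI s hs]
        have : s < i + 1 ↔ s < i := by omega
        rw [this]
    · rw [hI s hs]
      refine or_congr_right (and_congr_right fun hsA => ?_)
      have : s ≠ i := fun h => hiA (h ▸ hsA)
      omega
  · intro σ' hF hI
    refine ⟨fun s hs => ?_, fun s hs => ?_⟩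
    · rcases mem_union.1 hs with h | h
      exacts [hS.lt s h, hA.lt s h]
    · rw [hI s hs, mem_union]
      simp [hs]

theorem initPairs_achieves {c : Scene} {l : ℕ} {A S : Finset ℕ} {σ : Store}
    (h : HasScene c l σ) (hB : HasRows c.m c.n c.nearRow σ) (hA : Encodes nSupport c.m A σ)
    (hhit : ∀ t < c.n, (A ∩ c.nearRow t).Nonempty) (hAS : A ⊆ S) (hm : 0 < c.m) (hn : 0 < c.n) :
    Achieves initPairs (200 * (c.m * c.n)) (HasPairs c S 0) σ := by
  have hmn : c.n ≤ c.m * c.n := Nat.le_mul_of_pos_left c.n hm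
  refine Achieves.forLoop (τ := 60 * c.m + 50) (fun i σ' => ∀ t < i,
    c.Pair S 0 t (σ'.nat nFst t) (σ'.nat nSnd t) (σ'.real rAngle t)) h.rows
    (by decide) (by decide) (by decide) (by simp) ?_ (fun _ _ hI => hI)
    (by ring_nf at hmn ⊢; omega)
  intro i hi σ₁ hF₁ hv hI
  have hB₁ : HasRows c.m c.n c.nearRow σ₁ :=
    hB.congr (hF₁.nat _ (by decide)) (hF₁.nat _ (by decide)) (hF₁.nat _ (by decide))
  have hA₁ : Encodes nSupport c.m A σ₁ := hA.congr (hF₁.nat _ (by decide))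
  refine Achieves.seq (τ₁ := 60 * c.m + 20) (τ₂ := 30) ?_ (by omega)
  refine (scanRow_achieves hB₁ hA₁ hi hv).imp le_rfl fun σ₂ hF₂ h₂ => ?_
  obtain ⟨s, hs, hhit₂⟩ : ∃ s ∈ A ∩ c.nearRow i, σ₂.nat vHit 0 = s + 1 :=
    h₂.resolve_left fun h' => (hhit i hi).ne_empty h'.2
  obtain ⟨hsA, hsr⟩ := mem_inter.1 hs
  have hv₂ : σ₂.nat vRow 0 = i := by rw [hF₂.nat _ (by decide), hv]
  have hfst : σ₂.nat nFst = σ₁.nat nFst := hF₂.nat _ (by decide)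
  have hsnd : σ₂.nat nSnd = σ₁.nat nSnd := hF₂.nat _ (by decide)
  have hang : σ₂.real rAngle = σ₁.real rAngle := hF₂.real _ (by decide)
  refine Achieves.of_wp ?_ (by decide)
  intro t ht
  rcases Nat.lt_succ_iff_lt_or_eq.1 ht with h' | rfl
  · simpa [hv₂, h'.ne, hfst, hsnd, hang] using hI t h'
  · simpa [hv₂, hhit₂] using Scene.Pair.init (hAS hsA) (c.mem_nearRow.1 hsr).2

theorem improvePairs_achieves {c : Scene} {l r : ℕ} {A S S' : Finset ℕ} {σ : Store}
    (h : HasScene c l σ) (hP : HasPairs c S r σ)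
    (hB : HasRows c.m c.n (c.farRow (σ.nat nFst) (σ.nat nSnd) (σ.real rAngle)) σ)
    (hA : Encodes nSupport c.m A σ)
    (hhit : ∀ t < c.n, (A ∩ c.farRow (σ.nat nFst) (σ.nat nSnd) (σ.real rAngle) t).Nonempty)
    (hSS : S ⊆ S') (hAS : A ⊆ S') (h0 : 0 ≤ c.α) (hm : 0 < c.m) (hn : 0 < c.n) :
    Achieves improvePairs (1000 * (c.m * c.n)) (HasPairs c S' (r + 1)) σ := by
  have hmn : c.n ≤ c.m * c.n := Nat.le_mul_of_pos_left c.n hm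
  set P := σ.nat nFst with hPdef
  set Q := σ.nat nSnd with hQdef
  set W := σ.real rAngle with hWdef
  refine Achieves.forLoop (τ := 60 * c.m + 620) (fun i σ' => (∀ t < i,
      c.Pair S' (r + 1) t (σ'.nat nFst t) (σ'.nat nSnd t) (σ'.real rAngle t)) ∧
    ∀ t, i ≤ t → σ'.nat nFst t = P t ∧ σ'.nat nSnd t = Q t ∧ σ'.real rAngle t = W t) h.rows
    (by decide) (by decide) (by decide) (by simp [hPdef, hQdef, hWdef]) ?_
    (fun _ _ hI => hI.1) (by ring_nf at hmn ⊢; omega)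
  rintro i hi σ₁ hF₁ hv ⟨I1, I2⟩
  have hB₁ : HasRows c.m c.n (c.farRow P Q W) σ₁ :=
    hB.congr (hF₁.nat _ (by decide)) (hF₁.nat _ (by decide)) (hF₁.nat _ (by decide))
  have hA₁ : Encodes nSupport c.m A σ₁ := hA.congr (hF₁.nat _ (by decide))
  have h₁ : HasScene c l σ₁ := h.frame hF₁ (by decide) (by decide) (by decide)
  refine Achieves.seq (τ₁ := 60 * c.m + 20) (τ₂ := 600) ?_ (by omega)
  refine (scanRow_achieves hB₁ hA₁ hi hv).imp le_rfl fun σ₂ hF₂ h₂ => ?_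
  obtain ⟨s, hs, hhit₂⟩ : ∃ s ∈ A ∩ c.farRow P Q W i, σ₂.nat vHit 0 = s + 1 :=
    h₂.resolve_left fun h' => (hhit i hi).ne_empty h'.2
  obtain ⟨hsA, hsr⟩ := mem_inter.1 hs
  obtain ⟨-, hvis, himp⟩ := c.mem_farRow.1 hsr
  have hv₂ : σ₂.nat vRow 0 = i := by rw [hF₂.nat _ (by decide), hv]
  have hfst : σ₂.nat nFst = σ₁.nat nFst := hF₂.nat _ (by decide)
  have hsnd : σ₂.nat nSnd = σ₁.nat nSnd := hF₂.nat _ (by decide)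
  have hang : σ₂.real rAngle = σ₁.real rAngle := hF₂.real _ (by decide)
  have hsc₂ : HasScene c l σ₂ := h₁.frame hF₂ (by decide) (by decide) (by decide)
  rw [← hfst, ← hsnd, ← hang] at I1 I2
  clear_value P Q W
  obtain ⟨hPi, hQi, hWi⟩ := I2 i le_rfl
  have hpair : c.Pair S' r i (P i) (Q i) (W i) := by
    have := (hP i hi).mono hSS
    rwa [← hPdef, ← hQdef, ← hWdef] at this
  have hsS : s ∈ S' := hAS hsA
  refine Achieves.of_wp ?_ (by decide)
  simp only [Program.wp, hsc₂.holds_done, Test.holds_leReal, hsc₂.eval_halfway, hsc₂.eval_ang,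
    NExp.eval_var, NExp.eval_get, NExp.eval_sub, NExp.eval_const, hv₂, hhit₂, Nat.add_sub_cancel,
    hPi, hQi, hWi, Store.setNat_nat, Store.setNat_real, Store.setReal_nat, Store.setReal_real,
    Nat.reduceEqDiff, false_and, if_false, true_and]
  refine ⟨fun hd => ⟨fun t ht => ?_, fun t ht => I2 t (by omega)⟩,
    fun hd => ⟨fun hle => ⟨fun t ht => ?_, fun t ht => ?_⟩,
      fun hle => ⟨fun t ht => ?_, fun t ht => ?_⟩⟩⟩
  · rcases Nat.lt_succ_iff_lt_or_eq.1 ht with h' | rfl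
    · exact I1 t h'
    · rw [hPi, hQi, hWi]
      exact hpair.done h0 hd
  · rcases Nat.lt_succ_iff_lt_or_eq.1 ht with h' | rfl
    · simpa [h'.ne] using I1 t h'
    · simpa [hPi] using hpair.improve_snd hsS hvis (himp.resolve_left hd) hle
  · have : t ≠ i := by omega
    simpa [this] using I2 t (by omega)
  · rcases Nat.lt_succ_iff_lt_or_eq.1 ht with h' | rfl
    · simpa [h'.ne] using I1 t h'
    · simpa [hv₂, hQi] using hpair.improve_fst hsS hvis (himp.resolve_left hd) hle
  · have : t ≠ i := by omega
    simpa [this] using I2 t (by omega)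

/-- What the algorithm presupposes about an input with optimum `k`, and the number `l` that bounds
the logarithm of the number of sensors. -/
structure Valid (c : Scene) (l k : ℕ) : Prop where
  pos : 0 < c.n
  two_le : 2 ≤ k
  opt : ∃ O ⊆ range c.m, O.card = k ∧ ∀ t < c.n, c.Feasible O t
  α_nonneg : 0 ≤ c.α
  α_le : c.α ≤ Real.pi / 3
  inj : ∀ s < c.m, ∀ s' < c.m, c.px s = c.px s' → c.py s = c.py s' → s = s'
  le_two_pow : c.m ≤ 2 ^ l

theorem Valid.le {c : Scene} {l k : ℕ} (h : Valid c l k) : k ≤ c.m := by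
  obtain ⟨O, hO, hk, -⟩ := h.opt
  simpa [hk] using card_le_card hO

theorem Valid.one_le {c : Scene} {l k : ℕ} (h : Valid c l k) : 1 ≤ l := by
  by_contra! h0
  obtain rfl : l = 0 := by omega
  have h1 := h.le_two_pow
  have h2 := h.le
  have h3 := h.two_le
  simp at h1
  omega

/-- The number of sensors that one round may add when the optimum is `k`. -/
def roundSize (k : ℕ) : ℕ := 2 ^ 20 * (2 * k) * Nat.log 2 (2 * k)

theorem picks_zero_le_roundSize {i k : ℕ} (h : 2 ^ i < 2 * k) :
    picks i 0 ≤ roundSize k := by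
  unfold picks roundSize
  rw [pow_zero, mul_one]
  gcongr
  exact Nat.le_log_of_pow_le (by norm_num) h.le

/-- The state after round number `r`. -/
structure AfterRound (c : Scene) (l k r : ℕ) (σ : Store) : Prop where
  scene : HasScene c l σ
  selected : ∃ S, Encodes nSelected c.m S σ ∧ S.card ≤ (r + 1) * roundSize k ∧ HasPairs c S r σ

theorem firstRound_achieves {c : Scene} {l k : ℕ} {σ : Store} (hc : Valid c l k)
    (h : HasScene c l σ) (hS : ∀ s, σ.nat nSelected s = 0) :
    Achieves firstRound (2 ^ 40 * (c.m * c.n) * l * k) (AfterRound c l k 0) σ := by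
  have hn := hc.pos
  have hk := hc.two_le
  have hm : 0 < c.m := by have := hc.le; omega
  have hmn : 1 ≤ c.m * c.n := Nat.mul_pos hm hn
  have hmn' : c.m ≤ c.m * c.n := Nat.le_mul_of_pos_right c.m hn
  have hU : c.m * c.n ≤ c.m * c.n * l * k := by
    rw [mul_assoc _ l]
    exact Nat.le_mul_of_pos_right _ (Nat.mul_pos hc.one_le (by omega))
  have e1 : 2 ^ 40 * (c.m * c.n) * l * k = 2 ^ 40 * (c.m * c.n * l * k) := by ring
  have e2 : 2 ^ 39 * (c.m * c.n) * l * k = 2 ^ 39 * (c.m * c.n * l * k) := by ring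
  have hinst : HittingInstance c.m c.n k c.nearRow := by
    obtain ⟨O, hO, hOk, hf⟩ := hc.opt
    refine Scene.hittingInstance_of_quadrics hn hk hO hOk (fun t ht => ?_)
      fun t _ => Scene.exists_quadrics_nearRow c t
    obtain ⟨u, hu, -, -, -, hvu, -⟩ := hf t ht
    exact ⟨u, mem_inter.2 ⟨hu, c.mem_nearRow.2 ⟨mem_range.1 (hO hu), hvu⟩⟩⟩
  refine Achieves.seq (τ₁ := (200 + 80) * (c.m * c.n))
    (τ₂ := 2 ^ 39 * (c.m * c.n) * l * k + 300 * (c.m * c.n)) ?_ (by omega)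
  refine (fillMatrix_achieves (a := 200) (B := c.nearRow) h.cols h.rows h.base (by decide) hm hn
    ?_).imp le_rfl ?_
  · intro t ht s hs σ' hF hrow hcol
    have h' : HasScene c l σ' := h.frame hF (by decide) (by decide) (by decide)
    rw [h'.holds_visible, NExp.eval_var, NExp.eval_var, hrow, hcol, c.mem_nearRow]
    simp [hs]
  intro σ₁ hF₁ hB₁
  have h₁ : HasScene c l σ₁ := h.frame hF₁ (by decide) (by decide) (by decide)
  refine Achieves.seq (τ₁ := 2 ^ 39 * (c.m * c.n) * l * k) (τ₂ := 300 * (c.m * c.n)) ?_ le_rfl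
  refine (findHittingSet_achieves hB₁ hinst hc.le_two_pow h₁.log).imp le_rfl ?_
  rintro σ₂ hF₂ ⟨A, hA, hhit, i, hi, hcard⟩
  have h₂ : HasScene c l σ₂ := h₁.frame hF₂ (by decide) (by decide) (by decide)
  have hB₂ : HasRows c.m c.n c.nearRow σ₂ :=
    hB₁.congr (hF₂.nat _ (by decide)) (hF₂.nat _ (by decide)) (hF₂.nat _ (by decide))
  refine Achieves.seq (τ₁ := 200 * (c.m * c.n)) (τ₂ := 40 * c.m + 10) ?_ (by omega)
  refine (initPairs_achieves h₂ hB₂ hA hhit (S := ∅ ∪ A) (by simp) hm hn).imp le_rfl ?_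
  intro σ₃ hF₃ hP
  have h₃ : HasScene c l σ₃ := h₂.frame hF₃ (by decide) (by decide) (by decide)
  have hsel : Encodes nSelected c.m ∅ σ₃ := by
    refine ⟨by simp, fun s _ => ?_⟩
    rw [hF₃.nat _ (by decide), hF₂.nat _ (by decide), hF₁.nat _ (by decide), hS s]
    simp
  refine (selectSupport_achieves h₃.cols (hA.congr (hF₃.nat _ (by decide))) hsel).imp le_rfl ?_
  intro σ₄ hF₄ hS₄
  refine ⟨h₃.frame hF₄ (by decide) (by decide) (by decide), ∅ ∪ A, hS₄, ?_, ?_⟩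
  · rw [empty_union, zero_add, one_mul]
    exact hcard.trans (picks_zero_le_roundSize hi)
  · unfold HasPairs
    rw [hF₄.nat _ (by decide), hF₄.nat _ (by decide), hF₄.real _ (by decide)]
    exact hP

theorem nextRound_achieves {c : Scene} {l k r : ℕ} {σ : Store} (hc : Valid c l k)
    (h : AfterRound c l k r σ) :
    Achieves nextRound (2 ^ 40 * (c.m * c.n) * l * k) (AfterRound c l k (r + 1)) σ := by
  obtain ⟨h, S, hS, hSc, hP⟩ := h
  have hn := hc.pos
  have hk := hc.two_le
  have hm : 0 < c.m := by have := hc.le; omega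
  have hmn : 1 ≤ c.m * c.n := Nat.mul_pos hm hn
  have hmn' : c.m ≤ c.m * c.n := Nat.le_mul_of_pos_right c.m hn
  have hU : c.m * c.n ≤ c.m * c.n * l * k := by
    rw [mul_assoc _ l]
    exact Nat.le_mul_of_pos_right _ (Nat.mul_pos hc.one_le (by omega))
  have e1 : 2 ^ 40 * (c.m * c.n) * l * k = 2 ^ 40 * (c.m * c.n * l * k) := by ring
  have e2 : 2 ^ 39 * (c.m * c.n) * l * k = 2 ^ 39 * (c.m * c.n * l * k) := by ring
  set B := c.farRow (σ.nat nFst) (σ.nat nSnd) (σ.real rAngle) with hBdef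
  have hinst : HittingInstance c.m c.n k B := by
    obtain ⟨O, hO, hOk, hf⟩ := hc.opt
    refine Scene.hittingInstance_of_quadrics hn hk hO hOk (fun t ht => ?_) fun t ht => ?_
    · exact (hP t ht).exists_mem_farRow hc.α_nonneg hc.α_le hO (hf t ht)
    · exact Scene.exists_quadrics_farRow (hP t ht) hc.α_nonneg hc.α_le
        (fun s hs => mem_range.2 (hS.lt s hs)) hc.inj
  refine Achieves.seq (τ₁ := (1000 + 80) * (c.m * c.n))
    (τ₂ := 2 ^ 39 * (c.m * c.n) * l * k + 1100 * (c.m * c.n)) ?_ (by omega)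
  refine (fillMatrix_achieves (a := 1000) (B := B) h.cols h.rows h.base (by decide) hm hn
    ?_).imp le_rfl ?_
  · intro t ht s hs σ' hF hrow hcol
    have h' : HasScene c l σ' := h.frame hF (by decide) (by decide) (by decide)
    rw [Test.far, Test.holds_conj, Test.holds_disj, h'.holds_visible, h'.holds_done,
      h'.holds_improves, NExp.eval_var, NExp.eval_var, hrow, hcol, hBdef, c.mem_farRow,
      hF.nat nFst (by decide), hF.nat nSnd (by decide), hF.real rAngle (by decide)]
    simp [hs]
  intro σ₁ hF₁ hB₁
  have h₁ : HasScene c l σ₁ := h.frame hF₁ (by decide) (by decide) (by decide)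
  refine Achieves.seq (τ₁ := 2 ^ 39 * (c.m * c.n) * l * k) (τ₂ := 1100 * (c.m * c.n)) ?_ le_rfl
  refine (findHittingSet_achieves hB₁ hinst hc.le_two_pow h₁.log).imp le_rfl ?_
  rintro σ₂ hF₂ ⟨A, hA, hhit, i, hi, hcard⟩
  have h₂ : HasScene c l σ₂ := h₁.frame hF₂ (by decide) (by decide) (by decide)
  have e3 : σ₂.nat nFst = σ.nat nFst := (hF₂.nat _ (by decide)).trans (hF₁.nat _ (by decide))
  have e4 : σ₂.nat nSnd = σ.nat nSnd := (hF₂.nat _ (by decide)).trans (hF₁.nat _ (by decide))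
  have e5 : σ₂.real rAngle = σ.real rAngle :=
    (hF₂.real _ (by decide)).trans (hF₁.real _ (by decide))
  have hB₂ : HasRows c.m c.n B σ₂ :=
    hB₁.congr (hF₂.nat _ (by decide)) (hF₂.nat _ (by decide)) (hF₂.nat _ (by decide))
  have hP₂ : HasPairs c S r σ₂ := by
    unfold HasPairs
    rw [e3, e4, e5]
    exact hP
  rw [← e3, ← e4, ← e5] at hBdef
  refine Achieves.seq (τ₁ := 1000 * (c.m * c.n)) (τ₂ := 40 * c.m + 10) ?_ (by omega)
  refine (improvePairs_achieves h₂ hP₂ (hBdef ▸ hB₂) hA (hBdef ▸ hhit) (S' := S ∪ A)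
    subset_union_left subset_union_right hc.α_nonneg hm hn).imp le_rfl ?_
  intro σ₃ hF₃ hP₃
  have h₃ : HasScene c l σ₃ := h₂.frame hF₃ (by decide) (by decide) (by decide)
  have hsel : Encodes nSelected c.m S σ₃ := by
    refine hS.congr ?_
    rw [hF₃.nat _ (by decide), hF₂.nat _ (by decide), hF₁.nat _ (by decide)]
  refine (selectSupport_achieves h₃.cols (hA.congr (hF₃.nat _ (by decide))) hsel).imp le_rfl ?_
  intro σ₄ hF₄ hS₄
  refine ⟨h₃.frame hF₄ (by decide) (by decide) (by decide), S ∪ A, hS₄, ?_, ?_⟩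
  · refine (card_union_le _ _).trans ?_
    have := hcard.trans (picks_zero_le_roundSize hi)
    rw [add_mul (r + 1), one_mul]
    exact Nat.add_le_add hSc this
  · unfold HasPairs
    rw [hF₄.nat _ (by decide), hF₄.nat _ (by decide), hF₄.real _ (by decide)]
    exact hP₃

/-! ### The algorithm -/

/-- Compute the binary logarithm of the number of sensors, rounded up. -/
def setLogCols : Program :=
  setR xLogCols (.const 0) ;;
  setR xPow (.const 1) ;;
  .loop (.ltReal (.var xPow) (.ofNat (.get nDims (.const 0))))
    (setR xPow (.mul (.var xPow) (.const 2)) ;;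
      setR xLogCols (.add (.var xLogCols) (.const 1)))

/-- Rounds are repeated until the gap to `α` is at most `α / δ`. -/
def runRounds : Program :=
  firstRound ;;
  setR xCur (.const 1) ;;
  .loop (.ltReal (.var xCur) (.get rParam (.const 2)))
    (nextRound ;; setR xCur (.mul (.var xCur) (.const 2)))

/-- The sensor placement program. -/
def placeSensors : Program :=
  .branch (.leNat (.get nDims (.const 1)) (.const 0)) .skip (setOffsets ;; setLogCols ;; runRounds)

theorem setLogCols_achieves {m : ℕ} {σ : Store} (hm : σ.nat nDims 0 = m) (hm0 : 0 < m) :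
    Achieves setLogCols (50 * m + 50) (fun σ' => ∃ l : ℕ, σ'.real xLogCols 0 = l ∧ m ≤ 2 ^ l ∧
      2 ^ l < 2 * m) σ := by
  refine Achieves.seq (τ₁ := 4) (τ₂ := 50 * m + 46) ?_ (by omega)
  refine Achieves.of_wp ?_ (by decide)
  refine Achieves.seq (τ₁ := 4) (τ₂ := 50 * m + 40) ?_ (by omega)
  refine Achieves.of_wp ?_ (by decide)
  refine Achieves.loop (fun τ σ' => ∃ l : ℕ, σ'.nat nDims 0 = m ∧ σ'.real xLogCols 0 = l ∧
    σ'.real xPow 0 = (2 ^ l : ℕ) ∧ 2 ^ l < 2 * m ∧ 50 * (m - 2 ^ l) + 40 ≤ τ) ?_ ?_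
  · rintro τ σ' ⟨l, h1, h2, h3, h4, hτ⟩
    simp only [Test.holds_ltReal, RExp.eval_var, RExp.eval_ofNat, NExp.eval_get, NExp.eval_const,
      h1, h3, Nat.cast_lt, not_lt]
    refine ⟨fun hle => ⟨?_, l, h2, hle, h4⟩, fun hlt => ⟨30, 50 * (m - 2 ^ (l + 1)) + 40, ?_, ?_⟩⟩
    · refine le_trans ?_ (le_trans (Nat.le_add_left 40 _) hτ)
      decide
    · have : (Test.ltReal (.var xPow) (.ofNat (.get nDims (.const 0)))).cost = 7 := rfl
      have h5 : 1 ≤ 2 ^ l := Nat.one_le_two_pow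
      rw [pow_succ]
      omega
    · refine Achieves.of_wp ?_ (by decide)
      refine ⟨l + 1, ?_, ?_, ?_, ?_, le_rfl⟩
      · simpa using h1
      · simp [h2]
      · simp [h3, pow_succ]
      · rw [pow_succ]; omega
  · refine ⟨0, by simpa using hm, by simp, by simp, by omega, by omega⟩

theorem runRounds_achieves {c : Scene} {l k D : ℕ} {σ : Store} (hc : Valid c l k)
    (h : HasScene c l σ) (hS : ∀ s, σ.nat nSelected s = 0) (hδ : 1 < c.δ)
    (hD : c.δ ≤ 2 ^ D) :
    Achieves runRounds ((D + 2) * (2 ^ 41 * (c.m * c.n) * l * k)) (fun σ' => ∃ r, 0 < r ∧ r ≤ D ∧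
      c.δ ≤ 2 ^ r ∧ AfterRound c l k r σ') σ := by
  have hk := hc.two_le
  have hm : 0 < c.m := by have := hc.le; omega
  have hpos : 1 ≤ c.m * c.n * l * k :=
    Nat.mul_pos (Nat.mul_pos (Nat.mul_pos hm hc.pos) hc.one_le) (by omega)
  set U := c.m * c.n * l * k with hU
  have e1 : 2 ^ 40 * (c.m * c.n) * l * k = 2 ^ 40 * U := by rw [hU]; ring
  have e2 : 2 ^ 41 * (c.m * c.n) * l * k = 2 ^ 41 * U := by rw [hU]; ring
  rw [e2]
  refine Achieves.seq (τ₁ := 2 ^ 40 * U) (τ₂ := D * (2 ^ 41 * U) + 50) ?_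
    (by rw [add_mul]; omega)
  rw [← e1]
  refine (firstRound_achieves hc h hS).imp le_rfl fun σ₁ hF₁ h₁ => ?_
  refine Achieves.seq (τ₁ := 4) (τ₂ := D * (2 ^ 41 * U) + 40) ?_ (by omega)
  refine Achieves.of_wp ?_ (by decide)
  have hset : ∀ σ' r x, AfterRound c l k r σ' → AfterRound c l k r (σ'.setReal xCur 0 x) := by
    rintro σ' r x ⟨h', S, hS', hcard, hP⟩
    refine ⟨h'.congr rfl rfl (fun a ha => ?_) ?_, S, hS'.congr rfl, hcard, ?_⟩
    · have : a ≠ xCur := by omega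
      simp [Store.setReal, this]
    · funext j; simp
    · intro t ht
      simpa using hP t ht
  refine Achieves.loop (fun τ σ' => ∃ r ≤ D, AfterRound c l k r σ' ∧ σ'.real xCur 0 = 2 ^ r ∧
    (D - r) * (2 ^ 41 * U) + 40 ≤ τ) ?_ ?_
  · rintro τ σ' ⟨r, hr, h', hcur, hτ⟩
    simp only [Test.holds_ltReal, RExp.eval_var, RExp.eval_get, NExp.eval_const, hcur,
      h'.scene.δ, not_lt]
    refine ⟨fun hle => ⟨?_, r, ?_, hr, hle, h'⟩, fun hlt => ?_⟩
    · refine le_trans ?_ (le_trans (Nat.le_add_left 40 _) hτ)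
      decide
    · by_contra! h0
      obtain rfl : r = 0 := by omega
      rw [pow_zero] at hle
      linarith
    · have hrD : r < D := by
        by_contra! h0
        obtain rfl : r = D := by omega
        linarith
      refine ⟨2 ^ 40 * U + 10, (D - (r + 1)) * (2 ^ 41 * U) + 40, ?_, ?_⟩
      · have : (Test.ltReal (.var xCur) (.get rParam (.const 2))).cost = 6 := rfl
        have e : D - r = D - (r + 1) + 1 := by omega
        rw [e, add_mul] at hτ
        omega
      · refine Achieves.seq (τ₁ := 2 ^ 40 * U) (τ₂ := 10) ?_ le_rfl
        rw [← e1]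
        refine (nextRound_achieves hc h').imp le_rfl fun σ₂ hF₂ h₂ => ?_
        refine Achieves.of_wp ?_ (by decide)
        refine ⟨r + 1, hrD, hset _ _ _ h₂, ?_, le_rfl⟩
        have : σ₂.real xCur = σ'.real xCur := hF₂.real _ (by decide)
        simp [this, hcur, pow_succ]
  · exact ⟨0, Nat.zero_le _, hset _ _ _ h₁, by simp, by simp⟩

end RealRAM

open RealRAM

/-! ### Correctness of the sensor placement program -/

theorem le_four_mul_log {l m : ℕ} (hm : 2 ≤ m) (h : 2 ^ l ≤ 2 * m) : (l : ℝ) ≤ 4 * Real.log m := by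
  have hm0 : (0 : ℝ) < m := by positivity
  have h1 : Real.log ((2 : ℝ) ^ l) ≤ Real.log (2 * m) :=
    Real.log_le_log (by positivity) (by exact_mod_cast h)
  rw [Real.log_pow, Real.log_mul (by norm_num) hm0.ne'] at h1
  have h2 : Real.log 2 ≤ Real.log m := Real.log_le_log (by norm_num) (by exact_mod_cast hm)
  have h3 : 1 / 2 ≤ Real.log 2 := by linarith [Real.log_two_gt_d9]
  have h4 : (l : ℝ) * (1 / 2) ≤ l * Real.log 2 := by gcongr
  linarith

/-- The input in coordinates. -/
noncomputable def sceneOf {m n : ℕ} (x : Fin m → Plane) (t : Fin n → Plane) (α R δ : ℝ) : Scene :=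
  ⟨m, n, coordArray x 0, coordArray x 1, coordArray t 0, coordArray t 1, α, R, δ⟩

section sceneOf

variable {m n : ℕ} {x : Fin m → Plane} {t : Fin n → Plane} {α R δ : ℝ}

theorem sceneOf_vec (i : Fin m) (j : Fin n) :
    (sceneOf x t α R δ).vec i j = (x i 0 - t j 0, x i 1 - t j 1) := by
  simp [sceneOf, Scene.vec, coordArray]

theorem sceneOf_sqrt_distSq (i : Fin m) (j : Fin n) :
    Real.sqrt ((sceneOf x t α R δ).distSq i j) = dist (x i) (t j) := by
  rw [Scene.distSq, sceneOf_vec, dist_plane]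

theorem sceneOf_visible (i : Fin m) (j : Fin n) :
    (sceneOf x t α R δ).Visible i j ↔ x i ≠ t j ∧ dist (x i) (t j) ≤ R := by
  rw [Scene.Visible, sceneOf_sqrt_distSq, ← Real.sqrt_pos, sceneOf_sqrt_distSq, dist_pos]
  rfl

theorem sceneOf_pairCovers {β : ℝ} (i i' : Fin m) (j : Fin n) :
    PairCovers β (x i) (x i') (t j) ↔ x i ≠ x i' ∧ x i ≠ t j ∧ x i' ≠ t j ∧
      β ≤ (sceneOf x t α R δ).ang i i' j := by
  rw [PairCovers, angle_mem_Icc_iff, Scene.ang, sceneOf_vec, sceneOf_vec]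

end sceneOf

section solution

variable {X T : Finset Plane} (x : Fin X.card ≃ X) (t : Fin T.card ≃ T) {α R δ : ℝ}

/-- An optimal set of sensors shows that the input is one the algorithm can handle. -/
theorem valid_sceneOf (h0 : 0 ≤ α) (hα : α ≤ Real.pi / 3) (hcov : CoversWithin α R X T)
    (hT : 0 < T.card) {l : ℕ} (hl : X.card ≤ 2 ^ l) :
    Valid (sceneOf (fun i => (x i : Plane)) (fun j => (t j : Plane)) α R δ) l (kOpt α R X T) := by
  obtain ⟨S, hSX, hS, hSk⟩ : kOpt α R X T ∈
      {k : ℕ | ∃ S ⊆ X, CoversWithin α R S T ∧ S.card = k} :=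
    Nat.sInf_mem ⟨X.card, X, Finset.Subset.refl X, hcov, rfl⟩
  have hfeas : ∀ j : Fin T.card, ∃ i i' : Fin X.card, (x i : Plane) ∈ S ∧ (x i' : Plane) ∈ S ∧
      PairCovers α (x i : Plane) (x i') (t j) ∧ dist (x i : Plane) (t j) ≤ R ∧
      dist (x i' : Plane) (t j) ≤ R := by
    intro j
    obtain ⟨s, hs, s', hs', h1, h2, h3⟩ := hS (t j) (t j).2
    refine ⟨x.symm ⟨s, hSX hs⟩, x.symm ⟨s', hSX hs'⟩, ?_⟩
    simpa using ⟨hs, hs', h1, h2, h3⟩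
  refine ⟨hT, ?_, ?_, h0, hα, ?_, hl⟩
  · obtain ⟨i, i', h1, h2, h3, -⟩ := hfeas ⟨0, hT⟩
    rw [← hSk]
    exact one_lt_card.2 ⟨_, h1, _, h2, h3.1⟩
  · refine ⟨(univ.filter fun i => (x i : Plane) ∈ S).map Fin.valEmbedding, ?_, ?_, ?_⟩
    · intro s hs
      obtain ⟨i, -, rfl⟩ := mem_map.1 hs
      exact mem_range.2 i.2
    · rw [card_map, ← hSk]
      refine card_bij (fun i _ => (x i : Plane)) (by simp) (fun i _ i' _ h => ?_) fun s hs => ?_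
      · exact x.injective (Subtype.ext h)
      · exact ⟨x.symm ⟨s, hSX hs⟩, by simpa using hs, by simp⟩
    · intro j hj
      obtain ⟨i, i', h1, h2, h3, h4, h5⟩ := hfeas ⟨j, hj⟩
      have hmem : ∀ i : Fin X.card, (x i : Plane) ∈ S →
          (i : ℕ) ∈ (univ.filter fun i => (x i : Plane) ∈ S).map Fin.valEmbedding :=
        fun i hi => mem_map.2 ⟨i, by simpa using hi, rfl⟩
      have h3' := (sceneOf_pairCovers (x := fun i => (x i : Plane))
        (t := fun j => (t j : Plane)) (R := R) (δ := δ) (α := α) i i' ⟨j, hj⟩).1 h3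
      refine ⟨i, hmem i h1, i', hmem i' h2, ?_, ?_, ?_, h3'.2.2.2⟩
      · intro h
        exact h3.1 (by rw [Fin.ext h])
      · exact (sceneOf_visible (x := fun i => (x i : Plane)) (t := fun j => (t j : Plane)) i
          ⟨j, hj⟩).2 ⟨h3.2.1, h4⟩
      · exact (sceneOf_visible (x := fun i => (x i : Plane)) (t := fun j => (t j : Plane)) i'
          ⟨j, hj⟩).2 ⟨h3.2.2.1, h5⟩
  · intro s hs s' hs' h1 h2
    have hs : s < X.card := hs
    have hs' : s' < X.card := hs'
    have h3 : x ⟨s, hs⟩ = x ⟨s', hs'⟩ := by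
      refine Subtype.ext ?_
      ext i
      simp only [sceneOf, coordArray, hs, hs', dif_pos] at h1 h2
      fin_cases i
      exacts [h1, h2]
    exact congrArg Fin.val (x.injective h3)

/-- The pairs that witness the state after `r` rounds show that the output covers all targets. -/
theorem coversWithin_outputSet {r : ℕ} {σ : Store} (h0 : 0 ≤ α) (hδ : 1 < δ)
    (hr : 0 < r) (hδr : δ ≤ 2 ^ r) {S : Finset ℕ}
    (hS : Encodes nSelected X.card S σ)
    (hP : HasPairs (sceneOf (fun i => (x i : Plane)) (fun j => (t j : Plane)) α R δ) S r σ) :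
    CoversWithin ((1 - 1 / δ) * α) R (outputSet (fun i => (x i : Plane)) σ) T := by
  intro a ha
  obtain ⟨j, rfl⟩ : ∃ j, (t j : Plane) = a := ⟨t.symm ⟨a, ha⟩, by simp⟩
  have hj := hP j j.2
  set p := σ.nat nFst j
  set q := σ.nat nSnd j
  have hp : p < X.card := hS.lt p hj.fst_mem
  have hq : q < X.card := hS.lt q hj.snd_mem
  have hout : ∀ s (hs : s < X.card), s ∈ S →
      (x ⟨s, hs⟩ : Plane) ∈ outputSet (fun i => (x i : Plane)) σ := by
    intro s hs hsS
    exact mem_image.2 ⟨⟨s, hs⟩, by simpa using (hS.mem s hs).2 hsS, rfl⟩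
  have hvp := (sceneOf_visible (x := fun i => (x i : Plane)) (t := fun j => (t j : Plane))
    ⟨p, hp⟩ j).1 hj.fst_visible
  have hvq := (sceneOf_visible (x := fun i => (x i : Plane)) (t := fun j => (t j : Plane))
    ⟨q, hq⟩ j).1 hj.snd_visible
  refine ⟨_, hout p hp hj.fst_mem, _, hout q hq hj.snd_mem, ?_, hvp.2, hvq.2⟩
  refine (sceneOf_pairCovers (x := fun i => (x i : Plane)) (t := fun j => (t j : Plane)) (α := α)
    (R := R) (δ := δ) ⟨p, hp⟩ ⟨q, hq⟩ j).2 ⟨?_, hvp.1, hvq.1, ?_⟩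
  · intro h
    exact hj.ne hr.ne' (congrArg Fin.val (x.injective (Subtype.ext h)))
  · have h1 : (1 / 2 : ℝ) ^ r ≤ 1 / δ := by
      rw [one_div_pow]
      exact one_div_le_one_div_of_le (by linarith) hδr
    have h2 : α * (1 - (1 / 2) ^ r) ≤ σ.real rAngle j := hj.le
    have h3 : σ.real rAngle j =
        (sceneOf (fun i => (x i : Plane)) (fun j => (t j : Plane)) α R δ).ang p q j := hj.angle
    have h4 : α * (1 / 2 : ℝ) ^ r ≤ α * (1 / δ) := by gcongr
    change (1 - 1 / δ) * α ≤
      (sceneOf (fun i => (x i : Plane)) (fun j => (t j : Plane)) α R δ).ang p q j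
    rw [← h3]
    linarith

theorem card_outputSet_le {σ : Store} {S : Finset ℕ} (hS : Encodes nSelected X.card S σ) :
    (outputSet (fun i => (x i : Plane)) σ).card ≤ S.card := by
  refine card_image_le.trans ?_
  rw [← card_map Fin.valEmbedding]
  refine card_le_card fun s hs => ?_
  obtain ⟨i, hi, rfl⟩ := mem_map.1 hs
  exact (hS.mem i i.2).1 (by simpa using hi)

/-- The program in terms of natural number bounds, for a nonempty set of targets. -/
theorem placeSensors_achieves {D : ℕ} (h0 : 0 ≤ α) (hα : α ≤ Real.pi / 3) (hδ : 1 < δ)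
    (hcov : CoversWithin α R X T) (hT : 0 < T.card) (hD : δ ≤ 2 ^ D) :
    ∃ l : ℕ, 2 ^ l ≤ 2 * X.card ∧ 2 ≤ kOpt α R X T ∧ kOpt α R X T ≤ X.card ∧
      Achieves placeSensors ((D + 2) * (2 ^ 42 * (X.card * T.card) * l * kOpt α R X T))
        (fun σ => CoversWithin ((1 - 1 / δ) * α) R (outputSet (fun i => (x i : Plane)) σ) T ∧
          (outputSet (fun i => (x i : Plane)) σ).card ≤ (D + 1) * roundSize (kOpt α R X T))
        (inputStore (fun i => (x i : Plane)) (fun j => (t j : Plane)) α R δ) := by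
  set c := sceneOf (fun i => (x i : Plane)) (fun j => (t j : Plane)) α R δ with hc
  set k := kOpt α R X T with hk
  set σ₀ := inputStore (fun i => (x i : Plane)) (fun j => (t j : Plane)) α R δ with hσ₀
  have hX : X.card ≤ 2 ^ Nat.clog 2 X.card := Nat.le_pow_clog (by norm_num) _
  have hval : Valid c (Nat.clog 2 X.card) k := valid_sceneOf x t h0 hα hcov hT hX
  have hkX : k ≤ X.card := hval.le
  have hk2 := hval.two_le
  have hm : 0 < X.card := by omega
  have hm₀ : σ₀.nat nDims 0 = X.card := rfl
  have hn₀ : σ₀.nat nDims 1 = T.card := rfl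
  -- the program computes the only `l` with these properties
  obtain ⟨l, hl, hl'⟩ : ∃ l, X.card ≤ 2 ^ l ∧ 2 ^ l < 2 * X.card := by
    refine ⟨Nat.clog 2 X.card, hX, ?_⟩
    have h1 := Nat.pow_pred_clog_lt_self (b := 2) (by norm_num) (show 1 < X.card by omega)
    have h2 : 0 < Nat.clog 2 X.card := Nat.clog_pos (by norm_num) (by omega)
    obtain ⟨a, ha⟩ : ∃ a, Nat.clog 2 X.card = a + 1 := ⟨_, (Nat.succ_pred_eq_of_pos h2).symm⟩
    rw [ha, Nat.pred_succ] at h1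
    rw [ha, pow_succ]
    omega
  have hluniq : ∀ l', X.card ≤ 2 ^ l' → 2 ^ l' < 2 * X.card → l' = l := by
    intro l' h1 h2
    have h3 : 2 ^ l' < 2 ^ (l + 1) := by rw [pow_succ]; omega
    have h4 : 2 ^ l < 2 ^ (l' + 1) := by rw [pow_succ]; omega
    have h5 := (Nat.pow_lt_pow_iff_right (by norm_num)).1 h3
    have h6 := (Nat.pow_lt_pow_iff_right (by norm_num)).1 h4
    omega
  have hvalid : Valid c l k := { hval with le_two_pow := hl }
  refine ⟨l, hl'.le, hk2, hkX, ?_⟩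
  have hpos : X.card * T.card ≤ X.card * T.card * l * k := by
    rw [mul_assoc _ l]
    exact Nat.le_mul_of_pos_right _ (Nat.mul_pos hvalid.one_le (by omega))
  have hmn : T.card ≤ X.card * T.card := Nat.le_mul_of_pos_left T.card hm
  have hmn' : X.card ≤ X.card * T.card := Nat.le_mul_of_pos_right X.card hT
  have hbudget : (D + 2) * (2 ^ 41 * (X.card * T.card) * l * k) +
      1000 * (X.card * T.card * l * k) ≤
      (D + 2) * (2 ^ 42 * (X.card * T.card) * l * k) := by
    have e1 : (D + 2) * (2 ^ 42 * (X.card * T.card) * l * k) =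
        (D + 2) * (2 ^ 41 * (X.card * T.card) * l * k) +
          (D + 2) * 2 ^ 41 * (X.card * T.card * l * k) := by ring
    rw [e1]
    gcongr
    omega
  refine Achieves.branch (τ₁ := (D + 2) * (2 ^ 41 * (X.card * T.card) * l * k) +
    900 * (X.card * T.card * l * k)) (fun hb => ?_) (fun _ => ?_) ?_
  · exact absurd hT (not_lt.2 hb)
  · refine Achieves.seq (τ₁ := 40 * T.card + 20)
      (τ₂ := (D + 2) * (2 ^ 41 * (X.card * T.card) * l * k) +
        800 * (X.card * T.card * l * k)) ?_ (by omega)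
    refine (setOffsets_achieves hm₀ hn₀).imp le_rfl fun σ₁ hF₁ hbase => ?_
    refine Achieves.seq (τ₁ := 50 * X.card + 50)
      (τ₂ := (D + 2) * (2 ^ 41 * (X.card * T.card) * l * k)) ?_ (by omega)
    refine (setLogCols_achieves (m := X.card) (by rw [hF₁.nat _ (by decide), hm₀])
      hm).imp le_rfl ?_
    rintro σ₂ hF₂ ⟨l', hlog, hl1, hl2⟩
    obtain rfl : l' = l := hluniq l' hl1 hl2
    have hr : ∀ a < 5, σ₂.real a = σ₀.real a := fun a ha =>
      (hF₂.real a (by revert a; decide)).trans (hF₁.real a (by revert a; decide))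
    have hnat : σ₂.nat nDims = σ₀.nat nDims :=
      (hF₂.nat _ (by decide)).trans (hF₁.nat _ (by decide))
    have hsc : HasScene c l' σ₂ := by
      refine ⟨?_, ?_, ?_, ?_, ?_, ?_, ?_, ?_, ?_, ?_, hlog⟩
      · rw [hnat]; rfl
      · rw [hnat]; rfl
      · rw [hF₂.nat _ (by decide)]; exact hbase
      all_goals rw [hr _ (by decide)]; rfl
    have hsel : ∀ s, σ₂.nat nSelected s = 0 := by
      intro s
      rw [hF₂.nat _ (by decide), hF₁.nat _ (by decide)]
      rfl
    refine (runRounds_achieves hvalid hsc hsel hδ hD).imp le_rfl ?_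
    rintro σ₃ - ⟨r, hr0, hrD, hδr, -, S, hS, hcard, hP⟩
    refine ⟨coversWithin_outputSet x t (R := R) h0 hδ hr0 hδr hS hP, ?_⟩
    refine (card_outputSet_le x hS).trans (hcard.trans ?_)
    gcongr
  · have : (Test.leNat (.get nDims (.const 1)) (.const 0)).cost = 4 := rfl
    omega

end solution

theorem mainTheorem3 :
    ∃ (P : RealRAM.Program) (C : ℝ), 0 < C ∧
      ∀ (X T : Finset Plane) (x : Fin X.card ≃ X) (t : Fin T.card ≃ T) (α R δ : ℝ),
        0 ≤ α → α ≤ Real.pi / 3 → 1 < δ → CoversWithin α R X T →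
        ∃ (τ : ℕ) (σ : RealRAM.Store),
          RealRAM.Runs P (inputStore (fun i => (x i : Plane)) (fun j => (t j : Plane)) α R δ) τ σ ∧
          outputSet (fun i => (x i : Plane)) σ ⊆ X ∧
          CoversWithin ((1 - 1 / δ) * α) R (outputSet (fun i => (x i : Plane)) σ) T ∧
          ((outputSet (fun i => (x i : Plane)) σ).card : ℝ) ≤
            C * max 1 (Real.logb 2 δ) * Real.log (kOpt α R X T) * kOpt α R X T ∧
          (τ : ℝ) ≤
            C * (max 1 (Real.logb 2 δ) * kOpt α R X T * X.card * T.card * Real.log X.card + 1) := by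
  refine ⟨placeSensors, 2 ^ 46, by norm_num, ?_⟩
  intro X T x t α R δ h0 hα hδ hcov
  have hsub : ∀ σ : Store, outputSet (fun i => (x i : Plane)) σ ⊆ X := by
    intro σ a ha
    obtain ⟨i, -, rfl⟩ := mem_image.1 ha
    exact (x i).2
  set L := max 1 (Real.logb 2 δ) with hL
  set k := kOpt α R X T
  have hL1 : 1 ≤ L := le_max_left _ _
  have hlogk : 0 ≤ Real.log k := Real.log_natCast_nonneg k
  have hlogm : 0 ≤ Real.log X.card := Real.log_natCast_nonneg _
  rcases Nat.eq_zero_or_pos T.card with hT | hT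
  · -- without targets the program stops at once, with empty output
    have hrun : Achieves placeSensors 6 (fun σ => ∀ s, σ.nat nSelected s = 0)
        (inputStore (fun i => (x i : Plane)) (fun j => (t j : Plane)) α R δ) := by
      refine Achieves.branch (τ₁ := 1) (fun _ => ?_) (fun hb => absurd ?_ hb) (by decide)
      · exact Achieves.of_wp (p := .skip) (fun _ => rfl) le_rfl
      · exact hT.le
    obtain ⟨τ, σ, hrun, hτ, hσ⟩ := hrun
    have hempty : outputSet (fun i => (x i : Plane)) σ = ∅ := by
      simp [outputSet, hσ]
    refine ⟨τ, σ, hrun, hsub σ, ?_, ?_, ?_⟩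
    · rw [card_eq_zero.1 hT]
      intro a ha
      simp at ha
    · rw [hempty, card_empty, Nat.cast_zero]
      positivity
    · have : (τ : ℝ) ≤ 6 := by exact_mod_cast hτ
      have h1 : 0 ≤ L * k * X.card * T.card * Real.log X.card := by positivity
      linarith
  · set D := ⌈Real.logb 2 δ⌉₊ with hDdef
    have hlogδ : 0 < Real.logb 2 δ := Real.logb_pos (by norm_num) hδ
    have hD : δ ≤ 2 ^ D := by
      calc δ = (2 : ℝ) ^ Real.logb 2 δ :=
            (Real.rpow_logb (by norm_num) (by norm_num) (by linarith)).symm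
        _ ≤ (2 : ℝ) ^ (D : ℝ) := Real.rpow_le_rpow_of_exponent_le (by norm_num) (Nat.le_ceil _)
        _ = 2 ^ D := Real.rpow_natCast _ _
    have hDL : (D : ℝ) ≤ L + 1 :=
      (Nat.ceil_lt_add_one hlogδ.le).le.trans (by linarith [le_max_right 1 (Real.logb 2 δ)])
    obtain ⟨l, hl, hk2, hkX, τ, σ, hrun, hτ, hcovers, hcard⟩ :=
      placeSensors_achieves x t h0 hα hδ hcov hT hD
    refine ⟨τ, σ, hrun, hsub σ, hcovers, ?_, ?_⟩
    · have h1 : ((outputSet (fun i => (x i : Plane)) σ).card : ℝ) ≤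
          ((D + 1) * roundSize k : ℕ) := by exact_mod_cast hcard
      have h2 : (Nat.log 2 (2 * k) : ℝ) ≤ 4 * Real.log k :=
        le_four_mul_log hk2 (Nat.pow_log_le_self 2 (by omega))
      unfold roundSize at h1
      push_cast at h1
      calc ((outputSet (fun i => (x i : Plane)) σ).card : ℝ)
          ≤ (D + 1) * (2 ^ 20 * (2 * k) * Nat.log 2 (2 * k)) := h1.trans_eq (by norm_num)
        _ ≤ (3 * L) * (2 ^ 20 * (2 * k) * (4 * Real.log k)) := by gcongr; linarith
        _ = (3 * 2 ^ 23) * (L * Real.log k * k) := by ring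
        _ ≤ 2 ^ 46 * (L * Real.log k * k) := by gcongr; norm_num
        _ = 2 ^ 46 * L * Real.log k * k := by ring
    · have h1 : (τ : ℝ) ≤ ((D + 2) * (2 ^ 42 * (X.card * T.card) * l * k) : ℕ) := by
        exact_mod_cast hτ
      have h2 : (l : ℝ) ≤ 4 * Real.log X.card := le_four_mul_log (hk2.trans hkX) hl
      push_cast at h1
      calc (τ : ℝ) ≤ (D + 2) * (2 ^ 42 * (X.card * T.card) * l * k) := h1.trans_eq (by norm_num)
        _ ≤ (4 * L) * (2 ^ 42 * (X.card * T.card) * (4 * Real.log X.card) * k) := by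
            gcongr; linarith
        _ = 2 ^ 46 * (L * k * X.card * T.card * Real.log X.card) := by ring
        _ ≤ 2 ^ 46 * (L * k * X.card * T.card * Real.log X.card + 1) := by linarith
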